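/- An implicit set system is a function $\Phi$ that maps every string $I\in\{0,1\}^*$ (an instance, of size $N=|I|$) to a pair $(U_I,\mathcal F_I)$, where $U_I$ is a finite set with $n=|U_I|\le N$ elements and $\mathcal F_I$ is a collection of subsets of $U_I$. It is polynomial time computable if there is a polynomial time algorithm that produces $U_I$ from $I$, and a polynomial time algorithm that, given $I$, $U_I$ and $S\subseteq U_I$, decides whether $S\in\mathcal F_I$. The problem $\Phi$-Extension is to decide, given $I$, a set $X\subseteq U_I$ and an integer $k\ge 0$, whether there is a set $S\subseteq U_I\setminus X$ with $S\cup X\in\mathcal F_I$ and $|S|\le k$. The problem $\Phi$-Subset is, given $I$, to output a set $S\in\mathcal F_I$ if one exists, and to answer No otherwise. Theorem 1. Let $\Phi$ be a polynomial time computable implicit set system and let $b,c\ge 1$ be real constants. If there is a (deterministic) algorithm for $\Phi$-Extension with running time $b^{\,n-|X|}\,c^{\,k}\,N^{O(1)}$, then there is a randomized algorithm for $\Phi$-Subset with running time $\left(1+b-\frac1c\right)^{n}N^{O(1)}$ and one-sided error: for every outcome of its coin tosses it halts within this time and outputs either No or a set in $\mathcal F_I$ (so it always answers No if $\mathcal F_I=\emptyset$),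 and if $\mathcal F_I\ne\emptyset$, then it outputs a set in $\mathcal F_I$ with probability greater than $\frac12$. -/

import Mathlib

open scoped ENNReal

namespace PhiSubset

/-! ### The machine model

A small imperative language over binary trees (the data of LISP and of pointer machines), with a
fair coin toss as one of its commands. Programs have finitely many variables, each holding a tree;
one unit of time is charged for every elementary command and every evaluation of a test. A program
has constant size, so each step manipulates boundedly many cells; subtrees are shared, never
copied. -/

/-- Data values: binary trees. -/
inductive Data : Type
  | nil : Data
  | cons : Data → Data → Data

/-- Left component of a tree; `nil` for the empty tree. -/
def Data.hd : Data → Data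
  | .nil => .nil
  | .cons a _ => a

/-- Right component of a tree; `nil` for the empty tree. -/
def Data.tl : Data → Data
  | .nil => .nil
  | .cons _ d => d

/-- The test made by conditionals and loops: is the tree non-empty? -/
def Data.isCons : Data → Bool
  | .nil => false
  | .cons _ _ => true

/-- Expressions; variables are numbered by natural numbers. -/
inductive Expr : Type
  | var : ℕ → Expr
  | nil : Expr
  | cons : Expr → Expr → Expr
  | hd : Expr → Expr
  | tl : Expr → Expr

/-- A store assigns a tree to every variable. -/
abbrev Store : Type := ℕ → Data

/-- Value of an expression in a store. -/
def Expr.eval (s : Store) : Expr → Data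
  | .var x => s x
  | .nil => .nil
  | .cons e f => .cons (e.eval s) (f.eval s)
  | .hd e => (e.eval s).hd
  | .tl e => (e.eval s).tl

/-- Programs. `flip x` tosses a fair coin and stores the result in variable `x`. -/
inductive Cmd : Type
  | assign : ℕ → Expr → Cmd
  | flip : ℕ → Cmd
  | seq : Cmd → Cmd → Cmd
  | ite : Expr → Cmd → Cmd → Cmd
  | loop : Expr → Cmd → Cmd

/-- A program is deterministic if it contains no coin toss. -/
def Cmd.Deterministic : Cmd → Prop
  | .assign _ _ => True
  | .flip _ => False
  | .seq p q => p.Deterministic ∧ q.Deterministic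
  | .ite _ p q => p.Deterministic ∧ q.Deterministic
  | .loop _ p => p.Deterministic

/-- A configuration: the commands still to be executed, in order, and the store. -/
structure Cfg : Type where
  todo : List Cmd
  store : Store

/-- The tree that represents a truth value (or a bit). -/
def Data.ofBool : Bool → Data
  | false => .nil
  | true => .cons .nil .nil

/-- One step of computation, where `coin` is the outcome of the toss if the step is a coin toss
(and is ignored otherwise). A configuration with nothing left to do stays as it is. -/
def step (coin : Bool) : Cfg → Cfg
  | ⟨[], s⟩ => ⟨[], s⟩
  | ⟨.assign x e :: K, s⟩ => ⟨K, Function.update s x (e.eval s)⟩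
  | ⟨.flip x :: K, s⟩ => ⟨K, Function.update s x (Data.ofBool coin)⟩
  | ⟨.seq p q :: K, s⟩ => ⟨p :: q :: K, s⟩
  | ⟨.ite e p q :: K, s⟩ => ⟨(if (e.eval s).isCons then p else q) :: K, s⟩
  | ⟨.loop e p :: K, s⟩ => ⟨if (e.eval s).isCons then p :: .loop e p :: K else K, s⟩

/-- Initial configuration: the input is in variable `0`, all other variables are empty. -/
def start (P : Cmd) (input : Data) : Cfg :=
  ⟨[P], Function.update (fun _ => Data.nil) 0 input⟩

/-- A configuration has halted if nothing is left to do; its output is the value of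
variable `0`. -/
def Cfg.Halted (C : Cfg) : Prop := C.todo = []

/-- The output of a configuration. -/
def Cfg.output (C : Cfg) : Data := C.store 0

/-- The distribution of the configuration reached after `t` steps, with independent fair coins. -/
noncomputable def runDist : ℕ → Cfg → PMF Cfg
  | 0, C => PMF.pure C
  | t + 1, C => (PMF.uniformOfFintype Bool).bind fun coin => runDist t (step coin C)

/-- The deterministic program `P` on this input halts after at most `T` steps with an output
satisfying `Q`. (A deterministic program never looks at the coin.) -/
def HaltsWithin (P : Cmd) (input : Data) (T : ℝ) (Q : Data → Prop) : Prop :=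
  ∃ t : ℕ, (t : ℝ) ≤ T ∧ ((step false)^[t] (start P input)).Halted ∧
    Q ((step false)^[t] (start P input)).output

/-! ### Encodings -/

/-- Lists of trees as trees. -/
def Data.ofList : List Data → Data
  | [] => .nil
  | d :: l => .cons d (Data.ofList l)

/-- Binary strings as trees. -/
def Data.ofStr (w : List Bool) : Data := Data.ofList (w.map Data.ofBool)

/-- Lists of binary strings as trees. -/
def Data.ofStrs (l : List (List Bool)) : Data := Data.ofList (l.map Data.ofStr)

/-- Natural numbers (in unary) as trees. -/
def Data.ofNat (k : ℕ) : Data := Data.ofList (List.replicate k Data.nil)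

/-- Finite sets of strings are handed over as lists of their elements, in any order, without
repetition. -/
def Lists (l : List (List Bool)) (S : Finset (List Bool)) : Prop :=
  l.Nodup ∧ l.toFinset = S

/-- The input `(I, X, k)`, with `X` given by the list `l`. -/
def extensionInput (I : List Bool) (l : List (List Bool)) (k : ℕ) : Data :=
  .cons (Data.ofStr I) (.cons (Data.ofStrs l) (Data.ofNat k))

/-- The answer "no" to a search problem. -/
def noAnswer : Data := .nil

/-- The tree `d` is the answer "yes, and here is the set `S`" to a search problem. -/
def IsSetAnswer (d : Data) (S : Finset (List Bool)) : Prop :=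
  ∃ l, Lists l S ∧ d = .cons .nil (Data.ofStrs l)

/-! ### Implicit set systems and the two problems -/

/-- An implicit set system maps every binary string `I` (an instance, of size `N = I.length`) to a
finite universe `univ I`, of size `n ≤ N`, and a collection `sets I` of subsets of it. The elements
of the universe are binary strings. -/
structure ImplicitSetSystem : Type where
  univ : List Bool → Finset (List Bool)
  sets : List Bool → Set (Finset (List Bool))
  subset_univ : ∀ I, ∀ S ∈ sets I, S ⊆ univ I
  card_univ_le : ∀ I, (univ I).card ≤ I.length

/-- There are a deterministic polynomial-time algorithm that produces the universe of a given
instance, and one that decides, given `I`, its universe and a subset `S` of the universe, whether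
`S` belongs to the collection. -/
def ImplicitSetSystem.PolyTimeComputable (Φ : ImplicitSetSystem) : Prop :=
  (∃ P : Cmd, P.Deterministic ∧ ∃ p : Polynomial ℕ, ∀ I : List Bool,
    HaltsWithin P (Data.ofStr I) ((p.eval I.length : ℕ) : ℝ)
      fun d => ∃ l, Lists l (Φ.univ I) ∧ d = Data.ofStrs l) ∧
  (∃ P : Cmd, P.Deterministic ∧ ∃ p : Polynomial ℕ, ∀ (I : List Bool) (S : Finset (List Bool))
    (u l : List (List Bool)), S ⊆ Φ.univ I → Lists u (Φ.univ I) → Lists l S →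
    ∃ r : Bool, (r = true ↔ S ∈ Φ.sets I) ∧
      HaltsWithin P (.cons (Data.ofStr I) (.cons (Data.ofStrs u) (Data.ofStrs l)))
        ((p.eval I.length : ℕ) : ℝ) fun d => d = Data.ofBool r)

/-- `(I, X, k)` is a yes-instance of the extension problem: some `S ⊆ univ I \ X` with `|S| ≤ k`
satisfies `S ∪ X ∈ sets I`. -/
def ImplicitSetSystem.Extendable (Φ : ImplicitSetSystem) (I : List Bool)
    (X : Finset (List Bool)) (k : ℕ) : Prop :=
  ∃ S : Finset (List Bool), S ⊆ Φ.univ I \ X ∧ S ∪ X ∈ Φ.sets I ∧ S.card ≤ k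

/-- The deterministic program `P` decides the extension problem, using at most `T I X k` steps on
`(I, X, k)`. -/
def ImplicitSetSystem.SolvesExtension (Φ : ImplicitSetSystem) (P : Cmd)
    (T : List Bool → Finset (List Bool) → ℕ → ℝ) : Prop :=
  P.Deterministic ∧ ∀ (I : List Bool) (X : Finset (List Bool)) (l : List (List Bool)) (k : ℕ),
    X ⊆ Φ.univ I → Lists l X →
    ∃ r : Bool, (r = true ↔ Φ.Extendable I X k) ∧
      HaltsWithin P (extensionInput I l k) (T I X k) fun d => d = Data.ofBool r

/-- The randomized program `P` solves the subset problem (find a member of `sets I` if there is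
one) with one-sided error, using at most `T I` steps on `I`: whatever the coins, it halts in time,
and its output is either "no" or a member of `sets I`; and if `sets I` is non-empty, then it outputs
a member of `sets I` with probability greater than `1/2`. -/
def ImplicitSetSystem.RandomizedSolvesSubset (Φ : ImplicitSetSystem) (P : Cmd)
    (T : List Bool → ℝ) : Prop :=
  ∀ I : List Bool, ∃ t : ℕ, (t : ℝ) ≤ T I ∧
    (∀ C ∈ (runDist t (start P (Data.ofStr I))).support,
      C.Halted ∧ (C.output = noAnswer ∨ ∃ S ∈ Φ.sets I, IsSetAnswer C.output S)) ∧
    ((Φ.sets I).Nonempty →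
      (1 / 2 : ℝ≥0∞) < (runDist t (start P (Data.ofStr I))).toOuterMeasure
        {C | ∃ S ∈ Φ.sets I, IsSetAnswer C.output S})

end PhiSubset

/-! Let `S` be a member of the collection with `k` elements, in a universe of size `n`. A random
`t`-subset `X` of the universe lies inside `S` with probability C(k,t)/C(n,t), the inverse of `ratio
n k t`, and then the extension algorithm accepts `(X, k - t)`. So about `ratio n k t` samples
suffice, each costing b^(n-t) c^(k-t) up to a polynomial factor. An accepted sample is completed to
an actual set by self-reduction, testing the remaining elements one at a time (`tri_greedy`).

The analytic core is `exists_good_sample_card`: for every `k` some `t ≤ k` makes ratio · b^(n-t)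
c^(k-t) at most 2(n+1)(1+b-1/c)^n. Put x = 1/(bc), so that 1+b-1/c = 1+b(1-x). If k ≤ xn, then t = 0
works by weighted AM-GM. Otherwise let r = n-k and j = k-t. Since ratio · C(j+r,r) = C(n,k), a large
term C(j+r,r)x^j with j ≤ k is wanted. All these terms sum to (1-x)^(-r-1). They do not increase
beyond k and decay geometrically beyond 2k, so the largest one with j ≤ k carries the sum up to the
factor 2k+2/(1-x) (`exists_large_nbTerm`). The claim then follows because C(n,k)(b(1-x))^r is a
single term of the binomial expansion of (1+b(1-x))^n.

The constants `b` and `c` are arbitrary reals, so the program does not compute the best `t`. It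
works in phases j = 0, 1, ... with time limit 2^j and tries all pairs (k,t) within this limit. It
stops when a set has been found, or when for every `k` the search was completed for some `t`
(`tri_tryAll`). The limit is enforced by a program transformation that leaves every loop once a
clock is empty (`exists_tri_clocked`). A phase costs a polynomial times its limit, so the last phase
dominates, and `exists_phase` bounds its number.

Each phase uses fresh coins, shared by its pairs. An unlucky early stop is controlled by a union
bound over `t` for the one right `k`: it has probability at most 2^(-3-j) in phase j (`avg_bad_le`).
Summing over the phases, success has probability at least 3/4 (`spec_mainLoop`). Drawing an element
with 2n+2 coins is slightly biased, which costs at most a factor 3/4 in the probability that a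
sample lies in `S` (`three_quarters_le_hitBound`). Probabilities are computed as averages over lists
of coins (`avg`) and related to `runDist` through `Spec`. -/

namespace PhiSubset

/-! ### Big-step semantics of deterministic programs -/

/-- `BigStep p s t s'`: started in the store `s`, the program `p` halts after exactly `t` steps,
without tossing a coin, in the store `s'`. -/
inductive BigStep : Cmd → Store → ℕ → Store → Prop
  | assign (x : ℕ) (e : Expr) (s : Store) :
      BigStep (.assign x e) s 1 (Function.update s x (e.eval s))
  | seq {p q : Cmd} {s s' s'' : Store} {t t' : ℕ} :
      BigStep p s t s' → BigStep q s' t' s'' → BigStep (.seq p q) s (t + t' + 1) s''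
  | ite_true {e : Expr} {p q : Cmd} {s s' : Store} {t : ℕ} :
      (e.eval s).isCons = true → BigStep p s t s' → BigStep (.ite e p q) s (t + 1) s'
  | ite_false {e : Expr} {p q : Cmd} {s s' : Store} {t : ℕ} :
      (e.eval s).isCons = false → BigStep q s t s' → BigStep (.ite e p q) s (t + 1) s'
  | loop_done {e : Expr} {p : Cmd} {s : Store} :
      (e.eval s).isCons = false → BigStep (.loop e p) s 1 s
  | loop_step {e : Expr} {p : Cmd} {s s' s'' : Store} {t t' : ℕ} :
      (e.eval s).isCons = true → BigStep p s t s' → BigStep (.loop e p) s' t' s'' →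
      BigStep (.loop e p) s (t + t' + 1) s''

/-- Used in `exists_tri_clocked` to identify the run with the step bound and the run with the
simulation property. -/
theorem BigStep.unique {p : Cmd} {s s₁ s₂ : Store} {t₁ t₂ : ℕ} (h₁ : BigStep p s t₁ s₁)
    (h₂ : BigStep p s t₂ s₂) : t₁ = t₂ ∧ s₁ = s₂ := by
  induction h₁ generalizing t₂ s₂ with
  | assign x e s => cases h₂; exact ⟨rfl, rfl⟩
  | seq _ _ ih ih' =>
    cases h₂ with
    | seq a b =>
      obtain ⟨rfl, rfl⟩ := ih a
      obtain ⟨rfl, rfl⟩ := ih' b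
      exact ⟨rfl, rfl⟩
  | ite_true h _ ih =>
    cases h₂ with
    | ite_true _ a => obtain ⟨rfl, rfl⟩ := ih a; exact ⟨rfl, rfl⟩
    | ite_false h' _ => simp [h] at h'
  | ite_false h _ ih =>
    cases h₂ with
    | ite_false _ a => obtain ⟨rfl, rfl⟩ := ih a; exact ⟨rfl, rfl⟩
    | ite_true h' _ => simp [h] at h'
  | loop_done h =>
    cases h₂ with
    | loop_done _ => exact ⟨rfl, rfl⟩
    | loop_step h' _ _ => simp [h] at h'
  | loop_step h _ _ ih ih' =>
    cases h₂ with
    | loop_done h' => simp [h] at h'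
    | loop_step _ a b =>
      obtain ⟨rfl, rfl⟩ := ih a
      obtain ⟨rfl, rfl⟩ := ih' b
      exact ⟨rfl, rfl⟩

/-- Does the program assign to the variable `y`? -/
def Cmd.Writes : Cmd → ℕ → Prop
  | .assign x _, y => y = x
  | .flip x, y => y = x
  | .seq p q, y => p.Writes y ∨ q.Writes y
  | .ite _ p q, y => p.Writes y ∨ q.Writes y
  | .loop _ p, y => p.Writes y

theorem BigStep.frame {p : Cmd} {s s' : Store} {t : ℕ} (h : BigStep p s t s') (y : ℕ)
    (hy : ¬p.Writes y) : s' y = s y := by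
  induction h with
  | assign x e s => exact Function.update_of_ne hy _ _
  | seq _ _ ih ih' =>
    simp only [Cmd.Writes, not_or] at hy
    rw [ih' hy.2, ih hy.1]
  | ite_true _ _ ih => simp only [Cmd.Writes, not_or] at hy; exact ih hy.1
  | ite_false _ _ ih => simp only [Cmd.Writes, not_or] at hy; exact ih hy.2
  | loop_done _ => rfl
  | loop_step _ _ _ ih ih' => rw [ih' hy, ih hy]

/-- No coin is read on the way, so each step averages two equal distributions; the run only consumes
`t` of the steps. -/
theorem BigStep.runDist_eq {p : Cmd} {s s' : Store} {t : ℕ} (h : BigStep p s t s')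
    (K : List Cmd) (r : ℕ) : runDist (t + r) ⟨p :: K, s⟩ = runDist r ⟨K, s'⟩ := by
  induction h generalizing K r with
  | assign x e s => rw [Nat.add_comm]; simp [runDist, step]
  | @seq p q s s' s'' t t' _ _ ih ih' =>
    rw [show t + t' + 1 + r = (t + (t' + r)) + 1 by ring]
    simp [runDist, step, ih, ih']
  | @ite_true e p q s s' t h _ ih =>
    rw [show t + 1 + r = (t + r) + 1 by ring]
    simp [runDist, step, ih, h]
  | @ite_false e p q s s' t h _ ih =>
    rw [show t + 1 + r = (t + r) + 1 by ring]
    simp [runDist, step, ih, h]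
  | loop_done h => rw [Nat.add_comm]; simp [runDist, step, h]
  | @loop_step e p s s' s'' t t' h _ _ ih ih' =>
    rw [show t + t' + 1 + r = (t + (t' + r)) + 1 by ring]
    simp [runDist, step, ih, ih', h]

theorem step_iterate_nil (b : Bool) (s : Store) (t : ℕ) : (step b)^[t] ⟨[], s⟩ = ⟨[], s⟩ :=
  Function.iterate_fixed rfl t

/-- Halting means that the whole stack has been emptied, so its top command must have finished at
some moment, which splits the `t` steps. This turns the hypotheses on given programs, stated for
single steps, into big-step runs. -/
theorem exists_bigStep_of_halted {p : Cmd} (hp : p.Deterministic) {K : List Cmd}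
    (hK : ∀ q ∈ K, q.Deterministic) {s : Store} {t : ℕ}
    (h : ((step false)^[t] ⟨p :: K, s⟩).Halted) :
    ∃ t₁ t₂ s', t₁ + t₂ = t ∧ BigStep p s t₁ s' ∧
      (step false)^[t] ⟨p :: K, s⟩ = (step false)^[t₂] ⟨K, s'⟩ := by
  induction t using Nat.strong_induction_on generalizing p K s with
  | _ t ih =>
  cases t with
  | zero => simp [Cfg.Halted] at h
  | succ t =>
    rw [Function.iterate_succ_apply] at h ⊢
    cases p with
    | assign x e => exact ⟨1, t, _, Nat.add_comm _ _, .assign x e s, rfl⟩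
    | flip x => exact hp.elim
    | seq p q =>
      obtain ⟨t₁, t₂, s', rfl, h₁, e₁⟩ := ih t (Nat.lt_succ_self _) (p := p) (K := q :: K) hp.1
        (by simpa using ⟨hp.2, hK⟩) h
      have h' := h
      simp only [step] at h'
      rw [e₁] at h'
      obtain ⟨t₃, t₄, s'', rfl, h₂, e₂⟩ := ih t₂ (by omega) hp.2 hK h'
      exact ⟨t₁ + t₃ + 1, t₄, s'', by ring, .seq h₁ h₂, by simp only [step]; rw [e₁, e₂]⟩
    | ite e p q =>
      by_cases hc : (e.eval s).isCons = true
      · simp only [step, hc, if_true] at h ⊢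
        obtain ⟨t₁, t₂, s', rfl, h₁, e₁⟩ := ih t (Nat.lt_succ_self _) hp.1 hK h
        exact ⟨t₁ + 1, t₂, s', by ring, .ite_true hc h₁, e₁⟩
      · simp only [step, hc] at h ⊢
        obtain ⟨t₁, t₂, s', rfl, h₁, e₁⟩ := ih t (Nat.lt_succ_self _) hp.2 hK h
        exact ⟨t₁ + 1, t₂, s', by ring, .ite_false (by simpa using hc) h₁, e₁⟩
    | loop e p =>
      by_cases hc : (e.eval s).isCons = true
      · simp only [step, hc, if_true] at h ⊢
        obtain ⟨t₁, t₂, s', rfl, h₁, e₁⟩ := ih t (Nat.lt_succ_self _) (p := p) (K := .loop e p :: K) hp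
          (by simpa using ⟨hp, hK⟩) h
        rw [e₁] at h
        obtain ⟨t₃, t₄, s'', rfl, h₂, e₂⟩ := ih t₂ (by omega) (p := .loop e p) hp hK h
        exact ⟨t₁ + t₃ + 1, t₄, s'', by ring, .loop_step hc h₁ h₂, by rw [e₁, e₂]⟩
      · simp only [step, hc] at h ⊢
        exact ⟨1, t, s, Nat.add_comm _ _, .loop_done (by simpa using hc), rfl⟩

theorem HaltsWithin.exists_bigStep {P : Cmd} (hP : P.Deterministic) {d : Data} {T : ℝ}
    {Q : Data → Prop} (h : HaltsWithin P d T Q) :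
    ∃ t s', BigStep P (Function.update (fun _ => Data.nil) 0 d) t s' ∧ (t : ℝ) ≤ T ∧ Q (s' 0) := by
  obtain ⟨t, ht, hh, hQ⟩ := h
  obtain ⟨t₁, t₂, s', rfl, h₁, e₁⟩ := exists_bigStep_of_halted hP (K := []) (by simp) hh
  refine ⟨t₁, s', h₁, le_trans (by simp) ht, ?_⟩
  unfold start at hQ
  rwa [e₁, step_iterate_nil] at hQ

/-! ### Total correctness with time bounds -/

/-- Started in `s`, the program `p` halts within `τ` steps in a store satisfying `Q`. -/
def Tri (p : Cmd) (s : Store) (τ : ℕ) (Q : Store → Prop) : Prop :=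
  ∃ t s', BigStep p s t s' ∧ t ≤ τ ∧ Q s'

theorem Tri.assign {x : ℕ} {e : Expr} {s : Store} {Q : Store → Prop}
    (h : Q (Function.update s x (e.eval s))) : Tri (.assign x e) s 1 Q :=
  ⟨1, _, .assign x e s, le_rfl, h⟩

theorem Tri.seq {p q : Cmd} {s : Store} {τ τ' : ℕ} {Q : Store → Prop}
    (h : Tri p s τ fun s' => Tri q s' τ' Q) : Tri (.seq p q) s (τ + τ' + 1) Q := by
  obtain ⟨t, s', h₁, ht, t', s'', h₂, ht', hQ⟩ := h
  exact ⟨_, s'', .seq h₁ h₂, by omega, hQ⟩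

theorem Tri.ite {e : Expr} {p q : Cmd} {s : Store} {τ : ℕ} {Q : Store → Prop}
    (h₁ : (e.eval s).isCons = true → Tri p s τ Q) (h₂ : (e.eval s).isCons = false → Tri q s τ Q) :
    Tri (.ite e p q) s (τ + 1) Q := by
  cases hc : (e.eval s).isCons with
  | true =>
    obtain ⟨t, s', h, ht, hQ⟩ := h₁ hc
    exact ⟨_, s', .ite_true hc h, by omega, hQ⟩
  | false =>
    obtain ⟨t, s', h, ht, hQ⟩ := h₂ hc
    exact ⟨_, s', .ite_false hc h, by omega, hQ⟩

theorem Tri.conseq {p : Cmd} {s : Store} {τ τ' : ℕ} {Q Q' : Store → Prop} (h : Tri p s τ Q)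
    (hτ : τ ≤ τ') (hQ : ∀ s', (∀ y, ¬p.Writes y → s' y = s y) → Q s' → Q' s') : Tri p s τ' Q' := by
  obtain ⟨t, s', h, ht, hq⟩ := h
  exact ⟨t, s', h, by omega, hQ s' h.frame hq⟩

theorem Tri.mono {p : Cmd} {s : Store} {τ τ' : ℕ} {Q : Store → Prop} (h : Tri p s τ Q)
    (hτ : τ ≤ τ') : Tri p s τ' Q :=
  h.conseq hτ fun _ _ h => h

theorem Tri.loop {e : Expr} {p : Cmd} {τ : ℕ} (Inv : ℕ → Store → Prop)
    (h₀ : ∀ s, Inv 0 s → (e.eval s).isCons = false)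
    (h₁ : ∀ i s, Inv (i + 1) s → (e.eval s).isCons = true ∧ Tri p s τ (Inv i))
    {n : ℕ} {s : Store} (h : Inv n s) : Tri (.loop e p) s (n * (τ + 1) + 1) (Inv 0) := by
  induction n generalizing s with
  | zero => exact ⟨1, s, .loop_done (h₀ s h), by omega, h⟩
  | succ n ih =>
    obtain ⟨hc, t, s', hp, ht, hi⟩ := h₁ n s h
    obtain ⟨t', s'', hl, ht', hi'⟩ := ih hi
    exact ⟨_, s'', .loop_step hc hp hl, by rw [Nat.succ_mul]; omega, hi'⟩

/-- A loop that may be left before its counter has run out. -/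
theorem Tri.loop_of_le {e : Expr} {p : Cmd} {τ : ℕ} (Inv : ℕ → Store → Prop)
    (Q : Store → Prop) (h₀ : ∀ s, Inv 0 s → (e.eval s).isCons = false ∧ Q s)
    (h₁ : ∀ i s, Inv (i + 1) s → (e.eval s).isCons = true ∧
      Tri p s τ fun s' => Inv i s' ∨ ((e.eval s').isCons = false ∧ Q s'))
    {n : ℕ} {s : Store} (h : Inv n s) : Tri (.loop e p) s (n * (τ + 1) + 1) Q := by
  induction n generalizing s with
  | zero => exact ⟨1, s, .loop_done (h₀ s h).1, by omega, (h₀ s h).2⟩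
  | succ n ih =>
    obtain ⟨hc, t, s', hp, ht, hi | ⟨hd, hq⟩⟩ := h₁ n s h
    · obtain ⟨t', s'', hl, ht', hi'⟩ := ih hi
      exact ⟨_, s'', .loop_step hc hp hl, by rw [Nat.succ_mul]; omega, hi'⟩
    · exact ⟨_, s', .loop_step hc hp (.loop_done hd), by rw [Nat.succ_mul]; omega, hq⟩

/-! ### Renaming variables and calling a program as a subroutine -/

/-- Add `o` to the number of every variable of an expression. -/
def Expr.shift (o : ℕ) : Expr → Expr
  | .var x => .var (x + o)
  | .nil => .nil
  | .cons e f => .cons (e.shift o) (f.shift o)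
  | .hd e => .hd (e.shift o)
  | .tl e => .tl (e.shift o)

/-- Add `o` to the number of every variable of a program. -/
def Cmd.shift (o : ℕ) : Cmd → Cmd
  | .assign x e => .assign (x + o) (e.shift o)
  | .flip x => .flip (x + o)
  | .seq p q => .seq (p.shift o) (q.shift o)
  | .ite e p q => .ite (e.shift o) (p.shift o) (q.shift o)
  | .loop e p => .loop (e.shift o) (p.shift o)

/-- An upper bound for the variables of an expression. -/
def Expr.bound : Expr → ℕ
  | .var x => x + 1
  | .nil => 0
  | .cons e f => max e.bound f.bound
  | .hd e => e.bound
  | .tl e => e.bound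

/-- An upper bound for the variables of a program. -/
def Cmd.bound : Cmd → ℕ
  | .assign x e => max (x + 1) e.bound
  | .flip x => x + 1
  | .seq p q => max p.bound q.bound
  | .ite e p q => max e.bound (max p.bound q.bound)
  | .loop e p => max e.bound p.bound

theorem Expr.eval_shift {o B : ℕ} {s s₁ : Store} (h : ∀ x < B, s₁ (x + o) = s x) (e : Expr)
    (he : e.bound ≤ B) : (e.shift o).eval s₁ = e.eval s := by
  induction e with
  | var x => exact h x he
  | nil => rfl
  | cons e f ih ih' =>
    simp only [Expr.bound, max_le_iff] at he
    simp [Expr.shift, Expr.eval, ih he.1, ih' he.2]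
  | hd e ih => simp [Expr.shift, Expr.eval, ih he]
  | tl e ih => simp [Expr.shift, Expr.eval, ih he]

/-- Variables from `B` on do not occur in `p`, so agreement of the renamed variables below `B` is
enough and is preserved. -/
theorem BigStep.shift {p : Cmd} {s s' : Store} {t : ℕ} (h : BigStep p s t s') {o B : ℕ}
    (hp : p.bound ≤ B) {s₁ : Store} (hs : ∀ x < B, s₁ (x + o) = s x) :
    ∃ s₁', BigStep (p.shift o) s₁ t s₁' ∧ ∀ x < B, s₁' (x + o) = s' x := by
  induction h generalizing s₁ with
  | assign x e s =>
    simp only [Cmd.bound, max_le_iff] at hp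
    refine ⟨_, .assign _ _ _, fun y hy => ?_⟩
    rw [Expr.eval_shift hs e hp.2]
    by_cases hxy : y = x
    · subst hxy; simp
    · rw [Function.update_of_ne (by omega), Function.update_of_ne hxy, hs y hy]
  | seq _ _ ih ih' =>
    simp only [Cmd.bound, max_le_iff] at hp
    obtain ⟨s₂, h₂, hs₂⟩ := ih hp.1 hs
    obtain ⟨s₃, h₃, hs₃⟩ := ih' hp.2 hs₂
    exact ⟨s₃, .seq h₂ h₃, hs₃⟩
  | ite_true hc _ ih =>
    simp only [Cmd.bound, max_le_iff] at hp
    obtain ⟨s₂, h₂, hs₂⟩ := ih hp.2.1 hs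
    exact ⟨s₂, .ite_true (by rwa [Expr.eval_shift hs _ hp.1]) h₂, hs₂⟩
  | ite_false hc _ ih =>
    simp only [Cmd.bound, max_le_iff] at hp
    obtain ⟨s₂, h₂, hs₂⟩ := ih hp.2.2 hs
    exact ⟨s₂, .ite_false (by rwa [Expr.eval_shift hs _ hp.1]) h₂, hs₂⟩
  | loop_done hc =>
    simp only [Cmd.bound, max_le_iff] at hp
    exact ⟨s₁, .loop_done (by rwa [Expr.eval_shift hs _ hp.1]), hs⟩
  | loop_step hc _ _ ih ih' =>
    have hp' := hp
    simp only [Cmd.bound, max_le_iff] at hp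
    obtain ⟨s₂, h₂, hs₂⟩ := ih hp.2 hs
    obtain ⟨s₃, h₃, hs₃⟩ := ih' hp' hs₂
    exact ⟨s₃, .loop_step (by rwa [Expr.eval_shift hs _ hp.1]) h₂ h₃, hs₃⟩

theorem Cmd.le_of_writes_shift {o y : ℕ} {p : Cmd} (h : (p.shift o).Writes y) : o ≤ y := by
  induction p with
  | assign x e => simp only [Cmd.shift, Cmd.Writes] at h; omega
  | flip x => simp only [Cmd.shift, Cmd.Writes] at h; omega
  | seq p q ih ih' => exact h.elim ih ih'
  | ite e p q ih ih' => exact h.elim ih ih'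
  | loop e p ih => exact ih h

/-- Empty the variables `o, …, o + B`. -/
def clear (o : ℕ) : ℕ → Cmd
  | 0 => .assign o .nil
  | B + 1 => .seq (clear o B) (.assign (B + 1 + o) .nil)

theorem le_of_writes_clear {o B y : ℕ} (h : (clear o B).Writes y) : o ≤ y := by
  induction B with
  | zero => exact h.ge
  | succ B ih =>
    rcases h with h | h
    · exact ih h
    · simp only [Cmd.Writes] at h; omega

theorem tri_clear (o B : ℕ) (s : Store) :
    Tri (clear o B) s (2 * B + 1) fun s' => ∀ x ≤ B, s' (x + o) = .nil := by
  induction B with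
  | zero =>
    refine (Tri.assign ?_).mono (by omega)
    intro x hx
    obtain rfl : x = 0 := by omega
    simp [Expr.eval]
  | succ B ih =>
    refine (Tri.seq (τ' := 1) (ih.conseq le_rfl fun s' _ h => Tri.assign ?_)).mono (by omega)
    intro x hx
    by_cases hxB : x = B + 1
    · subst hxB; simp [Expr.eval]
    · rw [Function.update_of_ne (by omega)]; exact h x (by omega)

/-- Run `P` on the input `e`, in the variables from `o` on; the output is in variable `o`. -/
def call (o : ℕ) (P : Cmd) (e : Expr) : Cmd :=
  .seq (clear o P.bound) (.seq (.assign o e) (P.shift o))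

theorem le_of_writes_call {o y : ℕ} {P : Cmd} {e : Expr} (h : (call o P e).Writes y) : o ≤ y := by
  rcases h with h | h | h
  · exact le_of_writes_clear h
  · exact h.ge
  · exact Cmd.le_of_writes_shift h

/-- Clearing recreates the initial store that `P` expects. The input expression is evaluated after
the clearing, hence its value may depend only on variables below `o`. -/
theorem Tri.call {o : ℕ} {P : Cmd} {e : Expr} {d : Data} {s : Store} {τ : ℕ} {Q : Data → Prop}
    (he : ∀ s' : Store, (∀ y < o, s' y = s y) → e.eval s' = d)
    (h : ∃ t s', BigStep P (Function.update (fun _ => Data.nil) 0 d) t s' ∧ t ≤ τ ∧ Q (s' 0)) :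
    Tri (call o P e) s (τ + 2 * P.bound + 4) fun s' => Q (s' o) := by
  obtain ⟨t, s', hb, ht, hQ⟩ := h
  refine (Tri.seq (τ' := τ + 2) ((tri_clear o P.bound s).conseq le_rfl fun s₁ hf hs₁ =>
    (Tri.seq (τ' := τ) (Tri.assign ?_)).mono (by omega))).mono (by omega)
  have hd : e.eval s₁ = d := he s₁ fun y hy => hf y fun hw => by
    have := le_of_writes_clear hw; omega
  -- `P.bound + 1` instead of `P.bound` covers the output variable `0` even if `P` mentions no
  -- variable.
  obtain ⟨s₂, h₂, hs₂⟩ := hb.shift (o := o) (B := P.bound + 1) (by omega)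
    (s₁ := Function.update s₁ o (e.eval s₁)) (by
      intro x hx
      by_cases hx0 : x = 0
      · subst hx0; simp [hd]
      · rw [Function.update_of_ne (by omega), Function.update_of_ne hx0]; exact hs₁ x (by omega))
  refine ⟨t, s₂, h₂, ht, ?_⟩
  have := hs₂ 0 (by omega)
  rw [Nat.zero_add] at this
  simpa only [this] using hQ

/-! ### Clocked programs -/

/-- The number of components of a tree, seen as a list. -/
def Data.len : Data → ℕ
  | .nil => 0
  | .cons _ d => d.len + 1

theorem Data.len_tl (d : Data) : d.tl.len = d.len - 1 := by cases d <;> rfl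

theorem Data.isCons_iff_len (d : Data) : d.isCons = true ↔ 0 < d.len := by
  cases d <;> simp [Data.isCons, Data.len]

theorem Data.isCons_eq_false_iff_len (d : Data) : d.isCons = false ↔ d.len = 0 := by
  cases d <;> simp [Data.isCons, Data.len]

/-- Set the flag (variable `2`) to the value of `e`, or to `nil` if the clock (variable `1`) has
run out. -/
def setFlag (e : Expr) : Cmd := .ite (.var 1) (.assign 2 e) (.assign 2 .nil)

/-- The loop of a clocked program: as long as the flag is set, the clock loses a unit with every
round. -/
def clockedLoop (e : Expr) (p : Cmd) : Cmd :=
  .loop (.var 2) (.seq (.assign 1 (.tl (.var 1))) (.seq p (setFlag e)))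

/-- The program `p`, with all of its loops left as soon as the clock has run out. -/
def Cmd.clocked : Cmd → Cmd
  | .assign x e => .assign x e
  | .flip x => .flip x
  | .seq p q => .seq p.clocked q.clocked
  | .ite e p q => .ite e p.clocked q.clocked
  | .loop e p => .seq (setFlag e) (clockedLoop e p.clocked)

/-- The expression does not contain variable `y`. -/
def Expr.Avoids (y : ℕ) : Expr → Prop
  | .var x => x ≠ y
  | .nil => True
  | .cons e f => e.Avoids y ∧ f.Avoids y
  | .hd e => e.Avoids y
  | .tl e => e.Avoids y

/-- The program does not contain variable `y`. -/
def Cmd.Avoids (y : ℕ) : Cmd → Prop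
  | .assign x e => x ≠ y ∧ e.Avoids y
  | .flip x => x ≠ y
  | .seq p q => p.Avoids y ∧ q.Avoids y
  | .ite e p q => e.Avoids y ∧ p.Avoids y ∧ q.Avoids y
  | .loop e p => e.Avoids y ∧ p.Avoids y

theorem Expr.avoids_shift {o y : ℕ} (h : y < o) (e : Expr) : (e.shift o).Avoids y := by
  induction e with
  | var x => simp only [Expr.shift, Expr.Avoids]; omega
  | nil => trivial
  | cons e f ih ih' => exact ⟨ih, ih'⟩
  | hd e ih => exact ih
  | tl e ih => exact ih

theorem Cmd.avoids_shift {o y : ℕ} (h : y < o) (p : Cmd) : (p.shift o).Avoids y := by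
  induction p with
  | assign x e => exact ⟨by omega, e.avoids_shift h⟩
  | flip x => simp only [Cmd.shift, Cmd.Avoids]; omega
  | seq p q ih ih' => exact ⟨ih, ih'⟩
  | ite e p q ih ih' => exact ⟨e.avoids_shift h, ih, ih'⟩
  | loop e p ih => exact ⟨e.avoids_shift h, ih⟩

theorem avoids_clear {o y : ℕ} (h : y < o) (B : ℕ) : (clear o B).Avoids y := by
  induction B with
  | zero => exact ⟨by omega, trivial⟩
  | succ B ih => exact ⟨ih, by omega, trivial⟩

theorem avoids_call {o y : ℕ} (h : y < o) (P : Cmd) {e : Expr} (he : e.Avoids y) :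
    (call o P e).Avoids y :=
  ⟨avoids_clear h _, ⟨by omega, he⟩, P.avoids_shift h⟩

theorem Cmd.deterministic_shift {o : ℕ} {p : Cmd} (h : p.Deterministic) :
    (p.shift o).Deterministic := by
  induction p with
  | assign x e => trivial
  | flip x => exact h.elim
  | seq p q ih ih' => exact ⟨ih h.1, ih' h.2⟩
  | ite e p q ih ih' => exact ⟨ih h.1, ih' h.2⟩
  | loop e p ih => exact ih h

theorem deterministic_clear (o B : ℕ) : (clear o B).Deterministic := by
  induction B with
  | zero => trivial
  | succ B ih => exact ⟨ih, trivial⟩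

theorem deterministic_call (o : ℕ) {P : Cmd} (e : Expr) (h : P.Deterministic) :
    (call o P e).Deterministic :=
  ⟨deterministic_clear o _, trivial, Cmd.deterministic_shift h⟩

theorem Cmd.writes_clocked {p : Cmd} {y : ℕ} (h : p.clocked.Writes y) :
    p.Writes y ∨ y = 1 ∨ y = 2 := by
  induction p with
  | assign x e => exact .inl h
  | flip x => exact .inl h
  | seq p q ih ih' =>
    simp only [Cmd.clocked, Cmd.Writes] at h ⊢
    tauto
  | ite e p q ih ih' =>
    simp only [Cmd.clocked, Cmd.Writes] at h ⊢
    tauto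
  | loop e p ih =>
    simp only [Cmd.clocked, setFlag, clockedLoop, Cmd.Writes] at h ⊢
    tauto

theorem bigStep_setFlag (e : Expr) (s : Store) :
    BigStep (setFlag e) s 2
      (Function.update s 2 (if (s 1).isCons then e.eval s else .nil)) := by
  cases h : (s 1).isCons with
  | true => exact BigStep.ite_true (e := .var 1) (q := .assign 2 .nil) h (.assign 2 e s)
  | false => exact BigStep.ite_false (e := .var 1) (p := .assign 2 e) h (.assign 2 .nil s)

/-- A clocked program halts after a number of steps that is linear in the number of units that the
clock loses. -/
theorem exists_clocked_bound {p : Cmd} (hp : p.Deterministic) (ha : p.Avoids 1) :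
    ∃ K : ℕ, ∀ s, ∃ t s' δ, BigStep p.clocked s t s' ∧
      (s 1).len = (s' 1).len + δ ∧ t ≤ K * (δ + 1) := by
  induction p with
  | assign x e =>
    refine ⟨1, fun s => ⟨1, _, 0, .assign x e s, ?_, by simp⟩⟩
    rw [Function.update_of_ne (Ne.symm ha.1)]; rfl
  | flip x => exact hp.elim
  | seq p q ih ih' =>
    obtain ⟨K, hK⟩ := ih hp.1 ha.1
    obtain ⟨K', hK'⟩ := ih' hp.2 ha.2
    refine ⟨K + K' + 1, fun s => ?_⟩
    obtain ⟨t, s', δ, h, hl, ht⟩ := hK s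
    obtain ⟨t', s'', δ', h', hl', ht'⟩ := hK' s'
    exact ⟨_, s'', δ + δ', .seq h h', by omega, by nlinarith⟩
  | ite e p q ih ih' =>
    obtain ⟨K, hK⟩ := ih hp.1 ha.2.1
    obtain ⟨K', hK'⟩ := ih' hp.2 ha.2.2
    refine ⟨K + K' + 1, fun s => ?_⟩
    cases hc : (e.eval s).isCons with
    | true =>
      obtain ⟨t, s', δ, h, hl, ht⟩ := hK s
      exact ⟨_, s', δ, .ite_true hc h, by omega, by nlinarith⟩
    | false =>
      obtain ⟨t, s', δ, h, hl, ht⟩ := hK' s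
      exact ⟨_, s', δ, .ite_false hc h, by omega, by nlinarith⟩
  | loop e p ih =>
    obtain ⟨K, hK⟩ := ih hp ha.2
    -- The flag is set only while the clock is non-empty. So each round burns a unit, the clock
    -- length is a measure for the induction, and the unit pays for the round's overhead.
    have key : ∀ l : ℕ, ∀ s : Store, (s 1).len = l → ((s 2).isCons → (s 1).isCons) →
        ∃ t s' δ, BigStep (clockedLoop e p.clocked) s t s' ∧ (s 1).len = (s' 1).len + δ ∧
          t ≤ (K + 6) * (δ + 1) := by
      intro l
      induction l using Nat.strong_induction_on with
      | _ l ihl =>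
      intro s hl hs
      cases hc : (s 2).isCons with
      | false => exact ⟨1, s, 0, .loop_done hc, rfl, by omega⟩
      | true =>
        have h1 : 0 < (s 1).len := (Data.isCons_iff_len _).1 (hs hc)
        obtain ⟨t, s₁, δ, h, hl₁, ht⟩ := hK (Function.update s 1 (s 1).tl)
        simp only [Function.update_self, Data.len_tl] at hl₁
        set s₂ := Function.update s₁ 2 (if (s₁ 1).isCons then e.eval s₁ else .nil) with hs₂
        have h21 : s₂ 1 = s₁ 1 := Function.update_of_ne (by decide) _ _
        obtain ⟨t', s₃, δ', h', hl', ht'⟩ := ihl (s₂ 1).len (by rw [h21]; omega) s₂ rfl (by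
          rw [h21, hs₂, Function.update_self]
          split_ifs with hh
          · exact fun _ => hh
          · simp [Data.isCons])
        rw [h21] at hl'
        refine ⟨_, s₃, 1 + δ + δ', .loop_step hc (.seq (.assign 1 _ s)
          (.seq h (bigStep_setFlag e s₁))) h', by omega, by nlinarith⟩
    refine ⟨K + 9, fun s => ?_⟩
    set s₂ := Function.update s 2 (if (s 1).isCons then e.eval s else .nil) with hs₂
    have h21 : s₂ 1 = s 1 := Function.update_of_ne (by decide) _ _
    obtain ⟨t, s', δ, h, hl, ht⟩ := key _ s₂ rfl (by
      rw [h21, hs₂, Function.update_self]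
      split_ifs with hh
      · exact fun _ => hh
      · simp [Data.isCons])
    exact ⟨_, s', δ, .seq (bigStep_setFlag e s) h, by rw [← h21]; exact hl, by nlinarith⟩

/-! ### Simulation of a program by its clocked version -/

/-- The two stores agree on all variables except the clock and the flag. -/
def AgreeOffClock (s s₁ : Store) : Prop := ∀ y, y ≠ 1 → y ≠ 2 → s₁ y = s y

theorem AgreeOffClock.eval {s s₁ : Store} (h : AgreeOffClock s s₁) {e : Expr} (h₁ : e.Avoids 1)
    (h₂ : e.Avoids 2) : e.eval s₁ = e.eval s := by
  induction e with
  | var x => exact h x h₁ h₂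
  | nil => rfl
  | cons e f ih ih' => simp [Expr.eval, ih h₁.1 h₂.1, ih' h₁.2 h₂.2]
  | hd e ih => simp [Expr.eval, ih h₁ h₂]
  | tl e ih => simp [Expr.eval, ih h₁ h₂]

theorem AgreeOffClock.trans_update {s s₁ : Store} (h : AgreeOffClock s s₁) {x : ℕ}
    (hx : x = 1 ∨ x = 2) (d : Data) : AgreeOffClock s (Function.update s₁ x d) := by
  intro y h1 h2
  rw [Function.update_of_ne (by rcases hx with rfl | rfl <;> assumption)]
  exact h y h1 h2

theorem exists_clocked_of_clock_out {p : Cmd} (hp : p.Deterministic) (ha : p.Avoids 1) {s : Store}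
    (hs : (s 1).len = 0) : ∃ t s', BigStep p.clocked s t s' ∧ (s' 1).len = 0 := by
  obtain ⟨K, hK⟩ := exists_clocked_bound hp ha
  obtain ⟨t, s', δ, h, hl, -⟩ := hK s
  exact ⟨t, s', h, by omega⟩

/-- A clocked program does the same as the original one, unless the clock runs out. -/
theorem BigStep.clocked {p : Cmd} {s s' : Store} {t : ℕ} (h : BigStep p s t s')
    (hp : p.Deterministic) (ha₁ : p.Avoids 1) (ha₂ : p.Avoids 2) {s₁ : Store}
    (hs : AgreeOffClock s s₁) :
    ∃ t₁ s₁', BigStep p.clocked s₁ t₁ s₁' ∧ (((s₁' 1).len = 0 ∧ (s₁ 1).len ≤ t) ∨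
      (AgreeOffClock s' s₁' ∧ (s₁ 1).len ≤ (s₁' 1).len + t)) := by
  induction h generalizing s₁ with
  | assign x e s =>
    refine ⟨1, _, .assign x e s₁, .inr ⟨fun y h1 h2 => ?_, ?_⟩⟩
    · rw [hs.eval ha₁.2 ha₂.2]
      by_cases hy : y = x
      · subst hy; simp
      · rw [Function.update_of_ne hy, Function.update_of_ne hy, hs y h1 h2]
    · rw [Function.update_of_ne (Ne.symm ha₁.1)]; omega
  | seq _ _ ih ih' =>
    obtain ⟨t₁, s₂, h₁, h | ⟨h, hl⟩⟩ := ih hp.1 ha₁.1 ha₂.1 hs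
    · obtain ⟨t₂, s₃, h₂, h'⟩ := exists_clocked_of_clock_out hp.2 ha₁.2 h.1
      exact ⟨_, s₃, .seq h₁ h₂, .inl ⟨h', by omega⟩⟩
    · obtain ⟨t₂, s₃, h₂, h' | ⟨h', hl'⟩⟩ := ih' hp.2 ha₁.2 ha₂.2 h
      · exact ⟨_, s₃, .seq h₁ h₂, .inl ⟨h'.1, by omega⟩⟩
      · exact ⟨_, s₃, .seq h₁ h₂, .inr ⟨h', by omega⟩⟩
  | ite_true hc _ ih =>
    obtain ⟨t₁, s₂, h₁, h⟩ := ih hp.1 ha₁.2.1 ha₂.2.1 hs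
    refine ⟨_, s₂, .ite_true (by rwa [hs.eval ha₁.1 ha₂.1]) h₁, ?_⟩
    rcases h with h | h
    · exact .inl ⟨h.1, by omega⟩
    · exact .inr ⟨h.1, by omega⟩
  | ite_false hc _ ih =>
    obtain ⟨t₁, s₂, h₁, h⟩ := ih hp.2 ha₁.2.2 ha₂.2.2 hs
    refine ⟨_, s₂, .ite_false (by rwa [hs.eval ha₁.1 ha₂.1]) h₁, ?_⟩
    rcases h with h | h
    · exact .inl ⟨h.1, by omega⟩
    · exact .inr ⟨h.1, by omega⟩
  | @loop_done e p s hc =>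
    refine ⟨_, _, .seq (bigStep_setFlag e s₁) (.loop_done ?_), .inr ⟨hs.trans_update (.inr rfl) _, ?_⟩⟩
    · simp only [Expr.eval, Function.update_self, hs.eval ha₁.1 ha₂.1]
      split_ifs
      · exact hc
      · rfl
    · rw [Function.update_of_ne (by decide)]; omega
  | @loop_step e p s s' s'' t t' hc _ _ ih ih' =>
    cases h1 : (s₁ 1).isCons with
    | false =>
      have hl : (s₁ 1).len = 0 := (Data.isCons_eq_false_iff_len _).1 h1
      refine ⟨_, _, .seq (bigStep_setFlag e s₁) (.loop_done ?_), .inl ⟨?_, by omega⟩⟩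
      · simp only [Expr.eval, Function.update_self, h1]; rfl
      · rwa [Function.update_of_ne (by decide)]
    | true =>
      set s₂ := Function.update s₁ 2 (if (s₁ 1).isCons then e.eval s₁ else .nil) with hs₂
      have hs₂c : ((Expr.var 2).eval s₂).isCons = true := by
        simp [hs₂, Expr.eval, h1, hs.eval ha₁.1 ha₂.1, hc]
      set s₃ := Function.update s₂ 1 ((Expr.tl (.var 1)).eval s₂) with hs₃
      have h31 : (s₃ 1).len + 1 = (s₁ 1).len := by
        have : s₃ 1 = (s₁ 1).tl := by simp [hs₃, hs₂, Expr.eval]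
        have := (Data.isCons_iff_len _).1 h1
        rw [‹s₃ 1 = _›, Data.len_tl]; omega
      have hag : AgreeOffClock s s₃ := (hs.trans_update (.inr rfl) _).trans_update (.inl rfl) _
      obtain ⟨t₁, s₄, h₁, h⟩ := ih hp ha₁.2 ha₂.2 hag
      -- The flag is set on entering the clocked loop exactly as at the end of a round, so a run of
      -- the whole clocked loop from `s₄` can be spliced behind the first round.
      have fin : ∀ {t₂ s₅}, BigStep (Cmd.loop e p).clocked s₄ t₂ s₅ →
          ∃ t₃, BigStep (Cmd.loop e p).clocked s₁ t₃ s₅ := by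
        intro t₂ s₅ h₂
        cases h₂ with
        | seq hf hl =>
          exact ⟨_, .seq (bigStep_setFlag e s₁) (.loop_step hs₂c (.seq (.assign 1 _ s₂)
            (.seq h₁ hf)) hl)⟩
      rcases h with h | ⟨h, hl⟩
      · obtain ⟨t₂, s₅, h₂, h'⟩ := exists_clocked_of_clock_out (p := .loop e p) hp ha₁ h.1
        obtain ⟨t₃, h₃⟩ := fin h₂
        exact ⟨t₃, s₅, h₃, .inl ⟨h', by omega⟩⟩
      · obtain ⟨t₂, s₅, h₂, h'⟩ := ih' hp ha₁ ha₂ h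
        obtain ⟨t₃, h₃⟩ := fin h₂
        refine ⟨t₃, s₅, h₃, ?_⟩
        rcases h' with h' | h'
        · exact .inl ⟨h'.1, by omega⟩
        · exact .inr ⟨h'.1, by omega⟩

/-- Running a clocked program from a store in which the clock shows `L`. -/
theorem exists_tri_clocked {p : Cmd} (hp : p.Deterministic) (ha₁ : p.Avoids 1)
    (ha₂ : p.Avoids 2) :
    ∃ K : ℕ, ∀ s τ (Q : Store → Prop), Tri p s τ Q →
      Tri p.clocked s (K * ((s 1).len + 1)) fun s' =>
        ((s' 1).isCons = true → ∃ s'', Q s'' ∧ AgreeOffClock s'' s') ∧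
        (τ < (s 1).len → (s' 1).isCons = true) := by
  obtain ⟨K, hK⟩ := exists_clocked_bound hp ha₁
  refine ⟨K, fun s τ Q ⟨t, s'', h, ht, hQ⟩ => ?_⟩
  obtain ⟨t₁, s', δ, h₁, hl, ht₁⟩ := hK s
  obtain ⟨t₂, s₂, h₂, h'⟩ := h.clocked hp ha₁ ha₂ (s₁ := s) fun _ _ _ => rfl
  obtain ⟨rfl, rfl⟩ := h₁.unique h₂
  refine ⟨t₁, s', h₁, ht₁.trans (Nat.mul_le_mul_left _ (by omega)), ?_, ?_⟩ <;>
    rw [Data.isCons_iff_len]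
  · intro hc
    exact ⟨s'', hQ, (h'.resolve_left (by omega)).1⟩
  · omega

theorem Tri.assign_seq {x : ℕ} {e : Expr} {q : Cmd} {s : Store} {τ : ℕ} {Q : Store → Prop}
    (h : Tri q (Function.update s x (e.eval s)) τ Q) :
    Tri (.seq (.assign x e) q) s (τ + 2) Q :=
  (Tri.seq (Tri.assign h)).mono (by omega)

theorem Tri.seq_of {p q : Cmd} {s : Store} {τ τ' : ℕ} {R Q : Store → Prop} (hp : Tri p s τ R)
    (hq : ∀ s', (∀ y, ¬p.Writes y → s' y = s y) → R s' → Tri q s' τ' Q) :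
    Tri (.seq p q) s (τ + τ' + 1) Q :=
  Tri.seq (hp.conseq le_rfl hq)

/-! ### Lemmas on encodings -/

@[simp] theorem Data.isCons_nil : Data.nil.isCons = false := rfl
@[simp] theorem Data.isCons_cons (a d : Data) : (Data.cons a d).isCons = true := rfl
@[simp] theorem Data.hd_cons (a d : Data) : (Data.cons a d).hd = a := rfl
@[simp] theorem Data.tl_cons (a d : Data) : (Data.cons a d).tl = d := rfl
@[simp] theorem Data.len_nil : Data.nil.len = 0 := rfl
@[simp] theorem Data.len_cons (a d : Data) : (Data.cons a d).len = d.len + 1 := rfl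

@[simp] theorem Data.isCons_ofBool (b : Bool) : (Data.ofBool b).isCons = b := by cases b <;> rfl

@[simp] theorem Data.ofNat_zero : Data.ofNat 0 = .nil := rfl
theorem Data.ofNat_succ (k : ℕ) : Data.ofNat (k + 1) = .cons .nil (Data.ofNat k) := rfl

@[simp] theorem Data.len_ofNat (k : ℕ) : (Data.ofNat k).len = k := by
  induction k with
  | zero => rfl
  | succ k ih => rw [Data.ofNat_succ, Data.len_cons, ih]

@[simp] theorem Data.tl_ofNat (k : ℕ) : (Data.ofNat k).tl = Data.ofNat (k - 1) := by
  cases k <;> rfl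

@[simp] theorem Data.ofStrs_nil : Data.ofStrs [] = .nil := rfl
@[simp] theorem Data.ofStrs_cons (x : List Bool) (l : List (List Bool)) :
    Data.ofStrs (x :: l) = .cons (.ofStr x) (.ofStrs l) := rfl

@[simp] theorem Data.len_ofStrs (l : List (List Bool)) : (Data.ofStrs l).len = l.length := by
  induction l with
  | nil => rfl
  | cons x l ih => simp [ih]

@[simp] theorem Data.ofStr_nil : Data.ofStr [] = .nil := rfl
@[simp] theorem Data.ofStr_cons (b : Bool) (w : List Bool) :
    Data.ofStr (b :: w) = .cons (.ofBool b) (.ofStr w) := rfl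

@[simp] theorem Data.len_ofStr (l : List Bool) : (Data.ofStr l).len = l.length := by
  induction l with
  | nil => rfl
  | cons x l ih => simp [ih]

theorem Data.tl_ofStr (w : List Bool) : (Data.ofStr w).tl = .ofStr w.tail := by cases w <;> rfl
theorem Data.hd_ofStr (w : List Bool) : (Data.ofStr w).hd = .ofBool (w.headD false) := by
  cases w <;> rfl

/-! ### Drawing an element from a list -/

/-- The empty program. -/
def skip : Cmd := .assign 39 .nil

theorem Tri.skip {s : Store} {Q : Store → Prop} (h : Q (Function.update s 39 .nil)) :
    Tri skip s 1 Q := Tri.assign h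

/-- Move cyclically through the list `M` (variable 32), which is kept split into the part still
ahead (variable 30) and the reversal of the part passed (variable 31). -/
def advance : Cmd :=
  .seq (.assign 31 (.cons (.hd (.var 30)) (.var 31)))
    (.seq (.assign 30 (.tl (.var 30)))
      (.ite (.var 30) skip (.seq (.assign 30 (.var 32)) (.assign 31 .nil))))

/-- The list `M` is split at position `a`. -/
def SplitAt (M : List (List Bool)) (a : ℕ) (s : Store) : Prop :=
  a < M.length ∧ s 32 = .ofStrs M ∧ s 30 = .ofStrs (M.drop a) ∧ s 31 = .ofStrs (M.take a).reverse

theorem tri_advance {M : List (List Bool)} {a : ℕ} {s : Store} (h : SplitAt M a s) :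
    Tri advance s 8 (SplitAt M ((a + 1) % M.length)) := by
  obtain ⟨ha, h32, h30, h31⟩ := h
  have hd : M.drop a = M[a] :: M.drop (a + 1) := List.drop_eq_getElem_cons ha
  have ht : M.take (a + 1) = M.take a ++ [M[a]] := (List.take_append_getElem ha).symm
  have h30' : s 30 = .cons (.ofStr M[a]) (.ofStrs (M.drop (a + 1))) := by rw [h30, hd]; rfl
  have h31' : Data.cons (.ofStr M[a]) (s 31) = .ofStrs (M.take (a + 1)).reverse := by
    rw [ht, List.reverse_append, h31]; rfl
  refine Tri.assign_seq (Tri.assign_seq (Tri.ite (fun hc => (Tri.skip ?_).mono (by omega))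
    fun hc => Tri.assign_seq (Tri.assign ?_)))
  · have hlt : a + 1 < M.length := by
      rw [Data.isCons_iff_len] at hc
      simp [Expr.eval, h30'] at hc
      omega
    rw [Nat.mod_eq_of_lt hlt]
    refine ⟨hlt, ?_, ?_, ?_⟩ <;> simp [Expr.eval, h30', h31', h32]
  · have hlt : a + 1 = M.length := by
      rw [Data.isCons_eq_false_iff_len] at hc
      simp [Expr.eval, h30'] at hc
      omega
    rw [hlt, Nat.mod_self]
    refine ⟨by omega, ?_, ?_, ?_⟩ <;> simp [Expr.eval, h32]

/-- Double the position in the list, and add a coin taken from the supply of coins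
(variable 20). -/
def doubleAdd : Cmd :=
  .seq (.assign 33 (.var 31))
    (.seq (.loop (.var 33) (.seq advance (.assign 33 (.tl (.var 33)))))
      (.seq (.ite (.hd (.var 20)) advance skip) (.assign 20 (.tl (.var 20)))))

theorem SplitAt.congr {M : List (List Bool)} {a : ℕ} {s s' : Store} (h : SplitAt M a s)
    (h30 : s' 30 = s 30) (h31 : s' 31 = s 31) (h32 : s' 32 = s 32) : SplitAt M a s' :=
  ⟨h.1, h32.trans h.2.1, h30.trans h.2.2.1, h31.trans h.2.2.2⟩

/-- The passed part of the list has exactly `a` elements; advancing once for each of them doubles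
the position with no arithmetic on counters. -/
theorem tri_doubleAdd {M : List (List Bool)} {a : ℕ} {w : List Bool} {s : Store}
    (h : SplitAt M a s) (hw : s 20 = .ofStr w) :
    Tri doubleAdd s (11 * M.length + 20) fun s' =>
      SplitAt M ((2 * a + (w.headD false).toNat) % M.length) s' ∧ s' 20 = .ofStr w.tail := by
  have ha := h.1
  have hloop : Tri (.loop (.var 33) (.seq advance (.assign 33 (.tl (.var 33)))))
      (Function.update s 33 (s 31)) (a * (10 + 1) + 1) fun s' => SplitAt M (2 * a % M.length) s' := by
    refine (Tri.loop (τ := 10)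
      (fun i s' => i ≤ a ∧ (s' 33).len = i ∧ SplitAt M ((2 * a - i) % M.length) s') ?_ ?_
      (n := a) ?_).conseq le_rfl fun s' _ h => by simpa using h.2.2
    · rintro s' ⟨-, h, -⟩
      exact (Data.isCons_eq_false_iff_len _).2 h
    · rintro i s' ⟨hi, hl, hs'⟩
      refine ⟨(Data.isCons_iff_len _).2 (by simp [Expr.eval, hl]), ?_⟩
      refine (Tri.seq_of (τ' := 1) (tri_advance hs') fun s'' hf hs'' => Tri.assign ⟨by omega, ?_,
        SplitAt.congr (s := s'') ?_ (by simp) (by simp)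
          (by simp)⟩).mono (by omega)
      · have := hf 33 (by simp [advance, skip, Cmd.Writes])
        simp [Expr.eval, this, Data.len_tl, hl]
      · rw [Nat.mod_add_mod] at hs''
        rwa [show 2 * a - (i + 1) + 1 = 2 * a - i by omega] at hs''
    · refine ⟨le_rfl, ?_, ?_⟩
      · simp [h.2.2.2]; omega
      · rw [show 2 * a - a = a by omega, Nat.mod_eq_of_lt ha]
        exact h.congr (by simp) (by simp)
          (by simp)
  refine (Tri.assign_seq (Tri.seq_of (τ' := 11) hloop fun s₁ hf hs₁ =>
    (Tri.seq_of (τ := 9) (τ' := 1) (R := SplitAt M ((2 * a + (w.headD false).toNat) % M.length))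
      (Tri.ite (fun hc => ?_) (fun hc => ?_)) fun s₂ hf₂ hs₂ => Tri.assign ⟨?_, ?_⟩).mono
        (by omega))).mono (by omega)
  · have h20 : s₁ 20 = .ofStr w := by
      rw [hf 20 (by simp [advance, skip, Cmd.Writes])]; simpa using hw
    simp only [Expr.eval, h20, Data.hd_ofStr, Data.isCons_ofBool] at hc
    rw [hc]
    have := tri_advance hs₁
    rw [Nat.mod_add_mod] at this
    exact this
  · have h20 : s₁ 20 = .ofStr w := by
      rw [hf 20 (by simp [advance, skip, Cmd.Writes])]; simpa using hw
    simp only [Expr.eval, h20, Data.hd_ofStr, Data.isCons_ofBool] at hc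
    rw [hc]
    exact (Tri.skip (hs₁.congr (by simp) (by simp)
          (by simp))).mono (by omega)
  · exact hs₂.congr (by simp) (by simp)
          (by simp)
  · have h20 : s₂ 20 = .ofStr w := by
      rw [hf₂ 20 (by simp [advance, skip, Cmd.Writes]), hf 20 (by simp [advance, skip, Cmd.Writes])]
      simpa using hw
    simp [Expr.eval, h20, Data.tl_ofStr]

/-- The position in a cyclic list of length `m` that is reached from `a` with `ℓ` coins, by Horner's
rule. -/
def horner (m : ℕ) : ℕ → ℕ → List Bool → ℕ
  | 0, a, _ => a
  | ℓ + 1, a, w => horner m ℓ ((2 * a + (w.headD false).toNat) % m) w.tail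

theorem horner_lt {m ℓ a : ℕ} (h : a < m) (w : List Bool) : horner m ℓ a w < m := by
  induction ℓ generalizing a w with
  | zero => exact h
  | succ ℓ ih => exact ih (Nat.mod_lt _ (by omega)) _

/-- Move an element from the list in variable 30 to the list in variable 29. Its position is
determined by coins, whose number is given by variable 6. -/
def pick : Cmd :=
  .seq (.assign 32 (.var 30))
    (.seq (.assign 31 .nil)
      (.seq (.assign 34 (.var 6))
        (.seq (.loop (.var 34) (.seq doubleAdd (.assign 34 (.tl (.var 34)))))
          (.seq (.assign 29 (.cons (.hd (.var 30)) (.var 29)))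
            (.seq (.assign 30 (.tl (.var 30)))
              (.loop (.var 31) (.seq (.assign 30 (.cons (.hd (.var 31)) (.var 30)))
                (.assign 31 (.tl (.var 31))))))))))

theorem tri_restore {A V : List (List Bool)} {s : Store} (h31 : s 31 = .ofStrs A)
    (h30 : s 30 = .ofStrs V) :
    Tri (.loop (.var 31) (.seq (.assign 30 (.cons (.hd (.var 31)) (.var 30)))
      (.assign 31 (.tl (.var 31))))) s (A.length * (3 + 1) + 1) fun s' =>
        s' 30 = .ofStrs (A.reverse ++ V) := by
  refine (Tri.loop (τ := 3) (fun i s' => ∃ A' V', A'.length = i ∧ s' 31 = .ofStrs A' ∧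
    s' 30 = .ofStrs V' ∧ A'.reverse ++ V' = A.reverse ++ V) ?_ ?_ ⟨A, V, rfl, h31, h30, rfl⟩).conseq
      le_rfl ?_
  · rintro s' ⟨A', V', hA, h, -⟩
    exact (Data.isCons_eq_false_iff_len _).2 (by simp [Expr.eval, h, hA])
  · rintro i s' ⟨A', V', hA, h₁, h₂, h₃⟩
    obtain ⟨x, A', rfl⟩ := List.exists_of_length_succ _ hA
    refine ⟨by simp [Expr.eval, h₁], Tri.assign_seq (Tri.assign ⟨A', x :: V', ?_, ?_, ?_, ?_⟩)⟩
    · simpa using hA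
    · simp [Expr.eval, h₁]
    · simp [Expr.eval, h₁, h₂]
    · simpa using h₃
  · rintro s' - ⟨A', V', hA, -, h, h'⟩
    rw [List.length_eq_zero_iff] at hA
    subst hA
    rw [h, ← h']; rfl

theorem tri_pick {V X : List (List Bool)} {w : List Bool} {ℓ n : ℕ} {s : Store} (hV : V ≠ [])
    (hn : V.length ≤ n) (h30 : s 30 = .ofStrs V) (h29 : s 29 = .ofStrs X) (h6 : (s 6).len = ℓ)
    (h20 : s 20 = .ofStr w) :
    Tri pick s (ℓ * (11 * n + 23) + 4 * n + 13) fun s' =>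
      s' 30 = .ofStrs (V.eraseIdx (horner V.length ℓ 0 w)) ∧
      s' 29 = .ofStrs (V.getD (horner V.length ℓ 0 w) [] :: X) ∧ s' 20 = .ofStr (w.drop ℓ) := by
  have hpos : 0 < V.length := List.length_pos_iff.2 hV
  set i₀ := horner V.length ℓ 0 w with hi₀
  have hi₀lt : i₀ < V.length := horner_lt hpos w
  set s₁ := Function.update (Function.update (Function.update s 32 (s 30)) 31 .nil) 34 (s 6) with hs₁
  have hloop : Tri (.loop (.var 34) (.seq doubleAdd (.assign 34 (.tl (.var 34))))) s₁
      (ℓ * (11 * n + 22 + 1) + 1) fun s' => SplitAt V i₀ s' ∧ s' 20 = .ofStr (w.drop ℓ) := by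
    refine (Tri.loop (τ := 11 * n + 22) (fun i s' => (s' 34).len = i ∧ ∃ a w', SplitAt V a s' ∧
      s' 20 = .ofStr w' ∧ horner V.length i a w' = i₀ ∧ w'.drop i = w.drop ℓ) ?_ ?_
      (n := ℓ) ?_).conseq le_rfl ?_
    · rintro s' ⟨h, -⟩
      exact (Data.isCons_eq_false_iff_len _).2 h
    · rintro i s' ⟨hl, a, w', hs, hw, hh, hd⟩
      refine ⟨(Data.isCons_iff_len _).2 (by simp [Expr.eval, hl]), ?_⟩
      refine (Tri.seq_of (τ' := 1) (tri_doubleAdd hs hw) fun s'' hf hs'' => Tri.assign ⟨?_, _,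
        w'.tail, hs''.1.congr (by simp) (by simp)
          (by simp), ?_, hh, ?_⟩).mono (by omega)
      · have := hf 34 (by simp [doubleAdd, advance, skip, Cmd.Writes])
        simp [Expr.eval, this, Data.len_tl, hl]
      · simp [hs''.2]
      · rw [← hd, ← List.drop_one, List.drop_drop, Nat.add_comm]
    · refine ⟨by simp [hs₁, h6], 0, w, ⟨hpos, ?_, ?_, ?_⟩, ?_, rfl, rfl⟩ <;>
        simp [hs₁, h30, h20]
    · rintro s' - ⟨-, a, w', hs, hw, hh, hd⟩
      simp only [horner] at hh
      simp only [List.drop_zero] at hd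
      exact ⟨hh ▸ hs, hd ▸ hw⟩
  refine (Tri.assign_seq (Tri.assign_seq (Tri.assign_seq (Tri.seq_of
    (τ := ℓ * (11 * n + 22 + 1) + 1) (τ' := 4 * n + 5)
    (R := fun s' => SplitAt V i₀ s' ∧ s' 20 = .ofStr (w.drop ℓ)) ?_ fun s₂ hf hs₂ =>
      Tri.assign_seq (Tri.assign_seq ?_))))).mono ?_
  · exact hloop
  · obtain ⟨⟨-, h32, h30', h31⟩, hw₂⟩ := hs₂
    have hd : V.drop i₀ = V[i₀] :: V.drop (i₀ + 1) := List.drop_eq_getElem_cons hi₀lt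
    rw [hd, Data.ofStrs_cons] at h30'
    have h29' : s₂ 29 = .ofStrs X := by
      rw [hf 29 (by simp [doubleAdd, advance, skip, Cmd.Writes])]
      simpa using h29
    refine (tri_restore (A := (V.take i₀).reverse) (V := V.drop (i₀ + 1)) ?_ ?_).conseq ?_ ?_
    · simp [h31]
    · simp [Expr.eval, h30']
    · simp; omega
    · intro s₃ hf₃ h
      refine ⟨?_, ?_, ?_⟩
      · rw [h, List.reverse_reverse, List.eraseIdx_eq_take_drop_succ]
      · rw [hf₃ 29 (by simp [Cmd.Writes])]
        simp [Expr.eval, h30', h29', hi₀lt]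
      · rw [hf₃ 20 (by simp [Cmd.Writes])]
        simpa using hw₂
  · rw [Nat.add_assoc _ 22 1]; omega

/-! ### Drawing a sample without replacement -/

/-- The elements drawn from `V` in `t` rounds with `ℓ` coins each. -/
def picks (ℓ : ℕ) : ℕ → List Bool → List (List Bool) → List (List Bool)
  | 0, _, _ => []
  | t + 1, w, V => V.getD (horner V.length ℓ 0 w) [] ::
      picks ℓ t (w.drop ℓ) (V.eraseIdx (horner V.length ℓ 0 w))

/-- The elements left of `V` after `t` rounds with `ℓ` coins each. -/
def rest (ℓ : ℕ) : ℕ → List Bool → List (List Bool) → List (List Bool)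
  | 0, _, V => V
  | t + 1, w, V => rest ℓ t (w.drop ℓ) (V.eraseIdx (horner V.length ℓ 0 w))

/-- Drawing is without repetition, and what is not drawn stays available for the greedy completion.
-/
theorem picks_append_rest_perm (ℓ t : ℕ) (w : List Bool) {V : List (List Bool)}
    (h : t ≤ V.length) : (picks ℓ t w V ++ rest ℓ t w V).Perm V := by
  induction t generalizing w V with
  | zero => exact .refl _
  | succ t ih =>
    have hi := horner_lt (ℓ := ℓ) (show 0 < V.length by omega) w
    refine ((ih (w.drop ℓ) (V := V.eraseIdx (horner V.length ℓ 0 w)) ?_).cons _).trans ?_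
    · rw [List.length_eraseIdx_of_lt hi]; omega
    · rw [List.getD_eq_getElem _ _ hi]
      exact List.getElem_cons_eraseIdx_perm hi

theorem length_picks (ℓ t : ℕ) (w : List Bool) (V : List (List Bool)) :
    (picks ℓ t w V).length = t := by
  induction t generalizing w V with
  | zero => rfl
  | succ t ih => simp [picks, ih]

/-- Draw as many elements from the list in variable 4 as variable 19 says. -/
def sample : Cmd :=
  .seq (.assign 29 .nil)
    (.seq (.assign 30 (.var 4))
      (.seq (.assign 28 (.var 19))
        (.loop (.var 28) (.seq pick (.assign 28 (.tl (.var 28)))))))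

theorem tri_sample {u : List (List Bool)} {w : List Bool} {ℓ t : ℕ} {s : Store}
    (ht : t ≤ u.length) (h4 : s 4 = .ofStrs u) (h19 : (s 19).len = t) (h6 : (s 6).len = ℓ)
    (h20 : s 20 = .ofStr w) :
    Tri sample s (t * (ℓ * (11 * u.length + 23) + 4 * u.length + 16) + 7) fun s' =>
      s' 30 = .ofStrs (rest ℓ t w u) ∧ s' 29 = .ofStrs (picks ℓ t w u).reverse ∧
      s' 20 = .ofStr (w.drop (t * ℓ)) := by
  refine (Tri.assign_seq (Tri.assign_seq (Tri.assign_seq ((Tri.loop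
    (τ := ℓ * (11 * u.length + 23) + 4 * u.length + 15)
    (fun i s' => (s' 28).len = i ∧ (s' 6).len = ℓ ∧ ∃ V X w', i ≤ V.length ∧ V.length ≤ u.length ∧
      s' 30 = .ofStrs V ∧ s' 29 = .ofStrs X ∧ s' 20 = .ofStr w' ∧ rest ℓ i w' V = rest ℓ t w u ∧
      (picks ℓ i w' V).reverse ++ X = (picks ℓ t w u).reverse ∧
      w'.drop (i * ℓ) = w.drop (t * ℓ)) ?_ ?_ (n := t) ?_).conseq le_rfl ?_)))).mono (by rw [Nat.add_assoc _ 15 1])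
  · rintro s' ⟨h, -⟩
    exact (Data.isCons_eq_false_iff_len _).2 h
  · rintro i s' ⟨hl, h6', V, X, w', hi, hV, h30, h29, hw, hr, hp, hd⟩
    refine ⟨(Data.isCons_iff_len _).2 (by simp [Expr.eval, hl]), ?_⟩
    have hne : V ≠ [] := by rintro rfl; simp at hi
    have hh := horner_lt (ℓ := ℓ) (List.length_pos_iff.2 hne) w'
    refine (Tri.seq_of (τ' := 1) (tri_pick hne hV h30 h29 h6' hw) fun s'' hf hs'' => Tri.assign
      ⟨?_, ?_, V.eraseIdx (horner V.length ℓ 0 w'), V.getD (horner V.length ℓ 0 w') [] :: X,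
        w'.drop ℓ, ?_, ?_, ?_, ?_, ?_, hr, ?_, ?_⟩).mono (by omega)
    · have := hf 28 (by simp [pick, doubleAdd, advance, skip, Cmd.Writes])
      simp [Expr.eval, this, Data.len_tl, hl]
    · have := hf 6 (by simp [pick, doubleAdd, advance, skip, Cmd.Writes])
      simp [this, h6']
    · rw [List.length_eraseIdx_of_lt hh]; omega
    · rw [List.length_eraseIdx_of_lt hh]; omega
    · simp [hs''.1]
    · simp [hs''.2.1]
    · simp [hs''.2.2]
    · rw [← hp]; simp [picks]
    · rw [← hd, List.drop_drop]; congr 1; ring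
  · refine ⟨?_, ?_, u, [], w, ht, le_rfl, ?_, ?_, ?_, rfl, by simp, rfl⟩ <;>
      simp [Expr.eval, h4, h19, h6, h20]
  · rintro s' - ⟨-, -, V, X, w', -, -, h30, h29, h20, hr, hp, hd⟩
    simp only [rest] at hr
    simp only [picks, List.reverse_nil, List.nil_append] at hp
    simp only [Nat.zero_mul, List.drop_zero] at hd
    exact ⟨hr ▸ h30, hp ▸ h29, hd ▸ h20⟩

/-! ### The number of repetitions -/

/-- The number of repetitions: `m * (n choose t) / (k choose t)`, rounded up generously. -/
def reps (n k m : ℕ) : ℕ → ℕ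
  | 0 => m
  | i + 1 => reps n k m i * (n - i) / (k - i) + 1

theorem reps_le_succ {n k m i : ℕ} (hk : i < k) (hn : k ≤ n) :
    reps n k m i ≤ reps n k m (i + 1) := by
  refine Nat.le_succ_of_le ((Nat.le_div_iff_mul_le (by omega)).2 ?_)
  exact Nat.mul_le_mul_left _ (by omega)

/-- Bounds the intermediate values in `countReps` by the final one. -/
theorem reps_mono {n k m i j : ℕ} (hij : i ≤ j) (hk : j ≤ k) (hn : k ≤ n) :
    reps n k m i ≤ reps n k m j := by
  induction j, hij using Nat.le_induction with
  | base => exact le_rfl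
  | succ j _ ih => exact (ih (by omega)).trans (reps_le_succ (by omega) hn)

/-- Count a unit, and add one to the quotient (variable 22) when the divisor (variable 27) has been
counted. -/
def tick : Cmd :=
  .seq (.assign 23 (.tl (.var 23)))
    (.seq (.ite (.var 23) skip
      (.seq (.assign 22 (.cons .nil (.var 22))) (.assign 23 (.var 27))))
      (.assign 25 (.tl (.var 25))))

/-- Multiply variable 21 by variable 26, divide it by variable 27 and add one. -/
def mulDiv : Cmd :=
  .seq (.assign 22 (.cons .nil .nil))
    (.seq (.assign 23 (.var 27))
      (.seq (.assign 24 (.var 21))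
        (.seq (.loop (.var 24)
          (.seq (.assign 25 (.var 26)) (.seq (.loop (.var 25) tick) (.assign 24 (.tl (.var 24))))))
          (.assign 21 (.var 22)))))

/-- Division by counting: variable 22 is one more than the number of full divisors counted so far,
variable 23 is what is missing to the next one. Starting variable 22 at one yields the `+ 1` in
`reps`. -/
theorem tri_tick_loop {T β : ℕ} {s : Store} (hβ : (s 27).len = β)
    (h : (s 22).len * β = T + (s 23).len) (h1 : 1 ≤ (s 23).len) (h2 : (s 23).len ≤ β) :
    Tri (.loop (.var 25) tick) s ((s 25).len * (9 + 1) + 1) fun s' =>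
      (s' 22).len * β = T + (s 25).len + (s' 23).len ∧ 1 ≤ (s' 23).len ∧ (s' 23).len ≤ β := by
  refine (Tri.loop (τ := 9) (fun i s' => (s' 25).len = i ∧ (s' 27).len = β ∧ i ≤ (s 25).len ∧
    (s' 22).len * β = T + ((s 25).len - i) + (s' 23).len ∧ 1 ≤ (s' 23).len ∧ (s' 23).len ≤ β)
    ?_ ?_ (n := (s 25).len) ?_).conseq le_rfl ?_
  · rintro s' ⟨h, -⟩
    exact (Data.isCons_eq_false_iff_len _).2 h
  · rintro i s' ⟨hi, hβ', hle, h, h1, h2⟩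
    refine ⟨(Data.isCons_iff_len _).2 (by simp [Expr.eval, hi]), ?_⟩
    refine (Tri.assign_seq (Tri.seq (τ := 5) (τ' := 1) (Tri.ite (τ := 4) (fun hc => (Tri.skip (Tri.assign ?_)).mono (by omega))
      fun hc => (Tri.assign_seq (Tri.assign (Tri.assign ?_))).mono (by omega)))).mono (by omega)
    · rw [Data.isCons_iff_len] at hc
      simp [Expr.eval, Data.len_tl] at hc
      simp [Expr.eval, Data.len_tl]
      exact ⟨by omega, hβ', by omega, by omega, by omega, by omega⟩
    · rw [Data.isCons_eq_false_iff_len] at hc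
      simp [Expr.eval, Data.len_tl] at hc
      simp [Expr.eval, Data.len_tl]
      exact ⟨by omega, hβ', by omega, by rw [hβ', Nat.succ_mul]; omega, by omega, by omega⟩
  · exact ⟨rfl, hβ, le_rfl, by simpa using h, h1, h2⟩
  · rintro s' - ⟨-, -, -, h⟩
    simpa using h

theorem tri_mulDiv {s : Store} {r a β : ℕ} (h21 : (s 21).len = r) (h26 : (s 26).len = a)
    (h27 : (s 27).len = β) (hβ : 0 < β) :
    Tri mulDiv s (r * (10 * a + 6) + 9) fun s' => (s' 21).len = r * a / β + 1 := by
  have hloop : ∀ s₁ : Store, (s₁ 22).len = 1 → (s₁ 23).len = β → (s₁ 24).len = r →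
      (s₁ 26).len = a → (s₁ 27).len = β →
      Tri (.loop (.var 24) (.seq (.assign 25 (.var 26))
        (.seq (.loop (.var 25) tick) (.assign 24 (.tl (.var 24)))))) s₁
        (r * (10 * a + 5 + 1) + 1) fun s' => (s' 22).len = r * a / β + 1 := by
    intro s₁ h22 h23 h24 h26 h27
    refine (Tri.loop (τ := 10 * a + 5) (fun i s' => (s' 24).len = i ∧ (s' 26).len = a ∧
      (s' 27).len = β ∧ i ≤ r ∧ (s' 22).len * β = (r - i) * a + (s' 23).len ∧
      1 ≤ (s' 23).len ∧ (s' 23).len ≤ β) ?_ ?_ (n := r) ?_).conseq le_rfl ?_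
    · rintro s' ⟨h, -⟩
      exact (Data.isCons_eq_false_iff_len _).2 h
    · rintro i s' ⟨hi, ha, hb, hle, h, h1, h2⟩
      refine ⟨(Data.isCons_iff_len _).2 (by simp [Expr.eval, hi]), ?_⟩
      refine (Tri.assign_seq (Tri.seq_of (τ' := 1) (tri_tick_loop (T := (r - (i + 1)) * a) (β := β)
        ?_ ?_ ?_ ?_) fun s₂ hf hs₂ => Tri.assign ?_)).mono ?_
      · simpa using hb
      · simpa using h
      · simpa using h1
      · simpa using h2
      · have f24 := hf 24 (by simp [tick, skip, Cmd.Writes])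
        have f26 := hf 26 (by simp [tick, skip, Cmd.Writes])
        have f27 := hf 27 (by simp [tick, skip, Cmd.Writes])
        simp only [Function.update_apply, Expr.eval] at f24 f26 f27 hs₂
        simp only [Nat.reduceEqDiff, if_false, if_true] at f24 f26 f27 hs₂
        simp [Expr.eval, Data.len_tl, f24, f26, f27, hi, ha, hb]
        refine ⟨by omega, ?_, hs₂.2⟩
        rw [hs₂.1, ha, show r - i = r - (i + 1) + 1 by omega, Nat.succ_mul]
      · simp [Expr.eval, ha]; omega
    · exact ⟨h24, h26, h27, le_rfl, by simp [h22, h23], by omega, by omega⟩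
    · rintro s' - ⟨-, -, -, -, h, h1, h2⟩
      rw [Nat.sub_zero] at h
      obtain ⟨q, hq⟩ : ∃ q, (s' 22).len = q + 1 :=
        Nat.exists_eq_succ_of_ne_zero (by rintro h0; rw [h0] at h; omega)
      rw [hq] at h ⊢
      congr 1
      rw [Nat.succ_mul] at h
      refine (Nat.div_eq_of_lt_le ?_ ?_).symm
      · omega
      · rw [Nat.succ_mul]; omega
  refine (Tri.assign_seq (Tri.assign_seq (Tri.assign_seq (Tri.seq_of (τ' := 1)
    (hloop _ ?_ ?_ ?_ ?_ ?_) fun s' hf h => Tri.assign ?_)))).mono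
      (by rw [Nat.add_assoc _ 5 1])
  · simp [Expr.eval]
  · simp [Expr.eval, h27]
  · simp [Expr.eval, h21]
  · simp [h26]
  · simp [h27]
  · simpa [Expr.eval] using h

/-- Compute the number of repetitions in variable 21; variable 27 becomes the difference of
variables 18 and 19. -/
def countReps : Cmd :=
  .seq (.assign 21 (.var 7))
    (.seq (.assign 26 (.var 5))
      (.seq (.assign 27 (.var 18))
        (.seq (.assign 28 (.var 19))
          (.loop (.var 28)
            (.seq mulDiv
              (.seq (.assign 26 (.tl (.var 26)))
                (.seq (.assign 27 (.tl (.var 27)))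
                  (.assign 28 (.tl (.var 28))))))))))

theorem tri_countReps {s : Store} {n k t m : ℕ} (ht : t ≤ k) (hk : k ≤ n) (h5 : s 5 = .ofNat n)
    (h18 : s 18 = .ofNat k) (h19 : (s 19).len = t) (h7 : (s 7).len = m) :
    Tri countReps s (t * (reps n k m t * (10 * n + 6) + 16) + 9) fun s' =>
      (s' 21).len = reps n k m t ∧ s' 27 = .ofNat (k - t) := by
  refine (Tri.assign_seq (Tri.assign_seq (Tri.assign_seq (Tri.assign_seq ((Tri.loop
    (τ := reps n k m t * (10 * n + 6) + 15)
    (fun i s' => i ≤ t ∧ (s' 28).len = i ∧ (s' 21).len = reps n k m (t - i) ∧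
      s' 26 = .ofNat (n - (t - i)) ∧ s' 27 = .ofNat (k - (t - i))) ?_ ?_ (n := t) ?_).conseq
      le_rfl ?_))))).mono (by rw [Nat.add_assoc _ 15 1])
  · rintro s' ⟨-, h, -⟩
    exact (Data.isCons_eq_false_iff_len _).2 h
  · rintro i s' ⟨hi, h28, h21, h26, h27⟩
    refine ⟨(Data.isCons_iff_len _).2 (by simp [Expr.eval, h28]), ?_⟩
    refine (Tri.seq_of (τ' := 5) (tri_mulDiv h21 (congrArg Data.len h26) (congrArg Data.len h27)
      (by simp; omega)) fun s₂ hf h => (Tri.assign_seq (Tri.assign_seq (Tri.assign ?_)))).mono ?_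
    · have f26 := hf 26 (by simp [mulDiv, tick, skip, Cmd.Writes])
      have f27 := hf 27 (by simp [mulDiv, tick, skip, Cmd.Writes])
      have f28 := hf 28 (by simp [mulDiv, tick, skip, Cmd.Writes])
      have e : t - i = t - (i + 1) + 1 := by omega
      simp [Expr.eval, Data.len_tl, f26, f27, f28, h26, h27, h28]
      refine ⟨by omega, ?_, ?_, ?_⟩
      · rw [h, e]; simp [reps]
      · congr 1; omega
      · congr 1; omega
    · simp only [Data.len_ofNat]
      have h1 : reps n k m (t - (i + 1)) ≤ reps n k m t := reps_mono (by omega) ht hk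
      have := Nat.mul_le_mul h1 (show 10 * (n - (t - (i + 1))) + 6 ≤ 10 * n + 6 by omega)
      omega
  · refine ⟨le_rfl, ?_, ?_, ?_, ?_⟩ <;> simp [Expr.eval, h5, h18, h19, h7, reps]
  · rintro s' - ⟨-, -, h⟩
    simp only [Nat.sub_zero] at h
    exact ⟨h.1, h.2.2⟩

/-! ### The search for given cardinalities -/

/-- The extension algorithm answers within `E` steps, for all sets with at least `t` elements and all
parameters up to `d`. -/
def AnswersWithin (Φ : ImplicitSetSystem) (P : Cmd) (I : List Bool) (t d E : ℕ) : Prop :=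
  ∀ (l : List (List Bool)) (k : ℕ), l.Nodup → l.toFinset ⊆ Φ.univ I → t ≤ l.length → k ≤ d →
    ∃ r : Bool, (r = true ↔ Φ.Extendable I l.toFinset k) ∧
      ∃ τ s', BigStep P (Function.update (fun _ => Data.nil) 0 (extensionInput I l k)) τ s' ∧
        τ ≤ E ∧ s' 0 = Data.ofBool r

/-- Call the extension algorithm; the answer is in variable 40. -/
def askExtension (P : Cmd) (e f : Expr) : Cmd := call 40 P (.cons (.var 3) (.cons e f))

theorem not_writes_askExtension {P : Cmd} {e f : Expr} {y : ℕ} (h : y < 40) :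
    ¬(askExtension P e f).Writes y := fun hw => absurd (le_of_writes_call hw) (by omega)

theorem tri_askExtension {Φ : ImplicitSetSystem} {P : Cmd} {I : List Bool} {t d E : ℕ}
    (hP : AnswersWithin Φ P I t d E) {e f : Expr} {s : Store} {l : List (List Bool)} {k : ℕ}
    (h3 : s 3 = .ofStr I) (he : ∀ s' : Store, (∀ y < 40, s' y = s y) → e.eval s' = .ofStrs l)
    (hf : ∀ s' : Store, (∀ y < 40, s' y = s y) → f.eval s' = .ofNat k)
    (hl : l.Nodup) (hu : l.toFinset ⊆ Φ.univ I) (ht : t ≤ l.length) (hk : k ≤ d) :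
    Tri (askExtension P e f) s (E + 2 * P.bound + 4) fun s' =>
      (s' 40).isCons = true ↔ Φ.Extendable I l.toFinset k := by
  obtain ⟨r, hr, τ, s', hb, hτ, h0⟩ := hP l k hl hu ht hk
  refine (Tri.call (o := 40) (d := extensionInput I l k) (Q := fun d => d = .ofBool r) ?_
    ⟨τ, s', hb, hτ, h0⟩).conseq le_rfl fun s'' _ h => ?_
  · intro s'' hs
    simp only [Expr.eval, he s'' hs, hf s'' hs, hs 3 (by omega), h3]
    rfl
  · rw [h, Data.isCons_ofBool, hr]

/-! ### Self-reduction from extendability to an explicit set -/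

/-- The set `X` extends to a member of the collection by at most `k` more elements, and all ways to
do so use elements of `V` only. -/
structure Completable (Φ : ImplicitSetSystem) (I : List Bool) (X V : List (List Bool)) (k : ℕ) :
    Prop where
  nodup : (X ++ V).Nodup
  subset : (X ++ V).toFinset ⊆ Φ.univ I
  extendable : Φ.Extendable I X.toFinset k
  solution_subset : ∀ S ⊆ Φ.univ I \ X.toFinset, S ∪ X.toFinset ∈ Φ.sets I → S.card ≤ k →
    S ⊆ V.toFinset

theorem Completable.mem_sets {Φ : ImplicitSetSystem} {I : List Bool} {X : List (List Bool)} {k : ℕ}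
    (h : Completable Φ I X [] k) : X.toFinset ∈ Φ.sets I := by
  obtain ⟨S, hS, hmem, hk⟩ := h.extendable
  have := h.solution_subset S hS hmem hk
  rw [List.toFinset_nil, Finset.subset_empty] at this
  rwa [this, Finset.empty_union] at hmem

/-- Inserting `v` turns a solution for `v :: X` into one for `X`, which uses only `v` and elements
of `V`. -/
theorem Completable.take {Φ : ImplicitSetSystem} {I : List Bool} {X V : List (List Bool)}
    {v : List Bool} {k : ℕ} (h : Completable Φ I X (v :: V) (k + 1))
    (hv : Φ.Extendable I (v :: X).toFinset k) : Completable Φ I (v :: X) V k := by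
  have hperm : ((v :: X) ++ V).Perm (X ++ v :: V) := List.perm_middle.symm
  have hvX : v ∉ X ++ V := (List.nodup_cons.1 (hperm.nodup_iff.2 h.nodup)).1
  rw [List.mem_append, not_or] at hvX
  refine ⟨hperm.nodup_iff.2 h.nodup, ?_, hv, fun S hS hmem hk => ?_⟩
  · rw [List.toFinset_eq_of_perm _ _ hperm]; exact h.subset
  · have hvS : v ∉ S := fun hh => by simpa using (Finset.mem_sdiff.1 (hS hh)).2
    have hvU : v ∈ Φ.univ I := h.subset (by simp)
    have := h.solution_subset (insert v S) ?_ ?_ ?_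
    · intro x hx
      have h1 := this (Finset.mem_insert_of_mem hx)
      rw [List.toFinset_cons, Finset.mem_insert] at h1
      exact h1.resolve_left fun e => hvS (e ▸ hx)
    · intro x hx
      rcases Finset.mem_insert.1 hx with rfl | hx
      · simp [hvU, hvX.1]
      · have := hS hx
        simp only [List.toFinset_cons, Finset.mem_sdiff, Finset.mem_insert, not_or] at this ⊢
        exact ⟨this.1, this.2.2⟩
    · rwa [Finset.insert_union, ← Finset.union_insert, ← List.toFinset_cons]
    · rw [Finset.card_insert_of_notMem hvS]; omega

/-- A solution containing `v` would, with `v` erased, show that `v :: X` is extendable within `k -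
1`. -/
theorem Completable.drop {Φ : ImplicitSetSystem} {I : List Bool} {X V : List (List Bool)}
    {v : List Bool} {k : ℕ} (h : Completable Φ I X (v :: V) k)
    (hv : k = 0 ∨ ¬Φ.Extendable I (v :: X).toFinset (k - 1)) : Completable Φ I X V k := by
  refine ⟨h.nodup.sublist (by simp), ?_, h.extendable, fun S hS hmem hk => ?_⟩
  · refine Finset.Subset.trans (fun x => ?_) h.subset
    simp only [List.mem_toFinset, List.mem_append, List.mem_cons]
    tauto
  · have hsub := h.solution_subset S hS hmem hk
    have hvS : v ∉ S := by
      intro hvS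
      have hpos := Finset.card_pos.2 ⟨v, hvS⟩
      refine hv.elim (by omega) fun hv => hv ⟨S.erase v, ?_, ?_, ?_⟩
      · intro x hx
        have h1 := hS (Finset.mem_of_mem_erase hx)
        have h2 := Finset.ne_of_mem_erase hx
        simp only [List.toFinset_cons, Finset.mem_sdiff, Finset.mem_insert, not_or] at h1 ⊢
        exact ⟨h1.1, h2, h1.2⟩
      · rwa [List.toFinset_cons, Finset.union_insert, ← Finset.insert_union, Finset.insert_erase hvS]
      · rw [Finset.card_erase_of_mem hvS]; omega
    intro x hx
    have h1 := hsub hx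
    rw [List.toFinset_cons, Finset.mem_insert] at h1
    exact h1.resolve_left fun e => hvS (e ▸ hx)

/-- Run through the list in variable 30 and add those elements to the list in variable 29 that keep
it extendable. -/
def greedy (P : Cmd) : Cmd :=
  .loop (.var 30)
    (.seq (.ite (.var 27)
        (.seq (askExtension P (.cons (.hd (.var 30)) (.var 29)) (.tl (.var 27)))
          (.ite (.var 40) (.seq (.assign 29 (.cons (.hd (.var 30)) (.var 29)))
            (.assign 27 (.tl (.var 27)))) skip)) skip)
      (.assign 30 (.tl (.var 30))))

/-- Each element is tested once. The queried sets have more than `t` elements and the parameter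
never grows, so the bound `E` covers all queries. When no element is left, `Completable` forces the
added set to be empty, that is, the collected list is itself a member. -/
theorem tri_greedy {Φ : ImplicitSetSystem} {P : Cmd} {I : List Bool} {t d E : ℕ}
    (hP : AnswersWithin Φ P I t d E) {s : Store} {X V : List (List Bool)} {k : ℕ}
    (h3 : s 3 = .ofStr I) (h30 : s 30 = .ofStrs V) (h29 : s 29 = .ofStrs X) (h27 : s 27 = .ofNat k)
    (hk : k ≤ d) (ht : t ≤ X.length) (hc : Completable Φ I X V k) :
    Tri (greedy P) s (V.length * (E + 2 * P.bound + 13) + 1) fun s' =>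
      ∃ X', s' 29 = .ofStrs X' ∧ X'.Nodup ∧ X'.toFinset ∈ Φ.sets I := by
  refine (Tri.loop (τ := E + 2 * P.bound + 12) (fun i s' => ∃ V X k, V.length = i ∧
    s' 3 = .ofStr I ∧ s' 30 = .ofStrs V ∧ s' 29 = .ofStrs X ∧ s' 27 = .ofNat k ∧ k ≤ d ∧
    t ≤ X.length ∧ Completable Φ I X V k) ?_ ?_
    ⟨V, X, k, rfl, h3, h30, h29, h27, hk, ht, hc⟩).conseq le_rfl ?_
  · rintro s' ⟨V', X', k', hl, -, h, -⟩
    exact (Data.isCons_eq_false_iff_len _).2 (by simp [Expr.eval, h, hl])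
  · rintro i s' ⟨V', X', k', hl, h3, h30, h29, h27, hk, ht, hc⟩
    obtain ⟨v, V', rfl⟩ := List.exists_of_length_succ _ hl
    have hl' : V'.length = i := by simpa using hl
    refine ⟨by simp [Expr.eval, h30], ?_⟩
    refine (Tri.seq (τ := E + 2 * P.bound + 10) (τ' := 1) (Tri.ite (fun hcons => ?_) fun hcons =>
      ?_)).mono (by omega)
    · rw [Data.isCons_iff_len] at hcons
      simp only [Expr.eval, h27, Data.len_ofNat] at hcons
      obtain ⟨k', rfl⟩ := Nat.exists_eq_succ_of_ne_zero hcons.ne'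
      have hnd : (v :: X').Nodup :=
        (List.perm_middle.symm.nodup_iff.2 hc.nodup).sublist
          ((List.sublist_append_left X' V').cons_cons v)
      have hsub : (v :: X').toFinset ⊆ Φ.univ I := by
        refine Finset.Subset.trans (fun x => ?_) hc.subset
        simp only [List.mem_toFinset, List.mem_append, List.mem_cons]
        tauto
      refine (Tri.seq_of (τ' := 4) (tri_askExtension hP (l := v :: X') (k := k') h3 ?_ ?_ hnd hsub
        (by simp; omega) (by omega)) fun s₁ hf h => Tri.ite (fun h1 => ?_) fun h1 => ?_).mono (by omega)
      · intro s'' hs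
        simp [Expr.eval, hs 30, hs 29, h30, h29]
      · intro s'' hs
        simp [Expr.eval, hs 27, h27]
      · have f3 := hf 3 (not_writes_askExtension (by omega))
        have f27 := hf 27 (not_writes_askExtension (by omega))
        have f29 := hf 29 (not_writes_askExtension (by omega))
        have f30 := hf 30 (not_writes_askExtension (by omega))
        refine Tri.assign_seq (Tri.assign (Tri.assign ⟨V', v :: X', k', hl', ?_, ?_, ?_, ?_, by omega,
          by simp; omega, hc.take (h.1 h1)⟩)) <;> simp [Expr.eval, f3, f27, f29, f30, h3, h27, h29, h30]
      · have f3 := hf 3 (not_writes_askExtension (by omega))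
        have f27 := hf 27 (not_writes_askExtension (by omega))
        have f29 := hf 29 (not_writes_askExtension (by omega))
        have f30 := hf 30 (not_writes_askExtension (by omega))
        refine (Tri.skip (Tri.assign ⟨V', X', k' + 1, hl', ?_, ?_, ?_, ?_, hk, ht, hc.drop (.inr ?_)⟩)).mono
          (by omega)
        · simp [f3, h3]
        · simp [Expr.eval, f30, h30]
        · simp [f29, h29]
        · simp [f27, h27]
        · rw [Nat.succ_sub_one, ← h]
          simp only [Expr.eval] at h1
          simp [h1]
    · rw [Data.isCons_eq_false_iff_len] at hcons
      simp only [Expr.eval, h27, Data.len_ofNat] at hcons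
      refine (Tri.skip (Tri.assign ⟨V', X', k', hl', ?_, ?_, ?_, ?_, hk, ht,
        hc.drop (.inl hcons)⟩)).mono (by omega) <;> simp [Expr.eval, h3, h30, h29, h27]
  · rintro s' - ⟨V', X', k', hl, -, -, h29, -, -, -, hc⟩
    rw [List.length_eq_zero_iff] at hl
    subst hl
    exact ⟨X', h29, by simpa using hc.nodup, hc.mem_sets⟩

/-- None of the first `R` blocks of length `B` is a hit. -/
def Misses (hit : List Bool → Prop) (B : ℕ) : ℕ → List Bool → Prop
  | 0, _ => True
  | R + 1, w => ¬hit w ∧ Misses hit B R (w.drop B)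

/-- The coins determine a sample that extends to a member of the collection. -/
def Hit (Φ : ImplicitSetSystem) (I : List Bool) (u : List (List Bool)) (ℓ t d : ℕ)
    (w : List Bool) : Prop :=
  Φ.Extendable I (picks ℓ t w u).toFinset d

/-- Draw a sample and ask if it can be extended; if so, leave the loop. -/
def attempt (P : Cmd) : Cmd :=
  .seq sample
    (.seq (askExtension P (.var 29) (.var 27))
      (.ite (.var 40) (.seq (.assign 37 (.cons .nil .nil)) (.assign 24 .nil))
        (.assign 24 (.tl (.var 24)))))

/-- Search for a member of the collection with variable 18 giving its cardinality, and variable 19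
that of the samples. -/
def search (P : Cmd) : Cmd :=
  .seq countReps
    (.seq (.assign 37 .nil)
      (.seq (.assign 24 (.var 21))
        (.seq (.loop (.var 24) (attempt P))
          (.seq (.assign 35 .nil)
            (.ite (.var 37) (.seq (greedy P) (.assign 35 (.cons .nil (.var 29)))) skip)))))

/-- Every element of the universe is drawn or in `rest`, so no solution can leave `rest`. -/
theorem completable_picks {Φ : ImplicitSetSystem} {I : List Bool} {u : List (List Bool)}
    (hu : Lists u (Φ.univ I)) {ℓ t d : ℕ} {w : List Bool} (ht : t ≤ u.length)
    (h : Hit Φ I u ℓ t d w) : Completable Φ I (picks ℓ t w u).reverse (rest ℓ t w u) d := by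
  have hp : ((picks ℓ t w u).reverse ++ rest ℓ t w u).Perm u :=
    ((List.reverse_perm _).append_right _).trans (picks_append_rest_perm ℓ t w ht)
  refine ⟨hp.nodup_iff.2 hu.1, ?_, ?_, fun S hS _ _ x hx => ?_⟩
  · rw [List.toFinset_eq_of_perm _ _ hp, hu.2]
  · rw [List.toFinset_reverse]; exact h
  · have h1 := hS hx
    rw [Finset.mem_sdiff, ← hu.2, List.mem_toFinset, List.mem_toFinset] at h1
    rw [List.mem_toFinset]
    exact (List.mem_append.1 (hp.mem_iff.2 h1.1)).resolve_left h1.2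

theorem tri_attempts {Φ : ImplicitSetSystem} {P : Cmd} {I : List Bool} {u : List (List Bool)}
    (hu : Lists u (Φ.univ I)) {ℓ t d E R : ℕ} (ht : t ≤ u.length) (hP : AnswersWithin Φ P I t d E)
    {w : List Bool} {s : Store} (h3 : s 3 = .ofStr I) (h4 : s 4 = .ofStrs u) (h6 : (s 6).len = ℓ)
    (h19 : (s 19).len = t) (h20 : s 20 = .ofStr w) (h24 : (s 24).len = R) (h27 : s 27 = .ofNat d)
    (h37 : s 37 = .nil) :
    Tri (.loop (.var 24) (attempt P)) s
      (R * (t * (ℓ * (11 * u.length + 23) + 4 * u.length + 16) + E + 2 * P.bound + 18) + 1)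
      fun s' => ((s' 37).isCons = true ∧ ∃ X V, s' 30 = .ofStrs V ∧ s' 29 = .ofStrs X ∧
          s' 27 = .ofNat d ∧ s' 3 = .ofStr I ∧ t ≤ X.length ∧ V.length ≤ u.length ∧
          Completable Φ I X V d) ∨
        (s' 37 = .nil ∧ s' 20 = .ofStr (w.drop (R * (t * ℓ))) ∧
          Misses (Hit Φ I u ℓ t d) (t * ℓ) R w) := by
  -- The invariant carries an implication from misses on the remaining coins to misses on all of
  -- `w`, instead of recording the coins already used.
  refine (Tri.loop_of_le
    (τ := t * (ℓ * (11 * u.length + 23) + 4 * u.length + 16) + E + 2 * P.bound + 17)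
    (fun i s' => (s' 24).len = i ∧ s' 3 = .ofStr I ∧ s' 4 = .ofStrs u ∧ (s' 6).len = ℓ ∧
      (s' 19).len = t ∧ s' 27 = .ofNat d ∧ s' 37 = .nil ∧ ∃ w', s' 20 = .ofStr w' ∧
      w'.drop (i * (t * ℓ)) = w.drop (R * (t * ℓ)) ∧
      (Misses (Hit Φ I u ℓ t d) (t * ℓ) i w' → Misses (Hit Φ I u ℓ t d) (t * ℓ) R w)) _ ?_ ?_
    ⟨h24, h3, h4, h6, h19, h27, h37, w, h20, rfl, id⟩).mono le_rfl
  · rintro s' ⟨hl, -, -, -, -, -, h37, w', hw, hd, hm⟩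
    refine ⟨(Data.isCons_eq_false_iff_len _).2 hl, .inr ⟨h37, ?_, hm trivial⟩⟩
    rw [hw, ← hd]; simp
  · rintro i s' ⟨hl, h3, h4, h6, h19, h27, h37, w', hw, hd, hm⟩
    refine ⟨(Data.isCons_iff_len _).2 (by simp [Expr.eval, hl]), ?_⟩
    have hperm := picks_append_rest_perm ℓ t w' ht
    refine (Tri.seq_of (τ' := E + 2 * P.bound + 9) (tri_sample ht h4 h19 h6 hw) fun s₁ hf₁ hs₁ =>
      (Tri.seq_of (τ' := 4) (tri_askExtension hP (l := (picks ℓ t w' u).reverse) (k := d)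
        ?_ ?_ ?_ ?_ ?_ ?_ le_rfl) fun s₂ hf₂ hs₂ => Tri.ite (fun h1 => ?_) fun h1 => ?_).mono
        (by omega)).mono (by omega)
    · rw [hf₁ 3 (by simp [sample, pick, doubleAdd, advance, skip, Cmd.Writes]), h3]
    · intro s'' hs
      simp [Expr.eval, hs 29, hs₁.2.1]
    · intro s'' hs
      have := hf₁ 27 (by simp [sample, pick, doubleAdd, advance, skip, Cmd.Writes])
      simp [Expr.eval, hs 27, this, h27]
    · exact List.nodup_reverse.2 ((hperm.nodup_iff.2 hu.1).sublist (List.sublist_append_left _ _))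
    · rw [List.toFinset_reverse, ← hu.2, ← List.toFinset_eq_of_perm _ _ hperm, List.toFinset_append]
      exact Finset.subset_union_left
    · rw [List.length_reverse, length_picks]
    · have f3 := (hf₂ 3 (not_writes_askExtension (by omega))).trans
        (hf₁ 3 (by simp [sample, pick, doubleAdd, advance, skip, Cmd.Writes]))
      have f27 := (hf₂ 27 (not_writes_askExtension (by omega))).trans
        (hf₁ 27 (by simp [sample, pick, doubleAdd, advance, skip, Cmd.Writes]))
      have f29 := (hf₂ 29 (not_writes_askExtension (by omega))).trans hs₁.2.1
      have f30 := (hf₂ 30 (not_writes_askExtension (by omega))).trans hs₁.1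
      refine Tri.assign_seq (Tri.assign (.inr ⟨by simp [Expr.eval], .inl ⟨by simp [Expr.eval],
        (picks ℓ t w' u).reverse, rest ℓ t w' u, ?_, ?_, ?_, ?_, ?_, ?_, completable_picks hu ht ?_⟩⟩))
      · simp [f30]
      · simp [f29]
      · simp [f27, h27]
      · simp [f3, h3]
      · rw [List.length_reverse, length_picks]
      · rw [← hperm.length_eq, List.length_append]; omega
      · have := hs₂.1 h1
        rwa [List.toFinset_reverse] at this
    · have f : ∀ y, y < 40 → ¬sample.Writes y → s₂ y = s' y := fun y hy hy' =>
        (hf₂ y (not_writes_askExtension hy)).trans (hf₁ y hy')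
      have f3 := f 3 (by omega) (by simp [sample, pick, doubleAdd, advance, skip, Cmd.Writes])
      have f4 := f 4 (by omega) (by simp [sample, pick, doubleAdd, advance, skip, Cmd.Writes])
      have f6 := f 6 (by omega) (by simp [sample, pick, doubleAdd, advance, skip, Cmd.Writes])
      have f19 := f 19 (by omega) (by simp [sample, pick, doubleAdd, advance, skip, Cmd.Writes])
      have f24 := f 24 (by omega) (by simp [sample, pick, doubleAdd, advance, skip, Cmd.Writes])
      have f27 := f 27 (by omega) (by simp [sample, pick, doubleAdd, advance, skip, Cmd.Writes])
      have f37 := f 37 (by omega) (by simp [sample, pick, doubleAdd, advance, skip, Cmd.Writes])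
      have f20 := (hf₂ 20 (not_writes_askExtension (by omega))).trans hs₁.2.2
      refine (Tri.assign (.inl ⟨?_, ?_, ?_, ?_, ?_, ?_, ?_, w'.drop (t * ℓ), ?_, ?_, fun hmiss => hm
        ⟨fun hhit => ?_, hmiss⟩⟩)).mono (by omega)
      · simp [Expr.eval, Data.len_tl, f24, hl]
      · simp [f3, h3]
      · simp [f4, h4]
      · simp [f6, h6]
      · simp [f19, h19]
      · simp [f27, h27]
      · simp [f37, h37]
      · simp [f20]
      · rw [← hd, List.drop_drop]; congr 1; ring
      · have h2 := hs₂.2 (by rw [List.toFinset_reverse]; exact hhit)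
        simp only [Expr.eval] at h1
        rw [h1] at h2
        exact absurd h2 (by simp)

/-- A bound for the number of steps of `search`, in terms of the numbers of elements `n`, of coins
per draw `ℓ`, of elements in a sample `t`, of repetitions `R`, of steps of a call `E`. -/
def searchTime (n ℓ t R E : ℕ) : ℕ :=
  t * (R * (10 * n + 6) + 16) + R * (t * (ℓ * (11 * n + 23) + 4 * n + 16) + E + 18) +
    n * (E + 13) + 25

/-- No length of `w` is required: an exhausted supply reads as `false`, and a set that is found is
genuine in any case. `tryPair` tests afterwards whether the coins sufficed. -/
theorem tri_search {Φ : ImplicitSetSystem} {P : Cmd} {I : List Bool} {u : List (List Bool)}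
    (hu : Lists u (Φ.univ I)) {ℓ t k m E : ℕ} (ht : t ≤ k) (hk : k ≤ u.length)
    (hP : AnswersWithin Φ P I t (k - t) E) {w : List Bool} {s : Store}
    (h3 : s 3 = .ofStr I) (h4 : s 4 = .ofStrs u) (h5 : s 5 = .ofNat u.length) (h6 : (s 6).len = ℓ)
    (h7 : (s 7).len = m) (h18 : s 18 = .ofNat k) (h19 : (s 19).len = t) (h20 : s 20 = .ofStr w) :
    Tri (search P) s (searchTime u.length ℓ t (reps u.length k m t) (E + 2 * P.bound))
      fun s' => (∃ S ∈ Φ.sets I, IsSetAnswer (s' 35) S) ∨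
        (s' 35 = .nil ∧ s' 20 = .ofStr (w.drop (reps u.length k m t * (t * ℓ))) ∧
          Misses (Hit Φ I u ℓ t (k - t)) (t * ℓ) (reps u.length k m t) w) := by
  refine (Tri.seq_of (tri_countReps ht hk h5 h18 h19 h7) fun s₁ hf₁ hs₁ => Tri.assign_seq
    (Tri.assign_seq (Tri.seq_of (tri_attempts hu (ht.trans hk) hP (ℓ := ℓ) (w := w)
      (R := reps u.length k m t) ?_ ?_ ?_ ?_ ?_ ?_ ?_ ?_) fun s₂ hf₂ hs₂ => Tri.assign_seq (Tri.ite
        (τ := u.length * (E + 2 * P.bound + 13) + 3) (fun h1 => ?_) fun h1 => ?_)))).mono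
          (?_ : _ ≤ searchTime u.length ℓ t (reps u.length k m t) (E + 2 * P.bound))
  · simp [hf₁ 3 (by simp [countReps, mulDiv, tick, skip, Cmd.Writes]), h3]
  · simp [hf₁ 4 (by simp [countReps, mulDiv, tick, skip, Cmd.Writes]), h4]
  · simp [hf₁ 6 (by simp [countReps, mulDiv, tick, skip, Cmd.Writes]), h6]
  · simp [hf₁ 19 (by simp [countReps, mulDiv, tick, skip, Cmd.Writes]), h19]
  · simp [hf₁ 20 (by simp [countReps, mulDiv, tick, skip, Cmd.Writes]), h20]
  · simp [Expr.eval, hs₁.1]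
  · simp [hs₁.2]
  · simp [Expr.eval]
  · simp [Expr.eval] at h1
    rcases hs₂ with ⟨-, X, V, h30, h29, h27, h3', hX, hV, hc⟩ | ⟨h, -⟩
    · refine (Tri.seq_of (τ' := 1) (tri_greedy hP (X := X) (V := V) (k := k - t) ?_ ?_ ?_ ?_ le_rfl
        hX hc) fun s₃ _ ⟨X', hX', hnd, hmem⟩ => Tri.assign (.inl ⟨_, hmem, X', ⟨hnd, rfl⟩, ?_⟩)).mono ?_
      · simp [h3']
      · simp [h30]
      · simp [h29]
      · simp [h27]
      · have := Nat.mul_le_mul_right (E + 2 * P.bound + 13) hV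
        omega
      · simp [Expr.eval, hX']
    · simp [h] at h1
  · simp [Expr.eval] at h1
    rcases hs₂ with ⟨h, -⟩ | ⟨-, h20', hm⟩
    · simp [h] at h1
    · exact (Tri.skip (.inr ⟨by simp [Expr.eval], by simp [h20'], hm⟩)).mono (by omega)
  · simp only [searchTime]
    have e : t * (ℓ * (11 * u.length + 23) + 4 * u.length + 16) + E + 2 * P.bound + 18 =
      t * (ℓ * (11 * u.length + 23) + 4 * u.length + 16) + (E + 2 * P.bound) + 18 := by ring
    rw [e]
    omega

/-! ### One phase of the algorithm -/

theorem avoids_search {P : Cmd} {y : ℕ} (hy : y = 1 ∨ y = 2) : (search P).Avoids y := by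
  have h40 : y < 40 := by omega
  have h1 : (askExtension P (.var 29) (.var 27)).Avoids y :=
    avoids_call h40 P (by rcases hy with rfl | rfl <;> simp [Expr.Avoids])
  have h2 : (askExtension P (.cons (.hd (.var 30)) (.var 29)) (.tl (.var 27))).Avoids y :=
    avoids_call h40 P (by rcases hy with rfl | rfl <;> simp [Expr.Avoids])
  rcases hy with rfl | rfl <;>
    simp [search, countReps, mulDiv, tick, attempt, sample, pick, doubleAdd, advance, greedy, skip,
      Cmd.Avoids, Expr.Avoids, h1, h2]

theorem deterministic_search {P : Cmd} (h : P.Deterministic) : (search P).Deterministic := by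
  have := fun e f => deterministic_call 40 (.cons (.var 3) (.cons e f)) h
  simp [search, countReps, mulDiv, tick, attempt, sample, pick, doubleAdd, advance, greedy, skip,
      Cmd.Deterministic, askExtension, this]

theorem not_writes_search_clocked {P : Cmd} {y : ℕ} (h3 : 3 ≤ y) (h20 : y < 20) :
    ¬(search P).clocked.Writes y := by
  intro hw
  rcases Cmd.writes_clocked hw with hw | hw | hw
  · have h := fun e f => not_writes_askExtension (P := P) (e := e) (f := f) (show y < 40 by omega)
    simp only [search, countReps, mulDiv, tick, attempt, sample, pick, doubleAdd, advance, greedy,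
      skip, Cmd.Writes, h, false_or] at hw
    omega
  · omega
  · omega

/-- The variables that describe the instance and the current phase. -/
structure PhaseData (I : List Bool) (u : List (List Bool)) (ℓ m T : ℕ) (w : List Bool)
    (s : Store) : Prop where
  h3 : s 3 = .ofStr I
  h4 : s 4 = .ofStrs u
  h5 : s 5 = .ofNat u.length
  h6 : (s 6).len = ℓ
  h7 : (s 7).len = m
  h8 : (s 8).len = T
  h9 : s 9 = .ofStr w

theorem PhaseData.congr {I : List Bool} {u : List (List Bool)} {ℓ m T : ℕ} {w : List Bool}
    {s s' : Store} (h : PhaseData I u ℓ m T w s) (hs : ∀ y, 3 ≤ y → y ≤ 9 → s' y = s y) :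
    PhaseData I u ℓ m T w s' := by
  constructor <;> rw [hs _ (by omega) (by omega)]
  exacts [h.h3, h.h4, h.h5, h.h6, h.h7, h.h8, h.h9]

/-- The tree is an answer that is never wrong. -/
def SafeAnswer (Φ : ImplicitSetSystem) (I : List Bool) (d : Data) : Prop :=
  d = .nil ∨ ∃ S ∈ Φ.sets I, IsSetAnswer d S

/-- The coins suffice for all repetitions, and all of these miss. -/
def AllMiss (Φ : ImplicitSetSystem) (I : List Bool) (u : List (List Bool)) (ℓ m k t : ℕ)
    (w : List Bool) : Prop :=
  reps u.length k m t * (t * ℓ) < w.length ∧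
    Misses (Hit Φ I u ℓ t (k - t)) (t * ℓ) (reps u.length k m t) w

/-- The bound for the number of steps of a search. -/
def searchCost (u : List (List Bool)) (ℓ m B : ℕ) (E : ℕ → ℕ → ℕ) (k t : ℕ) : ℕ :=
  searchTime u.length ℓ t (reps u.length k m t) (E k t + 2 * B)

/-- Hence `T` coins are enough for a search whose time bound is below `T`. -/
theorem coins_le_searchTime (n ℓ t R E : ℕ) : R * (t * ℓ) ≤ searchTime n ℓ t R E := by
  have h1 : t * ℓ ≤ t * (ℓ * (11 * n + 23) + 4 * n + 16) + E + 18 := by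
    have := Nat.mul_le_mul_left t (show ℓ ≤ ℓ * (11 * n + 23) + 4 * n + 16 by nlinarith)
    omega
  have := Nat.mul_le_mul_left R h1
  unfold searchTime
  omega

/-- Search with a time limit, for one pair of cardinalities. -/
def tryPair (P : Cmd) : Cmd :=
  .seq (.assign 1 (.var 8))
    (.seq (.assign 20 (.var 9))
      (.seq (.assign 18 (.tl (.var 13)))
        (.seq (.assign 19 (.tl (.var 15)))
          (.seq (search P).clocked
            (.ite (.var 1)
              (.ite (.var 35) (.seq (.assign 11 (.var 35)) (.assign 14 (.cons .nil .nil)))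
                (.ite (.var 20) (.assign 14 (.cons .nil .nil)) skip))
              skip)))))

/-- `K` is the factor by which the clock slows down the search. -/
def ClockFactor (P : Cmd) (K : ℕ) : Prop :=
  ∀ s τ (Q : Store → Prop), Tri (search P) s τ Q →
    Tri (search P).clocked s (K * ((s 1).len + 1)) fun s' =>
      ((s' 1).isCons = true → ∃ s'', Q s'' ∧ AgreeOffClock s'' s') ∧
      (τ < (s 1).len → (s' 1).isCons = true)

theorem exists_clockFactor {P : Cmd} (h : P.Deterministic) : ∃ K, ClockFactor P K :=
  exists_tri_clocked (deterministic_search h) (avoids_search (.inl rfl)) (avoids_search (.inr rfl))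

/-- The results are looked at only if the clock has survived, since only then do they agree with
those of the original search. `T` serves both as the clock and as the number of coins, so a cost
below `T` excludes both ways of being cut short. -/
theorem tri_tryPair {Φ : ImplicitSetSystem} {P : Cmd} {K : ℕ} (hK : ClockFactor P K) {I : List Bool}
    {u : List (List Bool)} (hu : Lists u (Φ.univ I)) {ℓ m T t k : ℕ} {E : ℕ → ℕ → ℕ} (ht : t ≤ k)
    (hk : k ≤ u.length) (hP : AnswersWithin Φ P I t (k - t) (E k t)) {w : List Bool}
    (hw : w.length = T) {s : Store} (hs : PhaseData I u ℓ m T w s) (h13 : s 13 = .ofNat (k + 1))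
    (h15 : s 15 = .ofNat (t + 1)) (h11 : SafeAnswer Φ I (s 11)) :
    Tri (tryPair P) s (K * (T + 1) + 14) fun s' =>
      SafeAnswer Φ I (s' 11) ∧ ((s 11).isCons = true → (s' 11).isCons = true) ∧
      ((s 14).isCons = true → (s' 14).isCons = true) ∧
      ((s' 14).isCons = true → (s 14).isCons = true ∨ (s' 11).isCons = true ∨
        AllMiss Φ I u ℓ m k t w) ∧
      (searchCost u ℓ m P.bound E k t < T → (s' 14).isCons = true) := by
  set s₁ := Function.update (Function.update (Function.update (Function.update s 1 (s 8)) 20 (s 9))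
    18 (.ofNat k)) 19 (.ofNat t) with hs₁
  have hsearch := tri_search hu (ℓ := ℓ) (m := m) (w := w) (s := s₁) ht hk hP
    (by simp [hs₁, hs.h3]) (by simp [hs₁, hs.h4]) (by simp [hs₁, hs.h5]) (by simp [hs₁, hs.h6])
    (by simp [hs₁, hs.h7]) (by simp [hs₁]) (by simp [hs₁]) (by simp [hs₁, hs.h9])
  have hclk := hK _ _ _ hsearch
  have hs₁1 : (s₁ 1).len = T := by simp [hs₁, hs.h8]
  rw [hs₁1] at hclk
  refine (Tri.assign_seq (Tri.assign_seq (Tri.assign_seq (Tri.assign_seq (Tri.seq_of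
    (τ := K * (T + 1)) (τ' := 5) (by convert hclk using 1; simp [hs₁, Expr.eval, h13, h15])
    fun s₂ hf h => Tri.ite (fun h1 => Tri.ite (fun h2 => Tri.assign_seq (Tri.assign ?_))
      fun h2 => Tri.ite (fun h3 => (Tri.assign ?_).mono (by omega)) fun h3 =>
        (Tri.skip ?_).mono (by omega)) fun h1 => (Tri.skip ?_).mono (by omega)))))).mono (by omega)
  all_goals
    have f11 := hf 11 (not_writes_search_clocked (by omega) (by omega))
    have f14 := hf 14 (not_writes_search_clocked (by omega) (by omega))
    simp at f11 f14
    simp only [Expr.eval] at h1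
  · obtain ⟨s₃, hs₃, hag⟩ := h.1 h1
    simp only [Expr.eval] at h2
    have e35 := hag 35 (by omega) (by omega)
    rcases hs₃ with hS | hS
    · rw [← e35] at hS
      refine ⟨.inr ?_, ?_, ?_, ?_, ?_⟩
      · simpa [Expr.eval] using hS
      · simp [Expr.eval, h2]
      · simp [Expr.eval]
      · simp [Expr.eval, h2]
      · simp [Expr.eval]
    · rw [e35, hS.1] at h2
      simp at h2
  · obtain ⟨s₃, hs₃, hag⟩ := h.1 h1
    simp only [Expr.eval] at h2 h3
    have e35 := hag 35 (by omega) (by omega)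
    have e20 := hag 20 (by omega) (by omega)
    rcases hs₃ with ⟨S, hS, l, hl, hl'⟩ | ⟨-, h20, hm⟩
    · rw [e35, hl'] at h2
      simp at h2
    · refine ⟨by simpa [f11] using h11, by simp [f11], by simp [Expr.eval],
        fun _ => .inr (.inr ⟨?_, hm⟩), by simp [Expr.eval]⟩
      -- A coin left over shows that the supply was strictly longer than what all repetitions
      -- consumed.
      rw [e20, h20, Data.isCons_iff_len, Data.len_ofStr, List.length_drop] at h3
      omega
  · refine ⟨by simpa [f11] using h11, by simp [f11], by simp [f14], by simp +contextual [f14], ?_⟩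
    intro hlt
    obtain ⟨s₃, hs₃, hag⟩ := h.1 h1
    simp only [Expr.eval] at h2 h3
    have e35 := hag 35 (by omega) (by omega)
    have e20 := hag 20 (by omega) (by omega)
    rcases hs₃ with ⟨S, hS, l, hl, hl'⟩ | ⟨-, h20, hm⟩
    · rw [e35, hl'] at h2
      simp at h2
    · rw [e20, h20, Data.isCons_eq_false_iff_len, Data.len_ofStr, List.length_drop] at h3
      have := coins_le_searchTime u.length ℓ t (reps u.length k m t) (E k t + 2 * P.bound)
      unfold searchCost at hlt
      omega
  · refine ⟨by simpa [f11] using h11, by simp [f11], by simp [f14], by simp +contextual [f14], ?_⟩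
    intro hlt
    have := h.2 hlt
    rw [h1] at this
    simp at this

theorem not_writes_tryPair {P : Cmd} {y : ℕ} (h3 : 3 ≤ y) (h20 : y < 18) (h11 : y ≠ 11)
    (h14 : y ≠ 14) : ¬(tryPair P).Writes y := by
  have := not_writes_search_clocked (P := P) h3 (by omega)
  simp only [tryPair, skip, Cmd.Writes, this, false_or]
  omega

/-- Try all cardinalities of samples. -/
def trySamples (P : Cmd) : Cmd :=
  .seq (.assign 14 .nil)
    (.seq (.assign 15 (.var 13))
      (.loop (.var 15) (.seq (tryPair P) (.assign 15 (.tl (.var 15))))))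

/-- Variables 13 and 15 hold `k + 1` and `t + 1`, so that loops ending at the empty list still visit
the cardinality zero. -/
theorem tri_trySamples {Φ : ImplicitSetSystem} {P : Cmd} {K : ℕ} (hK : ClockFactor P K)
    {I : List Bool} {u : List (List Bool)} (hu : Lists u (Φ.univ I)) {ℓ m T k : ℕ} {E : ℕ → ℕ → ℕ}
    (hk : k ≤ u.length) (hP : ∀ t ≤ k, AnswersWithin Φ P I t (k - t) (E k t)) {w : List Bool}
    (hw : w.length = T) {s : Store} (hs : PhaseData I u ℓ m T w s) (h13 : s 13 = .ofNat (k + 1))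
    (h11 : SafeAnswer Φ I (s 11)) :
    Tri (trySamples P) s ((u.length + 1) * (K * (T + 1) + 17) + 5) fun s' =>
      SafeAnswer Φ I (s' 11) ∧ ((s 11).isCons = true → (s' 11).isCons = true) ∧
      ((s' 14).isCons = true → (s' 11).isCons = true ∨ ∃ t ≤ k, AllMiss Φ I u ℓ m k t w) ∧
      ((∃ t ≤ k, searchCost u ℓ m P.bound E k t < T) → (s' 14).isCons = true) := by
  refine (Tri.assign_seq (Tri.assign_seq ((Tri.loop (τ := K * (T + 1) + 16)
    (fun i s' => i ≤ k + 1 ∧ s' 15 = .ofNat i ∧ s' 13 = .ofNat (k + 1) ∧ PhaseData I u ℓ m T w s' ∧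
      SafeAnswer Φ I (s' 11) ∧ ((s 11).isCons = true → (s' 11).isCons = true) ∧
      ((s' 14).isCons = true → (s' 11).isCons = true ∨ ∃ t ≤ k, AllMiss Φ I u ℓ m k t w) ∧
      ((∃ t, i ≤ t ∧ t ≤ k ∧ searchCost u ℓ m P.bound E k t < T) → (s' 14).isCons = true))
    ?_ ?_ (n := k + 1) ?_).conseq le_rfl ?_))).mono ?_
  · rintro s' ⟨-, h, -⟩
    simp [Expr.eval, h]
  · rintro i s' ⟨hi, h15, h13, hd, hsafe, hmono, hmiss, hdone⟩
    refine ⟨by simp [Expr.eval, h15, Data.ofNat_succ], ?_⟩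
    refine (Tri.seq_of (τ' := 1) (tri_tryPair hK hu (E := E) (show i ≤ k by omega) hk
      (hP i (by omega)) hw hd h13 h15 hsafe) fun s₁ hf ⟨h1, h2, h3, h4, h5⟩ =>
        Tri.assign ⟨by omega, ?_, ?_, ?_, ?_, ?_, ?_, ?_⟩).mono (by omega)
    · have := hf 15 (not_writes_tryPair (by omega) (by omega) (by omega) (by omega))
      simp [Expr.eval, this, h15]
    · have := hf 13 (not_writes_tryPair (by omega) (by omega) (by omega) (by omega))
      simp [this, h13]
    · refine hd.congr fun y hy3 hy9 => ?_
      rw [Function.update_of_ne (by omega)]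
      exact hf y (not_writes_tryPair (by omega) (by omega) (by omega) (by omega))
    · simpa using h1
    · simpa using fun h => h2 (hmono h)
    · intro h
      simp only [ne_eq, Nat.reduceEqDiff, not_false_eq_true, Function.update_of_ne] at h ⊢
      rcases h4 h with h | h | h
      · exact (hmiss h).imp_left h2
      · exact .inl h
      · exact .inr ⟨i, by omega, h⟩
    · rintro ⟨t, ht, htk, hlt⟩
      simp only [ne_eq, Nat.reduceEqDiff, not_false_eq_true, Function.update_of_ne]
      rcases ht.eq_or_lt with rfl | ht
      · exact h5 hlt
      · exact h3 (hdone ⟨t, ht, htk, hlt⟩)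
  · refine ⟨le_rfl, by simp [Expr.eval, h13], by simp [h13], hs.congr fun y hy3 hy9 => ?_,
      by simpa using h11, by simp, by simp [Expr.eval], ?_⟩
    · rw [Function.update_of_ne (by omega), Function.update_of_ne (by omega)]
    · rintro ⟨t, ht, htk, -⟩; omega
  · rintro s' - ⟨-, -, -, -, h1, h2, h3, h4⟩
    exact ⟨h1, h2, h3, fun ⟨t, ht, hlt⟩ => h4 ⟨t, Nat.zero_le _, ht, hlt⟩⟩
  · have := Nat.mul_le_mul_right (K * (T + 1) + 17) (Nat.succ_le_succ hk)
    simp only [Nat.succ_eq_add_one] at this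
    rw [Nat.add_assoc _ 16 1, show 16 + 1 = 17 from rfl]
    omega

theorem not_writes_trySamples {P : Cmd} {y : ℕ} (h3 : 3 ≤ y) (h20 : y < 18) (h11 : y ≠ 11)
    (h14 : y ≠ 14) (h15 : y ≠ 15) : ¬(trySamples P).Writes y := by
  have := not_writes_tryPair (P := P) h3 h20 h11 h14
  simp only [trySamples, Cmd.Writes, this, false_or]
  omega

/-- Try all pairs of cardinalities; stop if a set has been found, or if for all cardinalities of the
set the search has been completed for some cardinality of the samples. -/
def tryAll (P : Cmd) : Cmd :=
  .seq (.assign 12 (.cons .nil .nil))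
    (.seq (.assign 13 (.cons .nil (.var 5)))
      (.seq (.loop (.var 13) (.seq (trySamples P)
          (.seq (.ite (.var 14) skip (.assign 12 .nil)) (.assign 13 (.tl (.var 13))))))
        (.ite (.var 11) (.assign 10 .nil) (.ite (.var 12) (.assign 10 .nil) skip))))

/-- One completed `t` for each `k` justifies stopping: for the cardinality of an actual member,
repeated misses are improbable for every `t`, so it does not matter which one was completed. -/
theorem tri_tryAll {Φ : ImplicitSetSystem} {P : Cmd} {K : ℕ} (hK : ClockFactor P K)
    {I : List Bool} {u : List (List Bool)} (hu : Lists u (Φ.univ I)) {ℓ m T : ℕ} {E : ℕ → ℕ → ℕ}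
    (hP : ∀ k t, t ≤ k → k ≤ u.length → AnswersWithin Φ P I t (k - t) (E k t)) {w : List Bool}
    (hw : w.length = T) {s : Store} (hs : PhaseData I u ℓ m T w s) (h11 : SafeAnswer Φ I (s 11)) :
    Tri (tryAll P) s ((u.length + 1) * ((u.length + 1) * (K * (T + 1) + 17) + 11) + 9) fun s' =>
      SafeAnswer Φ I (s' 11) ∧
      ((s' 10).isCons = false → (s 10).isCons = false ∨ (s' 11).isCons = true ∨
        ∀ k ≤ u.length, ∃ t ≤ k, AllMiss Φ I u ℓ m k t w) ∧
      ((∀ k ≤ u.length, ∃ t ≤ k, searchCost u ℓ m P.bound E k t < T) → (s' 10).isCons = false) := by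
  refine (Tri.assign_seq (Tri.assign_seq (Tri.seq_of (τ' := 3)
    (Tri.loop (τ := (u.length + 1) * (K * (T + 1) + 17) + 10)
    (fun i s' => i ≤ u.length + 1 ∧ s' 13 = .ofNat i ∧ PhaseData I u ℓ m T w s' ∧
      SafeAnswer Φ I (s' 11) ∧
      ((s' 12).isCons = true → (s' 11).isCons = true ∨
        ∀ k, i ≤ k → k ≤ u.length → ∃ t ≤ k, AllMiss Φ I u ℓ m k t w) ∧
      ((∀ k ≤ u.length, ∃ t ≤ k, searchCost u ℓ m P.bound E k t < T) → (s' 12).isCons = true))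
    ?_ ?_ (n := u.length + 1) ?_) fun s₁ hf ⟨_, _, _, h1, h2, h3⟩ => Tri.ite (fun hc =>
      (Tri.assign ?_).mono (by omega)) fun hc => Tri.ite (fun hc' => Tri.assign ?_)
        fun hc' => Tri.skip ?_))).mono (by rw [Nat.add_assoc _ 10 1])
  · rintro s' ⟨-, h, -⟩
    simp [Expr.eval, h]
  · rintro i s' ⟨hi, h13, hd, hsafe, hmiss, hdone⟩
    refine ⟨by simp [Expr.eval, h13, Data.ofNat_succ], ?_⟩
    refine (Tri.seq_of (τ' := 4) (tri_trySamples hK hu (E := E) (show i ≤ u.length by omega)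
      (fun t ht => hP i t ht (by omega)) hw hd h13 hsafe) fun s₁ hf ⟨h1, h2, h3, h4⟩ =>
        (Tri.seq (τ := 2) (Tri.ite (fun hc => Tri.skip (Tri.assign ?_))
          fun hc => (Tri.assign (Tri.assign ?_)).mono (by omega))).mono (by omega)).mono (by omega)
    all_goals
      have f13 := hf 13 (not_writes_trySamples (by omega) (by omega) (by omega) (by omega) (by omega))
      have f12 := hf 12 (not_writes_trySamples (by omega) (by omega) (by omega) (by omega) (by omega))
      simp only [Expr.eval] at hc
    · refine ⟨by omega, ?_, hd.congr fun y hy3 hy9 => ?_, ?_, ?_, ?_⟩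
      · simp [Expr.eval, f13, h13]
      · rw [Function.update_of_ne (by omega), Function.update_of_ne (by omega)]
        exact hf y (not_writes_trySamples (by omega) (by omega) (by omega) (by omega) (by omega))
      · simpa using h1
      · intro h
        simp only [ne_eq, Nat.reduceEqDiff, not_false_eq_true, Function.update_of_ne, f12] at h ⊢
        rcases hmiss h with h | h
        · exact .inl (h2 h)
        · refine (h3 hc).imp_right fun hi' k hik hk => ?_
          rcases hik.eq_or_lt with rfl | hik
          · exact hi'
          · exact h k hik hk
      · intro h
        simpa [f12] using hdone h
    · refine ⟨by omega, ?_, hd.congr fun y hy3 hy9 => ?_, ?_, ?_, ?_⟩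
      · simp [Expr.eval, f13, h13]
      · rw [Function.update_of_ne (by omega), Function.update_of_ne (by omega)]
        exact hf y (not_writes_trySamples (by omega) (by omega) (by omega) (by omega) (by omega))
      · simpa using h1
      · simp [Expr.eval]
      · intro h
        have := h4 (h i (by omega))
        rw [hc] at this
        simp at this
  · refine ⟨le_rfl, ?_, hs.congr fun y hy3 hy9 => ?_, by simpa using h11, ?_, ?_⟩
    · simp [Expr.eval, hs.h5, Data.ofNat_succ]
    · rw [Function.update_of_ne (by omega), Function.update_of_ne (by omega)]
    · intro _
      exact .inr fun k hk hk' => by omega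
    · simp [Expr.eval]
  · simp only [Expr.eval] at hc
    exact ⟨by simpa using h1, by simp [hc], by simp [Expr.eval]⟩
  · simp only [Expr.eval] at hc hc'
    refine ⟨by simpa using h1, fun _ => .inr ?_, by simp [Expr.eval]⟩
    simpa using h2 hc'
  · simp only [Expr.eval] at hc hc'
    have f10 := hf 10 (by
      have := not_writes_trySamples (P := P) (y := 10) (by omega) (by omega) (by omega) (by omega)
        (by omega)
      simp [Cmd.Writes, skip, this])
    simp at f10
    refine ⟨by simpa using h1, fun h => .inl ?_, fun h => ?_⟩
    · simpa [f10] using h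
    · have := h3 h
      rw [hc'] at this
      simp at this

theorem not_writes_tryAll {P : Cmd} {y : ℕ} (h3 : 3 ≤ y) (h9 : y ≤ 9) : ¬(tryAll P).Writes y := by
  have := not_writes_trySamples (P := P) h3 (by omega) (by omega) (by omega) (by omega)
  simp only [tryAll, skip, Cmd.Writes, this, false_or]
  omega

/-! ### Averages over lists of coins -/

/-- The average of `f` over all lists of `n` coins. -/
noncomputable def avg : ℕ → (List Bool → ℝ) → ℝ
  | 0, f => f []
  | n + 1, f => (avg n (fun w => f (false :: w)) + avg n (fun w => f (true :: w))) / 2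

theorem avg_mono {n : ℕ} {f g : List Bool → ℝ} (h : ∀ w, w.length = n → f w ≤ g w) :
    avg n f ≤ avg n g := by
  induction n generalizing f g with
  | zero => exact h [] rfl
  | succ n ih =>
    have h1 := ih (f := fun w => f (false :: w)) (g := fun w => g (false :: w))
      fun w hw => h _ (by simp [hw])
    have h2 := ih (f := fun w => f (true :: w)) (g := fun w => g (true :: w))
      fun w hw => h _ (by simp [hw])
    simp only [avg]
    linarith

theorem avg_congr {n : ℕ} {f g : List Bool → ℝ} (h : ∀ w, w.length = n → f w = g w) :
    avg n f = avg n g :=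
  le_antisymm (avg_mono fun w hw => (h w hw).le) (avg_mono fun w hw => (h w hw).ge)

theorem avg_const (n : ℕ) (c : ℝ) : avg n (fun _ => c) = c := by
  induction n with
  | zero => rfl
  | succ n ih => simp only [avg, ih]; ring

theorem avg_add (n : ℕ) (f g : List Bool → ℝ) :
    avg n (fun w => f w + g w) = avg n f + avg n g := by
  induction n generalizing f g with
  | zero => rfl
  | succ n ih => simp only [avg, ih]; ring

theorem avg_const_mul (n : ℕ) (c : ℝ) (f : List Bool → ℝ) :
    avg n (fun w => c * f w) = c * avg n f := by
  induction n generalizing f with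
  | zero => rfl
  | succ n ih => simp only [avg, ih]; ring

theorem avg_sum {ι : Type*} (n : ℕ) (s : Finset ι) (f : ι → List Bool → ℝ) :
    avg n (fun w => ∑ i ∈ s, f i w) = ∑ i ∈ s, avg n (f i) := by
  classical
  induction s using Finset.induction_on with
  | empty => simpa using avg_const n 0
  | insert a s ha ih => simp only [Finset.sum_insert ha, avg_add, ih]

theorem avg_append (m n : ℕ) (f : List Bool → ℝ) :
    avg (m + n) f = avg m fun v => avg n fun w => f (v ++ w) := by
  induction m generalizing f with
  | zero => simp [avg]
  | succ m ih => rw [Nat.succ_add]; simp [avg, ih]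

theorem avg_snoc (n : ℕ) (f : List Bool → ℝ) :
    avg (n + 1) f = (avg n (fun w => f (w ++ [false])) + avg n (fun w => f (w ++ [true]))) / 2 := by
  rw [avg_append, ← avg_add, div_eq_inv_mul, ← avg_const_mul]
  exact avg_congr fun w _ => by simp only [avg]; ring

/-! ### The probability of a hit -/

/-- The coins are the binary digits of a uniform number `y < 2 ^ ℓ`, and reducing modulo `m` after
each digit agrees with reducing once at the end. -/
theorem avg_horner {m : ℕ} (ℓ : ℕ) {a : ℕ} (ha : a < m) (h : ℕ → ℝ) :
    avg ℓ (fun w => h (horner m ℓ a w)) =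
      (∑ y ∈ Finset.range (2 ^ ℓ), h ((2 ^ ℓ * a + y) % m)) / 2 ^ ℓ := by
  induction ℓ generalizing a with
  | zero => simp [avg, horner, Nat.mod_eq_of_lt ha]
  | succ ℓ ih =>
    have hm : 0 < m := by omega
    simp only [avg, horner, List.headD_cons, List.tail_cons]
    rw [ih (Nat.mod_lt _ hm), ih (Nat.mod_lt _ hm), pow_succ, mul_two, Finset.sum_range_add]
    have e : ∀ b y, (2 ^ ℓ * ((2 * a + b) % m) + y) % m = (2 ^ ℓ * (2 * a + b) + y) % m := by
      intro b y
      rw [Nat.add_mod, Nat.mul_mod, Nat.mod_mod, ← Nat.mul_mod, ← Nat.add_mod]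
    simp only [e, Bool.toNat_false, Bool.toNat_true]
    have e1 : ∀ y, 2 ^ ℓ * (2 * a + 0) + y = (2 ^ ℓ + 2 ^ ℓ) * a + y := fun y => by ring
    have e2 : ∀ y, 2 ^ ℓ * (2 * a + 1) + y = (2 ^ ℓ + 2 ^ ℓ) * a + (2 ^ ℓ + y) := fun y => by ring
    simp only [e1, e2]
    rw [pow_succ]
    field_simp

theorem sum_range_mul_mod (q m : ℕ) (h : ℕ → ℝ) :
    ∑ y ∈ Finset.range (q * m), h (y % m) = q * ∑ i ∈ Finset.range m, h i := by
  induction q with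
  | zero => simp
  | succ q ih =>
    rw [Nat.succ_mul, Finset.sum_range_add, ih]
    have : ∑ x ∈ Finset.range m, h ((q * m + x) % m) = ∑ i ∈ Finset.range m, h i :=
      Finset.sum_congr rfl fun x hx => by
        rw [Nat.add_comm, Nat.add_mul_mod_self_right, Nat.mod_eq_of_lt (Finset.mem_range.1 hx)]
    rw [this]; push_cast; ring

/-- Each residue is attained by at least `2 ^ ℓ / m` (rounded down) of the numbers below `2 ^ ℓ`. -/
theorem le_avg_horner {m : ℕ} (ℓ : ℕ) (hm : 0 < m) {h : ℕ → ℝ} (hh : ∀ i, 0 ≤ h i) :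
    ((2 ^ ℓ / m : ℕ) : ℝ) / 2 ^ ℓ * ∑ i ∈ Finset.range m, h i ≤
      avg ℓ fun w => h (horner m ℓ 0 w) := by
  rw [avg_horner ℓ hm, div_mul_eq_mul_div]
  gcongr
  rw [← sum_range_mul_mod]
  simp only [mul_zero, zero_add]
  exact Finset.sum_le_sum_of_subset_of_nonneg
    (Finset.range_mono (Nat.div_mul_le_self _ _)) fun _ _ _ => hh _

open Classical in
/-- The indicator function of a property of lists of coins. -/
noncomputable def ind (p : Prop) : ℝ := if p then 1 else 0

theorem ind_nonneg (p : Prop) : 0 ≤ ind p := by unfold ind; split_ifs <;> norm_num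

theorem ind_le_one (p : Prop) : ind p ≤ 1 := by unfold ind; split_ifs <;> norm_num

theorem ind_of {p : Prop} (h : p) : ind p = 1 := if_pos h

theorem ind_of_not {p : Prop} (h : ¬p) : ind p = 0 := if_neg h

theorem ind_mono {p q : Prop} (h : p → q) : ind p ≤ ind q := by
  unfold ind; split_ifs <;> simp_all

theorem horner_append {m ℓ a : ℕ} {v : List Bool} (hv : ℓ ≤ v.length) (w : List Bool) :
    horner m ℓ a (v ++ w) = horner m ℓ a v := by
  induction ℓ generalizing a v with
  | zero => rfl
  | succ ℓ ih =>
    cases v with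
    | nil => simp at hv
    | cons b v =>
      simp only [List.length_cons, Nat.add_le_add_iff_right] at hv
      simp [horner, ih hv]

theorem picks_append {ℓ t : ℕ} {v : List Bool} (hv : t * ℓ ≤ v.length) (w : List Bool)
    (V : List (List Bool)) : picks ℓ t (v ++ w) V = picks ℓ t v V := by
  induction t generalizing v V with
  | zero => rfl
  | succ t ih =>
    rw [Nat.succ_mul] at hv
    simp only [picks, horner_append (show ℓ ≤ v.length by omega)]
    rw [List.drop_append_of_le_length (by omega), ih (by simp; omega)]

/-- A lower bound for the probability that `t` elements drawn from `μ` ones all belong to a set of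
`κ` elements. -/
noncomputable def hitBound (ℓ : ℕ) : ℕ → ℕ → ℕ → ℝ
  | 0, _, _ => 1
  | t + 1, κ, μ => ((2 ^ ℓ / μ : ℕ) : ℝ) / 2 ^ ℓ * κ * hitBound ℓ t (κ - 1) (μ - 1)

theorem hitBound_nonneg (ℓ t κ μ : ℕ) : 0 ≤ hitBound ℓ t κ μ := by
  induction t generalizing κ μ with
  | zero => exact zero_le_one
  | succ t ih => have := ih (κ - 1) (μ - 1); simp only [hitBound]; positivity

/-- Condition on the first draw: if it falls in `S`, erase it from both `S` and `V` and use
induction; the other outcomes are bounded below by zero. The function `h` is this conditional lower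
bound. -/
theorem hitBound_le_avg (ℓ : ℕ) {t : ℕ} {V : List (List Bool)} (hV : V.Nodup)
    {S : Finset (List Bool)} (hS : S ⊆ V.toFinset) (ht : t ≤ S.card) :
    hitBound ℓ t S.card V.length ≤ avg (t * ℓ) fun w => ind (∀ x ∈ picks ℓ t w V, x ∈ S) := by
  induction t generalizing V S with
  | zero => simp [hitBound, avg, picks, ind]
  | succ t ih =>
    have hcard : S.card ≤ V.length := (Finset.card_le_card hS).trans (List.toFinset_card_le V)
    set c := hitBound ℓ t (S.card - 1) (V.length - 1) with hc
    have hc0 : 0 ≤ c := hitBound_nonneg _ _ _ _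
    set h : ℕ → ℝ := fun i => c * ind (V.getD i [] ∈ S) with hh
    have hsum : ∑ i ∈ Finset.range V.length, h i = S.card * c := by
      have e1 : ∑ i ∈ Finset.range V.length, h i = (V.map fun x => c * ind (x ∈ S)).sum := by
        rw [Finset.sum_range, ← List.sum_ofFn]
        congr 1
        refine List.ext_getElem (by simp) fun i h₁ h₂ => ?_
        simp only [List.getElem_ofFn, List.getElem_map, hh]
        rw [List.getD_eq_getElem _ _ (by simpa using h₂)]
      rw [e1, ← List.sum_toFinset _ hV, ← Finset.mul_sum, mul_comm]
      congr 1
      rw [← Finset.sum_subset hS fun x _ hx => ind_of_not hx,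
        Finset.sum_congr rfl fun x hx => ind_of hx]
      simp
    have hmul : (t + 1) * ℓ = ℓ + t * ℓ := by ring
    rw [hmul, avg_append]
    calc hitBound ℓ (t + 1) S.card V.length
        = ((2 ^ ℓ / V.length : ℕ) : ℝ) / 2 ^ ℓ * ∑ i ∈ Finset.range V.length, h i := by
          rw [hsum]; simp only [hitBound, ← hc]; ring
      _ ≤ avg ℓ fun v => h (horner V.length ℓ 0 v) :=
          le_avg_horner ℓ (by omega) fun i => mul_nonneg hc0 (ind_nonneg _)
      _ ≤ _ := avg_mono fun v hv => ?_
    have hi := horner_lt (ℓ := ℓ) (show 0 < V.length by omega) v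
    set i := horner V.length ℓ 0 v with hi'
    simp only [hh, picks, horner_append hv.ge, ← hi']
    by_cases hx : V.getD i [] ∈ S
    · have hx' : V[i] ∈ S := by rwa [List.getD_eq_getElem _ _ hi] at hx
      have hlen : (V.eraseIdx i).length = V.length - 1 := List.length_eraseIdx_of_lt hi
      have hcard' : (S.erase V[i]).card = S.card - 1 := Finset.card_erase_of_mem hx'
      have := ih (V := V.eraseIdx i) (S := S.erase V[i]) (hV.sublist (List.eraseIdx_sublist _ _))
        (fun x hx => ?_) (by omega)
      · rw [hlen, hcard', ← hc] at this
        refine le_trans ?_ (this.trans (avg_mono fun w _ => ind_mono fun hw x hx => ?_))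
        · rw [ind_of hx, mul_one]
        · rw [List.drop_append_of_le_length hv.ge, List.drop_of_length_le hv.le, List.nil_append,
            List.mem_cons] at hx
          rcases hx with rfl | hx
          · assumption
          · exact Finset.mem_of_mem_erase (hw x hx)
      · have h1 := hS (Finset.mem_of_mem_erase hx)
        have h2 := Finset.ne_of_mem_erase hx
        rw [List.mem_toFinset] at h1 ⊢
        rw [← (List.getElem_cons_eraseIdx_perm hi).mem_iff, List.mem_cons] at h1
        exact h1.resolve_left h2
    · rw [ind_of_not hx, mul_zero, ← avg_const (t * ℓ) 0]
      exact avg_mono fun _ _ => ind_nonneg _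

/-- Successive repetitions read disjoint blocks of coins and are therefore independent; the last `L`
coins play no role. -/
theorem avg_misses_le {hit : List Bool → Prop} {B : ℕ} {p : ℝ}
    (happ : ∀ v w : List Bool, v.length = B → (hit (v ++ w) ↔ hit v))
    (hp : p ≤ avg B fun v => ind (hit v)) (R L : ℕ) :
    avg (R * B + L) (fun w => ind (Misses hit B R w)) ≤ (1 - p) ^ R := by
  have hp1 : 0 ≤ 1 - p := sub_nonneg.2 (hp.trans ((avg_mono fun _ _ => ind_le_one _).trans
    (avg_const B 1).le))
  induction R with
  | zero => simpa [Misses, ind] using (avg_const L 1).le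
  | succ R ih =>
    rw [show (R + 1) * B + L = B + (R * B + L) by ring, avg_append]
    calc _ ≤ avg B fun v => (1 - p) ^ R * (1 + (-1) * ind (hit v)) := avg_mono fun v hv => ?_
      _ ≤ _ := by
        rw [avg_const_mul, avg_add, avg_const, avg_const_mul, pow_succ]
        exact mul_le_mul_of_nonneg_left (by linarith) (pow_nonneg hp1 _)
    by_cases h : hit v
    · simp only [Misses, happ v _ hv, h, not_true, false_and]
      simp [ind, avg_const]
    · simp only [Misses, happ v _ hv, h, not_false_eq_true, true_and]
      simp only [ind, if_false, mul_zero, add_zero, mul_one]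
      refine (avg_mono fun w _ => ?_).trans ih
      rw [List.drop_append_of_le_length hv.ge, List.drop_of_length_le hv.le, List.nil_append]
      exact le_rfl

/-! ### From the probability of a hit to the failure probability of a phase -/

/-- The reciprocal of the probability that a random `t`-subset of an `n`-set is contained in a given
`k`-subset. -/
noncomputable def ratio (n k t : ℕ) : ℝ := n.descFactorial t / k.descFactorial t

theorem ratio_pos {n k t : ℕ} (ht : t ≤ k) (hk : k ≤ n) : 0 < ratio n k t := by
  have h1 : (0 : ℝ) < n.descFactorial t := by exact_mod_cast Nat.descFactorial_pos.2 (ht.trans hk)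
  have h2 : (0 : ℝ) < k.descFactorial t := by exact_mod_cast Nat.descFactorial_pos.2 ht
  exact div_pos h1 h2

theorem ratio_succ (n k t : ℕ) :
    ratio n k (t + 1) = ratio n k t * ((n - t : ℕ) / (k - t : ℕ)) := by
  simp only [ratio, Nat.descFactorial_succ]
  push_cast
  rw [mul_div_mul_comm, mul_comm]

theorem one_le_ratio {n k t : ℕ} (ht : t ≤ k) (hk : k ≤ n) : 1 ≤ ratio n k t := by
  have h2 : (0 : ℝ) < k.descFactorial t := by exact_mod_cast Nat.descFactorial_pos.2 ht
  rw [ratio, one_le_div h2]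
  exact_mod_cast Nat.descFactorial_le _ hk

theorem div_le_natDiv_add_one (a : ℕ) {b : ℕ} (hb : 0 < b) :
    (a : ℝ) / b ≤ ((a / b : ℕ) : ℝ) + 1 := by
  rw [div_le_iff₀ (by exact_mod_cast hb), mul_comm]
  exact_mod_cast (Nat.lt_mul_div_succ a hb).le

theorem mul_ratio_le_reps {k t : ℕ} (n m : ℕ) (ht : t ≤ k) :
    m * ratio n k t ≤ reps n k m t := by
  induction t with
  | zero => simp [ratio, reps]
  | succ t ih =>
    have h1 : ((reps n k m t * (n - t) : ℕ) : ℝ) / (k - t : ℕ) ≤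
        ((reps n k m t * (n - t) / (k - t) : ℕ) : ℝ) + 1 := div_le_natDiv_add_one _ (by omega)
    rw [ratio_succ, reps, ← mul_assoc]
    push_cast at h1 ⊢
    refine le_trans ?_ h1
    rw [mul_div_assoc]
    exact mul_le_mul_of_nonneg_right (ih (by omega)) (by positivity)

/-- Each of the `t` roundings adds at most one, and one is at most the current ratio. -/
theorem reps_le_mul_ratio {n k t : ℕ} (m : ℕ) (ht : t ≤ k) (hk : k ≤ n) :
    (reps n k m t : ℝ) ≤ (m + t) * ratio n k t := by
  induction t with
  | zero => simp [ratio, reps]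
  | succ t ih =>
    have h1 : ((reps n k m t * (n - t) / (k - t) : ℕ) : ℝ) ≤
      ((reps n k m t * (n - t) : ℕ) : ℝ) / (k - t : ℕ) := Nat.cast_div_le
    have h2 := one_le_ratio ht hk
    rw [reps]
    push_cast at h1 ⊢
    have h3 : (reps n k m t : ℝ) * (n - t : ℕ) / (k - t : ℕ) ≤ (m + t) * ratio n k (t + 1) := by
      rw [ratio_succ, ← mul_assoc, mul_div_assoc]
      exact mul_le_mul_of_nonneg_right (ih (by omega)) (by positivity)
    nlinarith

/-- Since ⌊2^ℓ/μ⌋ ≥ 2^ℓ/μ - 1 and μ ≤ n, each draw loses at most the factor 1 - n/2^ℓ against an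
exactly uniform one. -/
theorem le_hitBound {ℓ n t κ μ : ℕ} (hκ : t ≤ κ) (hμ : κ ≤ μ) (hn : μ ≤ n) (hℓ : n ≤ 2 ^ ℓ) :
    (1 - (n : ℝ) / 2 ^ ℓ) ^ t ≤ hitBound ℓ t κ μ * ratio μ κ t := by
  induction t generalizing κ μ with
  | zero => simp [hitBound, ratio]
  | succ t ih =>
    obtain ⟨κ, rfl⟩ := Nat.exists_eq_succ_of_ne_zero (show κ ≠ 0 by omega)
    obtain ⟨μ, rfl⟩ := Nat.exists_eq_succ_of_ne_zero (show μ ≠ 0 by omega)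
    have h2 : (0 : ℝ) < 2 ^ ℓ := by positivity
    have hμ0 : (0 : ℝ) < (μ + 1 : ℕ) := by positivity
    have hκ0 : (0 : ℝ) < (κ + 1 : ℕ) := by positivity
    have hd : (0 : ℝ) < κ.descFactorial t := by
      exact_mod_cast Nat.descFactorial_pos.2 (by omega : t ≤ κ)
    have hfloor : (2 : ℝ) ^ ℓ / (μ + 1 : ℕ) ≤ ((2 ^ ℓ / (μ + 1) : ℕ) : ℝ) + 1 := by
      have := div_le_natDiv_add_one (2 ^ ℓ) (Nat.succ_pos μ)
      exact_mod_cast this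
    have hfac : 1 - (n : ℝ) / 2 ^ ℓ ≤ ((2 ^ ℓ / (μ + 1) : ℕ) : ℝ) / 2 ^ ℓ * (μ + 1 : ℕ) := by
      rw [div_le_iff₀ hμ0] at hfloor
      have hn' : ((μ + 1 : ℕ) : ℝ) ≤ n := by exact_mod_cast hn
      rw [div_mul_eq_mul_div, one_sub_div h2.ne', div_le_div_iff_of_pos_right h2]
      linarith
    have h0 : 0 ≤ 1 - (n : ℝ) / 2 ^ ℓ := by
      rw [sub_nonneg, div_le_one h2]; exact_mod_cast hℓ
    have hih := ih (κ := κ) (μ := μ) (by omega) (by omega) (by omega)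
    calc (1 - (n : ℝ) / 2 ^ ℓ) ^ (t + 1) = (1 - (n : ℝ) / 2 ^ ℓ) * (1 - (n : ℝ) / 2 ^ ℓ) ^ t := by ring
      _ ≤ (((2 ^ ℓ / (μ + 1) : ℕ) : ℝ) / 2 ^ ℓ * (μ + 1 : ℕ)) * (hitBound ℓ t κ μ * ratio μ κ t) :=
          mul_le_mul hfac hih (pow_nonneg h0 _) (by positivity)
      _ = _ := by
          simp only [hitBound, ratio, Nat.succ_eq_add_one, Nat.succ_descFactorial_succ,
            Nat.add_sub_cancel]
          rw [Nat.cast_mul, Nat.cast_mul]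
          field_simp

theorem four_mul_sq_le (n : ℕ) : 4 * (n * n) ≤ 2 ^ (2 * n + 2) := by
  have h : n ≤ 2 ^ n := Nat.lt_two_pow_self.le
  calc 4 * (n * n) ≤ 4 * (2 ^ n * 2 ^ n) := by gcongr
    _ = 2 ^ (2 * n + 2) := by ring

/-- By Bernoulli's inequality, `t ≤ n` draws lose at most n²/2^(2n+2) ≤ 1/4. -/
theorem three_quarters_le_hitBound {n t k : ℕ} (ht : t ≤ k) (hk : k ≤ n) :
    3 / 4 ≤ hitBound (2 * n + 2) t k n * ratio n k t := by
  have h4 : (4 : ℝ) * (n * n) ≤ 2 ^ (2 * n + 2) := by exact_mod_cast four_mul_sq_le n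
  have h2 : (0 : ℝ) < 2 ^ (2 * n + 2) := by positivity
  have hle : n ≤ 2 ^ (2 * n + 2) := by nlinarith [four_mul_sq_le n]
  refine le_trans ?_ (le_hitBound ht hk le_rfl hle)
  have hx : (n : ℝ) / 2 ^ (2 * n + 2) ≤ 1 := by
    rw [div_le_one h2]; exact_mod_cast hle
  have htn : (t : ℝ) ≤ n := by exact_mod_cast ht.trans hk
  have hb := one_add_mul_le_pow (a := -((n : ℝ) / 2 ^ (2 * n + 2))) (by linarith) t
  have htx : (t : ℝ) * (n / 2 ^ (2 * n + 2)) ≤ 1 / 4 := by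
    rw [mul_div_assoc', div_le_iff₀ h2]
    nlinarith [Nat.cast_nonneg (α := ℝ) n]
  rw [← sub_eq_add_neg] at hb
  linarith

theorem pow_reps_le {n t k m : ℕ} {p : ℝ} (ht : t ≤ k) (hk : k ≤ n) (hp1 : p ≤ 1)
    (hp : 3 / 4 ≤ p * ratio n k t) : (1 - p) ^ reps n k m t ≤ (1 / 2) ^ m := by
  have hr := ratio_pos ht hk
  have hp0 : 0 ≤ p := by
    by_contra h
    nlinarith [mul_neg_of_neg_of_pos (not_le.1 h) hr]
  have h1 : 3 / 4 * (m : ℝ) ≤ p * reps n k m t := by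
    nlinarith [mul_ratio_le_reps n m ht, mul_le_mul_of_nonneg_left (mul_ratio_le_reps n m ht) hp0,
      Nat.cast_nonneg (α := ℝ) m]
  -- From e^y ≥ 1 + y + y²/2 at y = 3/4, whose value is 65/32 > 2.
  have he : Real.exp (-(3 / 4)) ≤ 1 / 2 := by
    rw [Real.exp_neg, one_div, inv_le_inv₀ (Real.exp_pos _) two_pos]
    nlinarith [Real.quadratic_le_exp_of_nonneg (show (0 : ℝ) ≤ 3 / 4 by norm_num)]
  calc (1 - p) ^ reps n k m t ≤ Real.exp (-p) ^ reps n k m t :=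
        pow_le_pow_left₀ (by linarith) (Real.one_sub_le_exp_neg p) _
    _ = Real.exp (-(p * reps n k m t)) := by rw [← Real.exp_nat_mul]; congr 1; ring
    _ ≤ Real.exp (m * -(3 / 4)) := Real.exp_le_exp.2 (by linarith)
    _ = Real.exp (-(3 / 4)) ^ m := Real.exp_nat_mul _ _
    _ ≤ (1 / 2) ^ m := pow_le_pow_left₀ (Real.exp_pos _).le he _

/-- A sample contained in `S` is a hit, the rest of `S` being the extension. If `T` coins are too
few for all repetitions, `AllMiss` is impossible by its first clause. -/
theorem avg_allMiss_le {Φ : ImplicitSetSystem} {I : List Bool} {u : List (List Bool)}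
    (hu : Lists u (Φ.univ I)) {S : Finset (List Bool)} (hS : S ∈ Φ.sets I) {t m : ℕ}
    (ht : t ≤ S.card) (T : ℕ) :
    avg T (fun w => ind (AllMiss Φ I u (2 * u.length + 2) m S.card t w)) ≤ (1 / 2) ^ m := by
  set ℓ := 2 * u.length + 2 with hℓ
  have hSu : S ⊆ u.toFinset := hu.2 ▸ Φ.subset_univ I S hS
  have hk : S.card ≤ u.length := (Finset.card_le_card hSu).trans (List.toFinset_card_le u)
  have hhit : ∀ w, (∀ x ∈ picks ℓ t w u, x ∈ S) → Hit Φ I u ℓ t (S.card - t) w := by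
    intro w hw
    have hsub : (picks ℓ t w u).toFinset ⊆ S := fun x hx => hw x (List.mem_toFinset.1 hx)
    have hnd : (picks ℓ t w u).Nodup :=
      ((picks_append_rest_perm ℓ t w (ht.trans hk)).nodup_iff.2 hu.1).sublist
        (List.sublist_append_left _ _)
    refine ⟨S \ (picks ℓ t w u).toFinset, Finset.sdiff_subset_sdiff (Φ.subset_univ I S hS) le_rfl,
      ?_, ?_⟩
    · rwa [Finset.sdiff_union_of_subset hsub]
    · rw [Finset.card_sdiff_of_subset hsub, List.toFinset_card_of_nodup hnd, length_picks]
  have hp : hitBound ℓ t S.card u.length ≤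
      avg (t * ℓ) fun w => ind (Hit Φ I u ℓ t (S.card - t) w) :=
    (hitBound_le_avg ℓ hu.1 hSu ht).trans (avg_mono fun w _ => ind_mono (hhit w))
  have hp1 : hitBound ℓ t S.card u.length ≤ 1 :=
    hp.trans ((avg_mono fun _ _ => ind_le_one _).trans (avg_const _ 1).le)
  have hpow := pow_reps_le (m := m) ht hk hp1 (three_quarters_le_hitBound ht hk)
  by_cases hT : reps u.length S.card m t * (t * ℓ) < T
  · obtain ⟨L, rfl⟩ := Nat.exists_eq_add_of_le hT.le
    refine le_trans (avg_mono fun w _ => ind_mono fun h => h.2) ((avg_misses_le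
      (fun v w hv => ?_) hp _ L).trans hpow)
    simp only [Hit, picks_append hv.ge]
  · refine le_trans (avg_mono (g := fun _ => 0) fun w hw => ?_) ((avg_const T 0).le.trans
      (by positivity))
    rw [ind, if_neg]
    rintro ⟨h, -⟩
    rw [hw] at h
    exact hT h

/-- Only `k = S.card` matters, for one fixed member `S`. The union bound over its at most n + 1 ≤
2^n values of `t` is paid for by the summand `u.length` in the repetition parameter. -/
theorem avg_bad_le {Φ : ImplicitSetSystem} {I : List Bool} {u : List (List Bool)}
    (hu : Lists u (Φ.univ I)) (j T : ℕ) :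
    avg T (fun w => ind ((Φ.sets I).Nonempty ∧ ∀ k ≤ u.length, ∃ t ≤ k,
      AllMiss Φ I u (2 * u.length + 2) (u.length + 3 + j) k t w)) ≤ (1 / 2) ^ (3 + j) := by
  by_cases hne : (Φ.sets I).Nonempty
  · obtain ⟨S, hS⟩ := hne
    have hSu : S ⊆ u.toFinset := hu.2 ▸ Φ.subset_univ I S hS
    have hk : S.card ≤ u.length := (Finset.card_le_card hSu).trans (List.toFinset_card_le u)
    set m := u.length + 3 + j with hm
    calc _ ≤ avg T fun w => ∑ t ∈ Finset.range (S.card + 1),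
            ind (AllMiss Φ I u (2 * u.length + 2) m S.card t w) := avg_mono fun w _ => ?_
      _ = ∑ t ∈ Finset.range (S.card + 1), avg T fun w =>
            ind (AllMiss Φ I u (2 * u.length + 2) m S.card t w) := avg_sum _ _ _
      _ ≤ ∑ t ∈ Finset.range (S.card + 1), (1 / 2 : ℝ) ^ m := Finset.sum_le_sum fun t ht =>
          avg_allMiss_le hu hS (by rw [Finset.mem_range] at ht; omega) T
      _ ≤ _ := ?_
    · by_cases h : ∀ k ≤ u.length, ∃ t ≤ k, AllMiss Φ I u (2 * u.length + 2) m k t w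
      · obtain ⟨t, ht, hmiss⟩ := h S.card hk
        refine le_trans ?_ (Finset.single_le_sum (fun t _ => ind_nonneg _)
          (Finset.mem_range.2 (Nat.lt_succ_of_le ht)))
        exact ind_mono fun _ => hmiss
      · rw [ind, if_neg fun hh => h hh.2]
        exact Finset.sum_nonneg fun t _ => ind_nonneg _
    · rw [Finset.sum_const, Finset.card_range, nsmul_eq_mul, hm, add_assoc, pow_add, ← mul_assoc]
      refine mul_le_of_le_one_left (by positivity) ?_
      have h2 : S.card + 1 ≤ 2 ^ u.length := (Nat.succ_le_succ hk).trans Nat.lt_two_pow_self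
      rw [one_div, inv_pow, mul_inv_le_iff₀ (by positivity), one_mul]
      exact_mod_cast h2
  · refine le_trans (avg_mono (g := fun _ => 0) fun w hw => ?_) ((avg_const T 0).le.trans
      (by positivity))
    rw [ind, if_neg fun h => hne h.1]

/-! ### The best cardinality of the samples -/

/-- Terms of the negative binomial series. -/
noncomputable def nbTerm (x : ℝ) (r j : ℕ) : ℝ := ((j + r).choose r : ℝ) * x ^ j

theorem nbTerm_succ (x : ℝ) (r j : ℕ) :
    (j + 1 : ℝ) * nbTerm x r (j + 1) = x * (j + 1 + r) * nbTerm x r j := by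
  have h : (j + 1) * (j + 1 + r).choose r = (j + 1 + r) * (j + r).choose r := by
    have := Nat.add_one_mul_choose_eq (j + r) j
    rw [show j + 1 + r = j + r + 1 by ring, ← Nat.choose_symm_of_eq_add (show j + r + 1 = (j + 1) + r by ring),
      ← Nat.choose_symm_of_eq_add (rfl : j + r = j + r), this]
    ring
  have h' : ((j : ℝ) + 1) * ((j + 1 + r).choose r : ℝ) = (j + 1 + r) * ((j + r).choose r : ℝ) := by
    exact_mod_cast h
  simp only [nbTerm]
  rw [← mul_assoc, h', pow_succ]
  ring

theorem exists_large_nbTerm {x : ℝ} (hx0 : 0 < x) (hx1 : x < 1) {r k : ℕ}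
    (h : x * r ≤ (1 - x) * k) :
    ∃ j ≤ k, 1 / (1 - x) ^ (r + 1) ≤ nbTerm x r j * (2 * k + 2 / (1 - x)) := by
  have hpos : ∀ j, 0 ≤ nbTerm x r j := fun j => by unfold nbTerm; positivity
  obtain ⟨j₀, hj₀, hmax⟩ := Finset.exists_max_image (Finset.range (k + 1)) (nbTerm x r)
    ⟨0, by simp⟩
  have hj₀' : j₀ ≤ k := by simpa [Nat.lt_succ_iff] using hj₀
  refine ⟨j₀, hj₀', ?_⟩
  set G := nbTerm x r j₀ with hG
  -- The quotient of consecutive terms is x + xr/(j+1) ≤ x + (1-x)k/(j+1), at most one as soon as j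
  -- + 1 ≥ k.
  have hle : ∀ j, nbTerm x r j ≤ G := by
    intro j
    induction j with
    | zero => exact hmax 0 (by simp)
    | succ j ih =>
      by_cases hj : j + 1 ≤ k
      · exact hmax _ (by simpa using hj)
      · have hkj : (k : ℝ) ≤ j + 1 := by exact_mod_cast (by omega : k ≤ j + 1)
        have h1 : x * (j + 1 + r) ≤ j + 1 := by nlinarith
        have h2 := nbTerm_succ x r j
        have h3 : (0 : ℝ) < j + 1 := by positivity
        have h4 := mul_le_mul_of_nonneg_right h1 (hpos j)
        rw [← h2] at h4
        exact (le_of_mul_le_mul_left h4 h3).trans ih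
  -- For indices from 2k on, the same quotient is at most x + (1-x)/2 = (1+x)/2.
  have htail : ∀ i, nbTerm x r (i + 2 * k) ≤ G * ((1 + x) / 2) ^ i := by
    intro i
    induction i with
    | zero => simpa using hle (0 + 2 * k)
    | succ i ih =>
      have h1 : x * (((i + 2 * k : ℕ) : ℝ) + 1 + r) ≤ (((i + 2 * k : ℕ) : ℝ) + 1) * ((1 + x) / 2) := by
        push_cast
        nlinarith [Nat.cast_nonneg (α := ℝ) i]
      have h2 := nbTerm_succ x r (i + 2 * k)
      have h3 : (0 : ℝ) < ((i + 2 * k : ℕ) : ℝ) + 1 := by positivity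
      have h4 := mul_le_mul_of_nonneg_right h1 (hpos (i + 2 * k))
      rw [← h2, mul_assoc] at h4
      have h5 := le_of_mul_le_mul_left h4 h3
      rw [show i + 1 + 2 * k = i + 2 * k + 1 by ring, pow_succ]
      nlinarith
  have hnorm : ‖x‖ < 1 := by rwa [Real.norm_of_nonneg hx0.le]
  have hs : Summable (nbTerm x r) := by
    have := summable_choose_mul_geometric_of_norm_lt_one r hnorm
    exact this
  have hsum : ∑' j, nbTerm x r j = 1 / (1 - x) ^ (r + 1) :=
    tsum_choose_mul_geometric_of_norm_lt_one r hnorm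
  have hy0 : 0 ≤ (1 + x) / 2 := by positivity
  have hy1 : (1 + x) / 2 < 1 := by linarith
  have hgeo := (hasSum_geometric_of_lt_one hy0 hy1).mul_left G
  have htsum : ∑' i, nbTerm x r (i + 2 * k) ≤ G * (1 - (1 + x) / 2)⁻¹ := by
    rw [← hgeo.tsum_eq]
    exact ((summable_nat_add_iff (2 * k)).2 hs).tsum_le_tsum htail hgeo.summable
  have hfin : ∑ j ∈ Finset.range (2 * k), nbTerm x r j ≤ 2 * k * G := by
    refine (Finset.sum_le_card_nsmul _ _ G fun j _ => hle j).trans ?_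
    simp
  rw [← hsum, ← hs.sum_add_tsum_nat_add (2 * k)]
  have he : (1 - (1 + x) / 2)⁻¹ = 2 / (1 - x) := by
    rw [show 1 - (1 + x) / 2 = (1 - x) / 2 by ring, inv_div]
  rw [he] at htsum
  linarith

/-- Counting pairs of a `t`-set inside a `k`-set gives C(n,k) C(k,t) = C(n,t) C(n-t,k-t). -/
theorem ratio_mul_choose {n k t : ℕ} (ht : t ≤ k) :
    ratio n k t * ((n - t).choose (k - t) : ℝ) = n.choose k := by
  have h := Nat.choose_mul (n := n) ht
  have h1 : (0 : ℝ) < k.choose t := by exact_mod_cast Nat.choose_pos ht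
  have h2 : (0 : ℝ) < t.factorial := by exact_mod_cast t.factorial_pos
  have h' : (n.choose k : ℝ) * k.choose t = n.choose t * (n - t).choose (k - t) := by
    exact_mod_cast h
  rw [ratio, Nat.descFactorial_eq_factorial_mul_choose, Nat.descFactorial_eq_factorial_mul_choose,
    Nat.cast_mul, Nat.cast_mul, mul_div_mul_left _ _ h2.ne', div_mul_eq_mul_div, ← h',
    mul_div_cancel_right₀ _ h1.ne']

theorem exists_good_sample_card {b c : ℝ} (hb : 1 ≤ b) (hc : 1 ≤ c) {n k : ℕ} (hk : k ≤ n) :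
    ∃ t ≤ k, ratio n k t * (b ^ (n - t) * c ^ (k - t)) ≤ 2 * (n + 1) * (1 + b - 1 / c) ^ n := by
  have hb0 : 0 < b := by linarith
  have hc0 : 0 < c := by linarith
  set x : ℝ := 1 / (b * c) with hx
  have hx0 : 0 < x := by positivity
  have hxbc : x * (b * c) = 1 := by rw [hx]; field_simp
  have hx1 : x ≤ 1 := by
    rw [hx, div_le_one (by positivity)]; nlinarith
  have hA : 1 + b - 1 / c = 1 + b * (1 - x) := by
    have : b * x = 1 / c := by rw [hx]; field_simp
    linarith
  have hA1 : 1 ≤ 1 + b - 1 / c := by rw [hA]; nlinarith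
  by_cases hkx : (k : ℝ) ≤ x * n
  -- Without sampling the cost is b^n c^k ≤ (b c^x)^n. AM-GM with weights x and 1-x on bc and b
  -- gives b c^x ≤ 1 + b(1-x).
  · refine ⟨0, Nat.zero_le _, ?_⟩
    have hgm := Real.geom_mean_le_arith_mean2_weighted hx0.le (sub_nonneg.2 hx1)
      (show 0 ≤ b * c by positivity) hb0.le (by ring)
    have hA' : b * c ^ x ≤ 1 + b - 1 / c := by
      have e : (b * c) ^ x * b ^ (1 - x) = b * c ^ x := by
        rw [Real.mul_rpow hb0.le hc0.le, mul_right_comm, ← Real.rpow_add hb0]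
        simp
      rw [← e, hA]
      linarith
    have hck : c ^ k ≤ (c ^ x) ^ n := by
      rw [← Real.rpow_natCast c k, ← Real.rpow_natCast (c ^ x) n, ← Real.rpow_mul hc0.le]
      exact Real.rpow_le_rpow_of_exponent_le hc hkx
    have h1 : b ^ n * c ^ k ≤ (1 + b - 1 / c) ^ n :=
      calc b ^ n * c ^ k ≤ b ^ n * (c ^ x) ^ n := by gcongr
        _ = (b * c ^ x) ^ n := (mul_pow _ _ _).symm
        _ ≤ _ := pow_le_pow_left₀ (by positivity) hA' n
    have h2 : (1 + b - 1 / c) ^ n ≤ 2 * (n + 1) * (1 + b - 1 / c) ^ n :=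
      le_mul_of_one_le_left (by positivity) (by nlinarith [Nat.cast_nonneg (α := ℝ) n])
    simpa [ratio] using h1.trans h2
  · have hx1' : x < 1 := by
      refine lt_of_le_of_ne hx1 fun h => hkx ?_
      rw [h, one_mul]; exact_mod_cast hk
    obtain ⟨r, rfl⟩ := Nat.exists_eq_add_of_le hk
    have hxr : x * r ≤ (1 - x) * k := by
      push_cast at hkx
      nlinarith
    obtain ⟨j, hj, hlarge⟩ := exists_large_nbTerm hx0 hx1' hxr
    -- The index `j` of the large term is the number of elements left to the extension algorithm.
    refine ⟨k - j, Nat.sub_le _ _, ?_⟩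
    have e1 : k + r - (k - j) = j + r := by omega
    have e2 : k - (k - j) = j := by omega
    have hratio := ratio_mul_choose (n := k + r) (Nat.sub_le k j)
    rw [e1, e2] at hratio ⊢
    rw [Nat.choose_symm_add, Nat.choose_symm_add] at hratio
    set y := 1 - x with hy
    have hy0 : 0 < y := by simpa [hy] using hx1'
    have hA0 : ((k + r).choose r : ℝ) * (b * y) ^ r ≤ (1 + b - 1 / c) ^ (k + r) := by
      rw [hA, add_pow (1 : ℝ)]
      refine le_trans (le_of_eq ?_) (Finset.single_le_sum (f := fun m => (1 : ℝ) ^ m *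
        (b * y) ^ (k + r - m) * ((k + r).choose m : ℝ)) (fun i _ => by positivity)
        (Finset.mem_range.2 (show k < k + r + 1 by omega)))
      simp only [one_pow, one_mul, Nat.add_sub_cancel_left]
      rw [Nat.choose_symm_add, mul_comm]
    set R := ratio (k + r) k (k - j) with hR
    have hRpos : 0 < R := ratio_pos (Nat.sub_le k j) hk
    have hnb : R * (b ^ (j + r) * c ^ j) * nbTerm x r j = ((k + r).choose r : ℝ) * b ^ r := by
      have hxj : (b * c) ^ j * x ^ j = 1 := by rw [← mul_pow, mul_comm (b * c), hxbc, one_pow]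
      calc R * (b ^ (j + r) * c ^ j) * nbTerm x r j
          = (R * ((j + r).choose r : ℝ)) * b ^ r * ((b * c) ^ j * x ^ j) := by
            rw [nbTerm, mul_pow, pow_add]; ring
        _ = _ := by rw [hxj, mul_one, hratio]
    set Z := R * (b ^ (j + r) * c ^ j) with hZ
    have hZ0 : 0 ≤ Z := by positivity
    -- By `hlarge` the factors appended to `Z` have product at least one; in `h2` they turn `Z` into
    -- the binomial term of `hA0` times 2ky + 2.
    have h1 : Z ≤ Z * (nbTerm x r j * (2 * k + 2 / y)) * y ^ (r + 1) := by
      rw [mul_assoc]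
      refine le_mul_of_one_le_right hZ0 ?_
      rw [← div_le_iff₀ (by positivity)]
      exact hlarge
    have h2 : Z * (nbTerm x r j * (2 * k + 2 / y)) * y ^ (r + 1) =
        ((k + r).choose r : ℝ) * (b * y) ^ r * (2 * k * y + 2) := by
      rw [← mul_assoc Z, hnb, mul_pow, pow_succ]
      field_simp
    rw [h2] at h1
    have h3 : 2 * (k : ℝ) * y + 2 ≤ 2 * ((k + r : ℕ) + 1) := by
      push_cast
      have : y ≤ 1 := by simp [hy, hx0.le]
      nlinarith [Nat.cast_nonneg (α := ℝ) k, Nat.cast_nonneg (α := ℝ) r]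
    calc Z ≤ _ := h1
      _ ≤ (1 + b - 1 / c) ^ (k + r) * (2 * ((k + r : ℕ) + 1)) := by gcongr
      _ = _ := by ring

/-! ### Total correctness of randomized programs -/

/-- After at least `T` steps from the configuration `⟨K, s⟩`, whatever the coins, the program has
halted with an output satisfying `OK`; with probability at least `v`, the output satisfies `Win`. -/
def Spec (OK Win : Data → Prop) (K : List Cmd) (s : Store) (T : ℕ) (v : ℝ) : Prop :=
  ∀ t ≥ T, (∀ C ∈ (runDist t ⟨K, s⟩).support, C.Halted ∧ OK C.output) ∧
    v ≤ ((runDist t ⟨K, s⟩).toOuterMeasure {C | Win C.output}).toReal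

section Spec

variable {OK Win : Data → Prop} {K : List Cmd} {s : Store} {T : ℕ} {v : ℝ}

theorem Spec.mono {T' : ℕ} {v' : ℝ} (h : Spec OK Win K s T v) (hT : T ≤ T') (hv : v' ≤ v) :
    Spec OK Win K s T' v' :=
  fun t ht => ⟨(h t (hT.trans ht)).1, hv.trans (h t (hT.trans ht)).2⟩

theorem runDist_nil (t : ℕ) (s : Store) : runDist t ⟨[], s⟩ = PMF.pure ⟨[], s⟩ := by
  induction t with
  | zero => rfl
  | succ t ih => simp [runDist, step, ih]

theorem Spec.nil (h : OK (s 0)) (hv : v ≤ ind (Win (s 0))) : Spec OK Win [] s 0 v := by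
  intro t _
  rw [runDist_nil]
  refine ⟨fun C hC => ?_, hv.trans (le_of_eq ?_)⟩
  · rw [PMF.support_pure, Set.mem_singleton_iff] at hC
    subst hC
    exact ⟨rfl, h⟩
  · rw [PMF.toOuterMeasure_pure_apply]
    by_cases hw : Win (s 0)
    · rw [ind_of hw, if_pos (show _ ∈ {C : Cfg | Win C.output} from hw), ENNReal.toReal_one]
    · rw [ind_of_not hw, if_neg (show _ ∉ {C : Cfg | Win C.output} from hw), ENNReal.toReal_zero]

theorem Spec.tri {p : Cmd} {τ : ℕ} {Q : Store → Prop} (hp : Tri p s τ Q)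
    (h : ∀ s', (∀ y, ¬p.Writes y → s' y = s y) → Q s' → Spec OK Win K s' T v) :
    Spec OK Win (p :: K) s (τ + T) v := by
  obtain ⟨t₁, s', hb, ht₁, hQ⟩ := hp
  intro t ht
  obtain ⟨t₂, rfl⟩ := Nat.exists_eq_add_of_le (show t₁ ≤ t by omega)
  rw [hb.runDist_eq]
  exact h s' hb.frame hQ t₂ (by omega)

theorem Spec.seq {p q : Cmd} (h : Spec OK Win (p :: q :: K) s T v) :
    Spec OK Win (.seq p q :: K) s (T + 1) v := by
  intro t ht
  obtain ⟨t, rfl⟩ := Nat.exists_eq_succ_of_ne_zero (show t ≠ 0 by omega)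
  have := h t (by omega)
  simpa [runDist, step] using this

theorem Spec.loop_done {e : Expr} {p : Cmd} (hc : (e.eval s).isCons = false)
    (h : Spec OK Win K s T v) : Spec OK Win (.loop e p :: K) s (T + 1) v := by
  intro t ht
  obtain ⟨t, rfl⟩ := Nat.exists_eq_succ_of_ne_zero (show t ≠ 0 by omega)
  have := h t (by omega)
  simpa [runDist, step, hc] using this

theorem Spec.loop_step {e : Expr} {p : Cmd} (hc : (e.eval s).isCons = true)
    (h : Spec OK Win (p :: .loop e p :: K) s T v) : Spec OK Win (.loop e p :: K) s (T + 1) v := by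
  intro t ht
  obtain ⟨t, rfl⟩ := Nat.exists_eq_succ_of_ne_zero (show t ≠ 0 by omega)
  have := h t (by omega)
  simpa [runDist, step, hc] using this

theorem Spec.flip {x : ℕ} {v₀ v₁ : ℝ}
    (h₀ : Spec OK Win K (Function.update s x (Data.ofBool false)) T v₀)
    (h₁ : Spec OK Win K (Function.update s x (Data.ofBool true)) T v₁) :
    Spec OK Win (.flip x :: K) s (T + 1) ((v₀ + v₁) / 2) := by
  intro t ht
  obtain ⟨t, rfl⟩ := Nat.exists_eq_succ_of_ne_zero (show t ≠ 0 by omega)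
  have e₀ := h₀ t (by omega)
  have e₁ := h₁ t (by omega)
  simp only [runDist, step]
  refine ⟨fun C hC => ?_, ?_⟩
  · rw [PMF.mem_support_bind_iff] at hC
    obtain ⟨c, -, hC⟩ := hC
    cases c with
    | false => exact e₀.1 C hC
    | true => exact e₁.1 C hC
  · have hfin : ∀ (μ : PMF Cfg) (A : Set Cfg), μ.toOuterMeasure A ≠ ∞ := fun μ A =>
      ((MeasureTheory.OuterMeasure.mono _ (Set.subset_univ A)).trans_lt (by
        show μ.toOuterMeasure Set.univ < ∞
        rw [(PMF.toOuterMeasure_apply_eq_one_iff μ _).2 (Set.subset_univ _)]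
        exact ENNReal.one_lt_top)).ne
    rw [PMF.toOuterMeasure_bind_apply, tsum_fintype, Fintype.sum_bool, PMF.uniformOfFintype_apply,
      PMF.uniformOfFintype_apply, ENNReal.toReal_add (ENNReal.mul_ne_top (by simp) (hfin _ _))
      (ENNReal.mul_ne_top (by simp) (hfin _ _)), ENNReal.toReal_mul, ENNReal.toReal_mul]
    simp only [Fintype.card_bool, Nat.cast_ofNat, ENNReal.toReal_inv, ENNReal.toReal_ofNat]
    linarith [e₀.2, e₁.2]

/-- Toss coins, as many as variable 16 says, and prepend them to the list in variable 9. -/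
def tossLoop : Cmd :=
  .loop (.var 16) (.seq (.flip 17) (.seq (.assign 9 (.cons (.var 17) (.var 9)))
    (.assign 16 (.tl (.var 16)))))

/-- Coins are prepended, so the first toss becomes the last element of the list; hence the average
is unfolded from its end by `avg_snoc`. -/
theorem Spec.tossLoop {n : ℕ} {w₀ : List Bool} {f : List Bool → ℝ} (h16 : (s 16).len = n)
    (h9 : s 9 = .ofStr w₀) (h : ∀ w, w.length = n → ∀ s', s' 9 = .ofStr (w ++ w₀) →
      (∀ y, y ≠ 9 → y ≠ 16 → y ≠ 17 → s' y = s y) → Spec OK Win K s' T (f w)) :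
    Spec OK Win (tossLoop :: K) s (n * 7 + 1 + T) (avg n f) := by
  induction n generalizing s w₀ f with
  | zero =>
    refine (Spec.loop_done (e := .var 16) ((Data.isCons_eq_false_iff_len _).2 h16) (h [] rfl s h9
      fun _ _ _ _ => rfl)).mono (by omega) le_rfl
  | succ n ih =>
    have key : ∀ b, Spec OK Win (.seq (.assign 9 (.cons (.var 17) (.var 9)))
        (.assign 16 (.tl (.var 16))) :: PhiSubset.tossLoop :: K)
        (Function.update s 17 (Data.ofBool b)) (n * 7 + 1 + T + 3)
        (avg n fun w => f (w ++ [b])) := by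
      intro b
      refine (Spec.tri (τ := 3) (T := n * 7 + 1 + T) (Q := fun s' => s' 9 = .ofStr (b :: w₀) ∧
        (s' 16).len = n) (Tri.assign_seq (Tri.assign ?_)) fun s' hf hs' => ih hs'.2 hs'.1
          fun w hw s'' h9' hs'' => ?_).mono (by omega) le_rfl
      · simp [Expr.eval, Data.len_tl, h16, h9]
      · refine h (w ++ [b]) (by simp [hw]) s'' (by simpa using h9') fun y h1 h2 h3 => ?_
        rw [hs'' y h1 h2 h3, hf y (by simp [Cmd.Writes, h1, h2]), Function.update_of_ne h3]
    rw [avg_snoc]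
    exact (Spec.loop_step ((Data.isCons_iff_len _).2 (by simp [Expr.eval, h16]))
      (Spec.seq (Spec.flip (key false) (key true)))).mono (by omega) le_rfl

end Spec

/-! ### The algorithm -/

/-- Double the time limit. -/
def doubleTime : Cmd :=
  .seq (.assign 16 (.var 8))
    (.loop (.var 16) (.seq (.assign 8 (.cons .nil (.var 8))) (.assign 16 (.tl (.var 16)))))

theorem tri_doubleTime {s : Store} {T : ℕ} (h8 : (s 8).len = T) :
    Tri doubleTime s (T * (3 + 1) + 3) fun s' => (s' 8).len = 2 * T := by
  refine (Tri.assign_seq ((Tri.loop (τ := 3) (fun i s' => (s' 16).len = i ∧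
    (s' 8).len + i = 2 * T) ?_ ?_ (n := T) ?_).conseq le_rfl ?_)).mono (by omega)
  · rintro s' ⟨h, -⟩
    exact (Data.isCons_eq_false_iff_len _).2 h
  · rintro i s' ⟨h16, h8⟩
    refine ⟨(Data.isCons_iff_len _).2 (by simp [Expr.eval, h16]), Tri.assign_seq (Tri.assign ?_)⟩
    simp [Expr.eval, Data.len_tl, h16]
    omega
  · simp [Expr.eval, h8]; omega
  · rintro s' - ⟨-, h⟩
    simpa using h

/-- Toss coins and search within the time limit; then double the time limit. -/
def phase (P : Cmd) : Cmd :=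
  .seq (.assign 9 .nil)
    (.seq (.assign 16 (.var 8))
      (.seq tossLoop
        (.seq (tryAll P)
          (.seq doubleTime (.assign 7 (.cons .nil (.var 7)))))))

/-- Repeat phases until the search is complete. -/
def mainLoop (P : Cmd) : Cmd := .loop (.var 10) (phase P)

/-- The output is a member of the collection, if there is any. -/
def Wins (Φ : ImplicitSetSystem) (I : List Bool) (d : Data) : Prop :=
  (Φ.sets I).Nonempty → ∃ S ∈ Φ.sets I, IsSetAnswer d S

/-- The left side covers one phase. Being linear in the limit `T`, the costs of the phases form a
geometric series. -/
theorem phase_time_le {n K T : ℕ} (hT : 1 ≤ T) :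
    (n + 1) * ((n + 1) * (K * (T + 1) + 17) + 11) + 11 * T + 40 ≤
      (2 * K + 80) * (n + 1) ^ 2 * T := by
  have h1 : 1 ≤ (n + 1) ^ 2 * T := Nat.mul_pos (by positivity) hT
  have h2 : (n + 1) ^ 2 * 1 ≤ (n + 1) ^ 2 * T := Nat.mul_le_mul_left _ hT
  have h3 : 1 * T ≤ (n + 1) ^ 2 * T := Nat.mul_le_mul_right _ (Nat.one_le_pow _ _ (by omega))
  have h4 : n + 1 ≤ (n + 1) ^ 2 := by nlinarith
  have h5 : K * ((n + 1) ^ 2 * 1) ≤ K * ((n + 1) ^ 2 * T) := Nat.mul_le_mul_left _ h2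
  nlinarith

/-- Induction on the number `d` of phases still possible. With `X` the cost per unit of the limit,
the time bound X·2^(J+1) - X·2^j drops by X·2^j in phase `j`, which pays for it. The failure
probability 2^(-2-j) splits into 2^(-3-j) for this phase and as much for all later ones. -/
theorem spec_mainLoop {Φ : ImplicitSetSystem} {P : Cmd} {K : ℕ} (hK : ClockFactor P K)
    {I : List Bool} {u : List (List Bool)} (hu : Lists u (Φ.univ I)) {E : ℕ → ℕ → ℕ}
    (hP : ∀ k t, t ≤ k → k ≤ u.length → AnswersWithin Φ P I t (k - t) (E k t)) {J : ℕ}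
    (hJ : ∀ k ≤ u.length, ∃ t ≤ k,
      searchCost u (2 * u.length + 2) (u.length + 3 + J) P.bound E k t < 2 ^ J)
    {d j : ℕ} (hj : j + d = J) {s : Store} {w₀ : List Bool}
    (hs : PhaseData I u (2 * u.length + 2) (u.length + 3 + j) (2 ^ j) w₀ s)
    (h11 : SafeAnswer Φ I (s 11)) (h10 : (s 10).isCons = true) :
    Spec (SafeAnswer Φ I) (Wins Φ I) [mainLoop P, .assign 0 (.var 11)] s
      ((2 * K + 80) * (u.length + 1) ^ 2 * 2 ^ (J + 1) -
        (2 * K + 80) * (u.length + 1) ^ 2 * 2 ^ j + 2) (1 - (1 / 2) ^ (2 + j)) := by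
  set X := (2 * K + 80) * (u.length + 1) ^ 2 with hX
  have hfinish : ∀ {s : Store} {v : ℝ}, SafeAnswer Φ I (s 11) → (s 10).isCons = false →
      v ≤ ind (Wins Φ I (s 11)) →
      Spec (SafeAnswer Φ I) (Wins Φ I) [mainLoop P, .assign 0 (.var 11)] s 2 v := by
    intro s v h11 h10 hv
    exact Spec.loop_done (e := .var 10) (p := phase P) h10 (Spec.tri (τ := 1) (T := 0) (Tri.assign (Q := fun s' => s' 0 = s 11)
      (by simp [Expr.eval])) fun s' _ h => Spec.nil (by rwa [h]) (by rwa [h]))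
  induction d generalizing j s w₀ with
  | zero => ?_
  | succ d ih => ?_
  all_goals
    have hT1 : 1 ≤ 2 ^ j := Nat.one_le_two_pow
    have hXT : 2 * (X * 2 ^ j) ≤ X * 2 ^ (J + 1) := by
      calc 2 * (X * 2 ^ j) = X * 2 ^ (j + 1) := by ring
        _ ≤ _ := by gcongr <;> omega
    have htime := phase_time_le (n := u.length) (K := K) hT1
    rw [← hX] at htime
    set Bad : List Bool → Prop := fun w => (Φ.sets I).Nonempty ∧ ∀ k ≤ u.length, ∃ t ≤ k,
      AllMiss Φ I u (2 * u.length + 2) (u.length + 3 + j) k t w with hBad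
    have hbad : avg (2 ^ j) (fun w => ind (Bad w)) ≤ (1 / 2) ^ (3 + j) := avg_bad_le hu j (2 ^ j)
    -- Coins that are not bad are credited with what the later phases guarantee; bad coins are
    -- charged a full unit, which makes their value at most zero.
    have hv : (1 : ℝ) - (1 / 2) ^ (2 + j) ≤
        avg (2 ^ j) fun w => (1 - (1 / 2) ^ (3 + j)) + (-1) * ind (Bad w) := by
      rw [avg_add, avg_const, avg_const_mul]
      have : (1 / 2 : ℝ) ^ (2 + j) = 2 * (1 / 2) ^ (3 + j) := by ring
      linarith
    refine (Spec.loop_step (e := .var 10) (p := phase P) h10 (Spec.seq (Spec.tri (τ := 1) (T := X * 2 ^ (J + 1) - X * 2 ^ (j + 1) + 2 +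
      ((u.length + 1) * ((u.length + 1) * (K * (2 ^ j + 1) + 17) + 11) + 11 * 2 ^ j + 30))
      (Q := fun s' => s' 9 = .nil) (Tri.assign (by simp [Expr.eval])) fun s₁ hf₁ hs₁ =>
      (Spec.seq (Spec.tri (τ := 1) (Q := fun s' => s' 16 = s₁ 8) (Tri.assign (by simp [Expr.eval]))
      fun s₂ hf₂ hs₂ => Spec.seq (Spec.tossLoop (n := 2 ^ j) (w₀ := [])
        (T := X * 2 ^ (J + 1) - X * 2 ^ (j + 1) + 2 +
          ((u.length + 1) * ((u.length + 1) * (K * (2 ^ j + 1) + 17) + 11) + 4 * 2 ^ j + 20))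
        (f := fun w => (1 - (1 / 2) ^ (3 + j)) + (-1) * ind (Bad w))
        ?_ ?_ fun w hw s₃ h9 hf₃ => ?_))).mono (by omega) hv))).mono ?_ le_rfl
    · rw [hs₂, hf₁ 8 (by simp [Cmd.Writes])]; exact hs.h8
    · rw [hf₂ 9 (by simp [Cmd.Writes]), hs₁]; rfl
    · have f : ∀ y, y ≠ 9 → y ≠ 16 → y ≠ 17 → s₃ y = s y := fun y h1 h2 h3 => by
        rw [hf₃ y h1 h2 h3, hf₂ y (by simp [Cmd.Writes, h2]), hf₁ y (by simp [Cmd.Writes, h1])]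
      have hs₃ : PhaseData I u (2 * u.length + 2) (u.length + 3 + j) (2 ^ j) w s₃ :=
        ⟨by rw [f 3 (by omega) (by omega) (by omega)]; exact hs.h3,
          by rw [f 4 (by omega) (by omega) (by omega)]; exact hs.h4,
          by rw [f 5 (by omega) (by omega) (by omega)]; exact hs.h5,
          by rw [f 6 (by omega) (by omega) (by omega)]; exact hs.h6,
          by rw [f 7 (by omega) (by omega) (by omega)]; exact hs.h7,
          by rw [f 8 (by omega) (by omega) (by omega)]; exact hs.h8, by simpa using h9⟩
      have h11' : SafeAnswer Φ I (s₃ 11) := by rwa [f 11 (by omega) (by omega) (by omega)]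
      refine (Spec.seq (Spec.tri (T := X * 2 ^ (J + 1) - X * 2 ^ (j + 1) + 2 + (4 * 2 ^ j + 8))
        (tri_tryAll hK hu (E := E) hP hw hs₃ h11')
        fun s₄ hf₄ ⟨h1, h2, h3⟩ => (Spec.seq (Spec.tri (T := X * 2 ^ (J + 1) - X * 2 ^ (j + 1) + 2 + 1)
          (tri_doubleTime (T := 2 ^ j) ?_)
          fun s₅ hf₅ h8 => (Spec.tri (τ := 1) (T := X * 2 ^ (J + 1) - X * 2 ^ (j + 1) + 2)
            (Q := fun s' => s' 7 = .cons .nil (s₅ 7))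
            (Tri.assign (by simp [Expr.eval])) fun s₆ hf₆ h7 => ?_).mono (by omega)
              le_rfl)).mono (by omega) le_rfl)).mono (by omega) le_rfl
      · rw [hf₄ 8 (not_writes_tryAll (by omega) (by omega))]; exact hs₃.h8
      have g : ∀ y, y ≠ 7 → y ≠ 8 → y ≠ 16 → s₆ y = s₄ y := fun y h1 h2 h3 => by
        rw [hf₆ y (by simp [Cmd.Writes, h1]), hf₅ y (by simp [Cmd.Writes, doubleTime, h2, h3])]
      have g10 := g 10 (by omega) (by omega) (by omega)
      have g11 := g 11 (by omega) (by omega) (by omega)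
      by_cases hdone : (s₄ 10).isCons = false
      · refine (hfinish (by rwa [g11]) (by rwa [g10]) ?_).mono (by omega) le_rfl
        rw [g11]
        by_cases hB : Bad w
        · have := ind_nonneg (Wins Φ I (s₄ 11))
          have : (0 : ℝ) ≤ (1 / 2) ^ (3 + j) := by positivity
          simp only [ind_of hB]
          linarith
        · rw [ind_of_not hB, ind_of]
          · have : (0 : ℝ) ≤ (1 / 2) ^ (3 + j) := by positivity
            linarith
          · intro hne
            rcases h1 with h1 | h1
            · rcases h2 hdone with h | h | h
              · rw [f 10 (by omega) (by omega) (by omega), h10] at h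
                simp at h
              · rw [h1] at h
                simp at h
              · exact absurd ⟨hne, h⟩ hB
            · exact h1
      -- The phase was not conclusive. For `j = J` this contradicts `hJ`; otherwise the induction
      -- hypothesis takes over.
      · first
          | (refine absurd (h3 ?_) hdone
             obtain rfl : j = J := hj
             exact hJ)
          | (refine (ih (j := j + 1) (w₀ := w) (by omega) ?_ (by rwa [g11])
              (by rw [g10]; simpa using hdone)).mono le_rfl ?_
             · have e : ∀ y, 3 ≤ y → y ≤ 9 → y ≠ 7 → y ≠ 8 → s₆ y = s₃ y := fun y h1 h2 h3 h4 => by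
                 rw [g y h3 h4 (by omega), hf₄ y (not_writes_tryAll h1 h2)]
               refine ⟨?_, ?_, ?_, ?_, ?_, ?_, ?_⟩
               · rw [e 3 (by omega) (by omega) (by omega) (by omega)]; exact hs₃.h3
               · rw [e 4 (by omega) (by omega) (by omega) (by omega)]; exact hs₃.h4
               · rw [e 5 (by omega) (by omega) (by omega) (by omega)]; exact hs₃.h5
               · rw [e 6 (by omega) (by omega) (by omega) (by omega)]; exact hs₃.h6
               · rw [h7, hf₅ 7 (by simp [doubleTime, Cmd.Writes]),
                   hf₄ 7 (not_writes_tryAll (by omega) (by omega)), Data.len_cons, hs₃.h7]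
                 ring
               · rw [hf₆ 8 (by simp [Cmd.Writes]), h8]; ring
               · rw [e 9 (by omega) (by omega) (by omega) (by omega)]; exact hs₃.h9
             · have := ind_nonneg (Bad w)
               rw [show 2 + (j + 1) = 3 + j by ring]
               linarith)
    · have : X * 2 ^ (j + 1) = 2 * (X * 2 ^ j) := by ring
      omega

/-- Compute the universe and its cardinality, and prepare the first phase. -/
def setup (PU : Cmd) : Cmd :=
  .seq (.assign 3 (.var 0))
    (.seq (call 40 PU (.var 0))
      (.seq (.assign 4 (.var 40))
        (.seq (.assign 5 .nil)
          (.seq (.assign 6 (.cons .nil (.cons .nil .nil)))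
            (.seq (.assign 16 (.var 4))
              (.seq
                (.loop (.var 16)
                  (.seq (.assign 5 (.cons .nil (.var 5)))
                    (.seq (.assign 6 (.cons .nil (.cons .nil (.var 6))))
                      (.assign 16 (.tl (.var 16))))))
                (.seq (.assign 7 (.cons .nil (.cons .nil (.cons .nil (.var 5)))))
                  (.seq (.assign 8 (.cons .nil .nil))
                    (.assign 10 (.cons .nil .nil))))))))))

theorem tri_setup {Φ : ImplicitSetSystem} {PU : Cmd} {I : List Bool} {τ : ℕ}
    (h : ∃ t s', BigStep PU (Function.update (fun _ => Data.nil) 0 (.ofStr I)) t s' ∧ t ≤ τ ∧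
      ∃ l, Lists l (Φ.univ I) ∧ s' 0 = .ofStrs l) :
    Tri (setup PU) (Function.update (fun _ => Data.nil) 0 (.ofStr I))
      (τ + 2 * PU.bound + 6 * (Φ.univ I).card + 23) fun s =>
      ∃ u, Lists u (Φ.univ I) ∧ PhaseData I u (2 * u.length + 2) (u.length + 3) 1 [] s ∧
        (s 10).isCons = true ∧ s 11 = .nil := by
  refine (Tri.assign_seq (Tri.seq_of (τ := τ + 2 * PU.bound + 4)
    (τ' := 6 * (Φ.univ I).card + 16) (Tri.call (d := .ofStr I)
    (Q := fun d => ∃ l, Lists l (Φ.univ I) ∧ d = .ofStrs l) ?_ h) fun s₁ hf₁ ⟨u, hu, hs₁⟩ =>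
      (Tri.assign_seq (Tri.assign_seq (Tri.assign_seq (Tri.assign_seq (Tri.seq_of
        (τ := 6 * (Φ.univ I).card + 1) (τ' := 5)
        ((Tri.loop (τ := 5) (fun i s' => ∃ a, a + i = u.length ∧ (s' 16).len = i ∧
          s' 5 = .ofNat a ∧ (s' 6).len = 2 * a + 2) ?_ ?_ (n := u.length) ?_).mono ?_)
        fun s₂ hf₂ hs₂ => Tri.assign_seq (Tri.assign_seq (Tri.assign ?_))))))).mono
          (by omega))).mono (by omega)
  · intro s' hs'
    simp [Expr.eval, hs' 0]
  · rintro s' ⟨a, -, h, -⟩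
    exact (Data.isCons_eq_false_iff_len _).2 h
  · rintro i s' ⟨a, ha, h16, h5, h6⟩
    refine ⟨(Data.isCons_iff_len _).2 (by simp [Expr.eval, h16]),
      Tri.assign_seq (Tri.assign_seq (Tri.assign ⟨a + 1, by omega, ?_⟩))⟩
    simp [Expr.eval, Data.len_tl, h16, h5, h6, Data.ofNat_succ]
    ring
  · exact ⟨0, by simp, by simp [Expr.eval, hs₁], by simp [Expr.eval], by simp [Expr.eval]⟩
  · rw [← hu.2, List.toFinset_card_of_nodup hu.1]; omega
  · obtain ⟨a, ha, -, h5, h6⟩ := hs₂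
    obtain rfl : a = u.length := by omega
    have f₁ : ∀ y < 40, ¬(call 40 PU (.var 0)).Writes y := fun y hy hw =>
      absurd (le_of_writes_call hw) (by omega)
    have f : ∀ y < 40, y ≠ 3 → y ≠ 4 → y ≠ 5 → y ≠ 6 → y ≠ 16 → y ≠ 0 → s₂ y = .nil :=
      fun y hy h3 h4 h5 h6 h16 h0 => by
        rw [hf₂ y (by simp [Cmd.Writes, h5, h6, h16])]
        simp only [Function.update_of_ne h4, Function.update_of_ne h5, Function.update_of_ne h6,
          Function.update_of_ne h16]
        rw [hf₁ y (f₁ y hy)]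
        simp only [Function.update_of_ne h3, Function.update_of_ne h0]
    have h3 : s₂ 3 = .ofStr I := by
      rw [hf₂ 3 (by simp [Cmd.Writes])]
      simpa [Expr.eval] using hf₁ 3 (f₁ 3 (by omega))
    have h4 : s₂ 4 = .ofStrs u := by
      rw [hf₂ 4 (by simp [Cmd.Writes])]
      simpa [Expr.eval] using hs₁
    refine ⟨u, hu, ⟨?_, ?_, ?_, ?_, ?_, ?_, ?_⟩, ?_, ?_⟩
    all_goals simp [Expr.eval, h3, h4, h5, h6, f 9, f 11]

/-! ### The total running time -/

theorem answersWithin_of_solvesExtension {Φ : ImplicitSetSystem} {P : Cmd} {p : Polynomial ℕ}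
    {b c : ℝ} (hb : 1 ≤ b) (hc : 1 ≤ c)
    (h : Φ.SolvesExtension P fun I X k =>
      b ^ ((Φ.univ I).card - X.card) * c ^ k * ((p.eval I.length : ℕ) : ℝ))
    (I : List Bool) (t d : ℕ) :
    AnswersWithin Φ P I t d
      ⌊b ^ ((Φ.univ I).card - t) * c ^ d * ((p.eval I.length : ℕ) : ℝ)⌋₊ := by
  intro l k hl hu ht hk
  obtain ⟨r, hr, hr'⟩ := h.2 I l.toFinset l k hu ⟨hl, rfl⟩
  obtain ⟨τ, s', hb', hτ, hs'⟩ := hr'.exists_bigStep h.1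
  refine ⟨r, hr, τ, s', hb', Nat.le_floor (hτ.trans ?_), hs'⟩
  simp only [List.toFinset_card_of_nodup hl]
  gcongr

theorem searchTime_le {n t R E : ℕ} (ht : t ≤ n) (hR : 1 ≤ R) :
    searchTime n (2 * n + 2) t R E ≤ 144 * (R * (n + 1) ^ 3 * (E + 1)) := by
  obtain ⟨R, rfl⟩ := Nat.exists_eq_add_of_le' hR
  have h1 : t * ((R + 1) * (10 * n + 6) + 16) ≤ n * ((R + 1) * (10 * n + 6) + 16) := by gcongr
  have h2 : t * ((2 * n + 2) * (11 * n + 23) + 4 * n + 16) ≤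
      n * ((2 * n + 2) * (11 * n + 23) + 4 * n + 16) := by gcongr
  have h3 := Nat.mul_le_mul_left (R + 1) h2
  have h4 : searchTime n (2 * n + 2) t (R + 1) E ≤ n * ((R + 1) * (10 * n + 6) + 16) +
      (R + 1) * (n * ((2 * n + 2) * (11 * n + 23) + 4 * n + 16) + E + 18) + n * (E + 13) + 25 := by
    unfold searchTime
    gcongr
  refine h4.trans ?_
  zify
  -- The constant 144 is large enough that only non-negative coefficients remain after expansion.
  have : (0 : ℤ) ≤ 144 * ((R + 1) * (n + 1) ^ 3 * (E + 1)) - (n * ((R + 1) * (10 * n + 6) + 16) +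
      (R + 1) * (n * ((2 * n + 2) * (11 * n + 23) + 4 * n + 16) + E + 18) + n * (E + 13) + 25) := by
    ring_nf
    positivity
  linarith

theorem searchCost_le {u : List (List Bool)} {k t J B e p : ℕ} {F : ℝ} (ht : t ≤ k)
    (hk : k ≤ u.length) (hF : 1 ≤ F) (he : (e : ℝ) ≤ F * p) (E : ℕ → ℕ → ℕ) (hE : E k t = e) :
    (searchCost u (2 * u.length + 2) (u.length + 3 + J) B E k t : ℝ) ≤
      144 * (u.length + 1) ^ 3 * (p + 2 * B + 1) * (2 * u.length + 3 + J) *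
        (ratio u.length k t * F) := by
  have hR : 1 ≤ reps u.length k (u.length + 3 + J) t :=
    le_trans (show 1 ≤ u.length + 3 + J by omega) (reps_mono (Nat.zero_le t) ht hk)
  have h1 : (searchCost u (2 * u.length + 2) (u.length + 3 + J) B E k t : ℝ) ≤
      ((144 * (reps u.length k (u.length + 3 + J) t * (u.length + 1) ^ 3 *
        (e + 2 * B + 1)) : ℕ) : ℝ) := by
    have := searchTime_le (E := e + 2 * B) (ht.trans hk) hR
    rw [← hE] at this ⊢
    exact_mod_cast this
  refine h1.trans ?_
  push_cast
  -- The factor 2n + 3 + J bounds the repetition parameter n + 3 + J plus the `t ≤ n` roundings.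
  have h2 : (reps u.length k (u.length + 3 + J) t : ℝ) ≤
      (2 * u.length + 3 + J) * ratio u.length k t := by
    refine (reps_le_mul_ratio _ ht hk).trans ?_
    have h3 := (ratio_pos ht hk).le
    have h4 : (t : ℝ) ≤ u.length := by exact_mod_cast ht.trans hk
    push_cast
    exact mul_le_mul_of_nonneg_right (by linarith) h3
  have h3 : (e : ℝ) + 2 * B + 1 ≤ F * (p + 2 * B + 1) := by
    have : (0 : ℝ) ≤ 2 * B + 1 := by positivity
    nlinarith
  calc 144 * ((reps u.length k (u.length + 3 + J) t : ℝ) * (u.length + 1) ^ 3 * (e + 2 * B + 1))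
      ≤ 144 * (((2 * u.length + 3 + J) * ratio u.length k t) * (u.length + 1) ^ 3 *
        (F * (p + 2 * B + 1))) := by
        have := (ratio_pos ht hk).le
        gcongr
    _ = _ := by ring

/-- The cost of a search itself grows linearly with the phase number, so `J` stands on both sides.
Taking log β + log(g + log β) + 2 resolves this at the price of a logarithmic factor. -/
theorem exists_mul_add_lt_two_pow {β : ℕ} (hβ : 1 ≤ β) {g : ℕ} (hg : 1 ≤ g) :
    ∃ J, β * (g + J) < 2 ^ J ∧ 2 ^ J ≤ 16 * (β * (g + Nat.clog 2 β)) := by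
  have key : ∀ x, 1 ≤ x → 2 ^ Nat.clog 2 x ≤ 2 * x := by
    intro x hx
    rcases hx.eq_or_lt with rfl | hx
    · simp
    · have h1 := Nat.pow_pred_clog_lt_self (b := 2) (by omega) hx
      have h2 : 0 < Nat.clog 2 x := Nat.clog_pos (by omega) hx
      obtain ⟨a, ha⟩ := Nat.exists_eq_succ_of_ne_zero h2.ne'
      rw [ha] at h1 ⊢
      rw [pow_succ]
      simp only [Nat.pred_succ] at h1
      omega
  set a := Nat.clog 2 β
  set q := Nat.clog 2 (g + a) with hq
  have ha := Nat.le_pow_clog (b := 2) (by omega) β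
  have hq' := Nat.le_pow_clog (b := 2) (by omega) (g + a)
  rw [← hq] at hq'
  have hlt : q < 2 ^ q := Nat.lt_two_pow_self
  have e : (2 : ℕ) ^ (a + (q + 2)) = 2 ^ a * (4 * 2 ^ q) := by ring
  refine ⟨a + (q + 2), ?_, ?_⟩
  · rw [e]
    calc β * (g + (a + (q + 2))) ≤ 2 ^ a * (g + (a + (q + 2))) := Nat.mul_le_mul_right _ ha
      _ < 2 ^ a * (4 * 2 ^ q) := Nat.mul_lt_mul_of_pos_left (by omega) (by positivity)
  · rw [e]
    calc 2 ^ a * (4 * 2 ^ q) ≤ (2 * β) * (4 * (2 * (g + a))) :=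
          Nat.mul_le_mul (key β hβ) (Nat.mul_le_mul_left _ (key _ (by omega)))
      _ = _ := by ring

/-- The randomized algorithm for the subset problem, given algorithms for the universe and for the
extension problem. -/
def subsetAlgorithm (PU P : Cmd) : Cmd :=
  .seq (setup PU) (.seq (mainLoop P) (.assign 0 (.var 11)))

theorem spec_subsetAlgorithm {Φ : ImplicitSetSystem} {P PU : Cmd} {K : ℕ} (hK : ClockFactor P K)
    {I : List Bool} {τ J : ℕ}
    (hU : ∃ t s', BigStep PU (Function.update (fun _ => Data.nil) 0 (.ofStr I)) t s' ∧ t ≤ τ ∧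
      ∃ l, Lists l (Φ.univ I) ∧ s' 0 = .ofStrs l) {E : ℕ → ℕ → ℕ}
    (hP : ∀ k t, t ≤ k → k ≤ (Φ.univ I).card → AnswersWithin Φ P I t (k - t) (E k t))
    (hJ : ∀ u, Lists u (Φ.univ I) → ∀ k ≤ u.length, ∃ t ≤ k,
      searchCost u (2 * u.length + 2) (u.length + 3 + J) P.bound E k t < 2 ^ J) :
    Spec (SafeAnswer Φ I) (Wins Φ I) [subsetAlgorithm PU P]
      (Function.update (fun _ => Data.nil) 0 (.ofStr I))
      (τ + 2 * PU.bound + 6 * (Φ.univ I).card + 27 +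
        (2 * K + 80) * ((Φ.univ I).card + 1) ^ 2 * 2 ^ (J + 1)) (3 / 4) := by
  refine (Spec.seq (Spec.tri (tri_setup hU) (T := 1 + (2 +
    (2 * K + 80) * ((Φ.univ I).card + 1) ^ 2 * 2 ^ (J + 1)))
    fun s _ ⟨u, hu, hd, h10, h11⟩ => ?_)).mono (by omega) le_rfl
  have hn : u.length = (Φ.univ I).card := by
    rw [← hu.2, List.toFinset_card_of_nodup hu.1]
  rw [← hn] at hP ⊢
  exact (Spec.seq ((spec_mainLoop hK hu hP (hJ u hu) (j := 0) (d := J) (by omega)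
    hd (.inl h11) h10).mono le_rfl le_rfl)).mono (by omega) (by norm_num)

/-- A bound for the cost of a search, apart from the factor exponential in the size of the universe
and the factor linear in the number of the phase. -/
noncomputable def costPoly (p : Polynomial ℕ) (B : ℕ) : Polynomial ℕ :=
  288 * (.X + 1) ^ 4 * (p + Polynomial.C (2 * B + 1))

/-- The polynomial factor of the running time, where `2 ^ α` bounds the basis of the exponential
factor. -/
noncomputable def timePoly (pU p : Polynomial ℕ) (BU B K α : ℕ) : Polynomial ℕ :=
  pU + Polynomial.C (2 * BU) + 6 * .X + 27 + Polynomial.C (2 * K + 80) * (.X + 1) ^ 2 *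
    (64 * costPoly p B * (2 * .X + 4 + costPoly p B + Polynomial.C α * .X))

/-- With `W` the polynomial factor and A = 1+b-1/c, the cost for the best `t` is at most β(2n+3+J)
for β = ⌈W A^n⌉. The bound `A ≤ 2 ^ α` keeps log β polynomial, so A^n enters 2^J only once. -/
theorem exists_phase {Φ : ImplicitSetSystem} {p : Polynomial ℕ} {b c : ℝ} (hb : 1 ≤ b) (hc : 1 ≤ c)
    {α : ℕ} (hα : 1 + b - 1 / c ≤ 2 ^ α) (B : ℕ) (I : List Bool) :
    ∃ J : ℕ, (∀ u, Lists u (Φ.univ I) → ∀ k ≤ u.length, ∃ t ≤ k,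
      searchCost u (2 * u.length + 2) (u.length + 3 + J) B (fun k t =>
        ⌊b ^ ((Φ.univ I).card - t) * c ^ (k - t) * ((p.eval I.length : ℕ) : ℝ)⌋₊) k t < 2 ^ J) ∧
      (2 : ℝ) ^ (J + 1) ≤ (1 + b - 1 / c) ^ (Φ.univ I).card * ((64 * (costPoly p B).eval I.length *
        (2 * I.length + 4 + (costPoly p B).eval I.length + α * I.length) : ℕ) : ℝ) := by
  set N := I.length
  set n := (Φ.univ I).card with hn
  have hnN : n ≤ N := Φ.card_univ_le I
  set W := (costPoly p B).eval N with hW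
  have hWe : W = 288 * (N + 1) ^ 4 * (p.eval N + (2 * B + 1)) := by simp [hW, costPoly]
  have hW1 : 1 ≤ W := by rw [hWe]; exact Nat.mul_pos (by positivity) (by omega)
  have hc' : 1 / c ≤ 1 := (div_le_one (by linarith)).2 hc
  set A := 1 + b - 1 / c
  have hA : 1 ≤ A := by simp only [A]; linarith
  have hAn : 1 ≤ A ^ n := one_le_pow₀ hA
  have hW1' : (1 : ℝ) ≤ W := by exact_mod_cast hW1
  have hWA : 1 ≤ W * A ^ n := by nlinarith
  set β := ⌈W * A ^ n⌉₊ with hβ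
  have hβ1 : 1 ≤ β := Nat.one_le_ceil_iff.2 (by linarith)
  have hβ2 : (β : ℝ) ≤ 2 * W * A ^ n := by
    have := (Nat.ceil_lt_add_one (show 0 ≤ W * A ^ n by linarith)).le
    linarith
  have hlog : Nat.clog 2 β ≤ 1 + W + α * N := by
    refine Nat.clog_le_of_le_pow ?_
    have h1 : (W : ℝ) ≤ 2 ^ W := by exact_mod_cast Nat.lt_two_pow_self.le
    have h2 : A ^ n ≤ 2 ^ (α * N) := by
      calc A ^ n ≤ (2 ^ α) ^ n := by gcongr
        _ = 2 ^ (α * n) := (pow_mul _ _ _).symm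
        _ ≤ 2 ^ (α * N) := by gcongr; norm_num
    have h3 : (β : ℝ) ≤ 2 ^ (1 + W + α * N) := by
      calc (β : ℝ) ≤ 2 * W * A ^ n := hβ2
        _ ≤ 2 * 2 ^ W * 2 ^ (α * N) := by gcongr
        _ = _ := by ring
    exact_mod_cast h3
  obtain ⟨J, hJ, hJ'⟩ := exists_mul_add_lt_two_pow hβ1 (g := 2 * n + 3) (by omega)
  refine ⟨J, fun u hu k hk => ?_, ?_⟩
  · have hun : u.length = n := by rw [hn, ← hu.2, List.toFinset_card_of_nodup hu.1]
    obtain ⟨t, ht, hr⟩ := exists_good_sample_card hb hc (hk.trans_eq hun)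
    refine ⟨t, ht, ?_⟩
    have hF : 1 ≤ b ^ (n - t) * c ^ (k - t) := one_le_mul_of_one_le_of_one_le (one_le_pow₀ hb)
      (one_le_pow₀ hc)
    have hcost := searchCost_le (J := J) (B := B) (p := p.eval N) ht hk hF (Nat.floor_le (by positivity))
      (fun k t => ⌊b ^ (n - t) * c ^ (k - t) * ((p.eval N : ℕ) : ℝ)⌋₊) rfl
    have h1 : (u.length : ℝ) ≤ N := by exact_mod_cast hun.trans_le hnN
    have h2 : (144 * (u.length + 1) ^ 3 * (p.eval N + 2 * B + 1) * (2 * u.length + 3 + J) *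
        (ratio u.length k t * (b ^ (n - t) * c ^ (k - t))) : ℝ) ≤
        ((β * (2 * n + 3 + J) : ℕ) : ℝ) := by
      rw [← hun] at hr
      calc (144 * (u.length + 1) ^ 3 * (p.eval N + 2 * B + 1) * (2 * u.length + 3 + J) *
            (ratio u.length k t * (b ^ (n - t) * c ^ (k - t))) : ℝ)
          ≤ 144 * (u.length + 1) ^ 3 * (p.eval N + 2 * B + 1) * (2 * u.length + 3 + J) *
            (2 * (u.length + 1) * A ^ n) := by
            rw [← hun]
            gcongr
        _ = (288 * (u.length + 1) ^ 4 * (p.eval N + (2 * B + 1)) * A ^ n) *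
              (2 * u.length + 3 + J) := by ring
        _ ≤ (288 * (N + 1) ^ 4 * (p.eval N + (2 * B + 1)) * A ^ n) *
              (2 * u.length + 3 + J) := by gcongr
        _ = (W * A ^ n) * (2 * n + 3 + J) := by rw [hWe, hun]; push_cast; ring
        _ ≤ ((β * (2 * n + 3 + J) : ℕ) : ℝ) := by
            push_cast
            gcongr
            exact Nat.le_ceil _
    exact lt_of_le_of_lt (by exact_mod_cast hcost.trans h2) hJ
  · have h1 : (2 : ℝ) ^ J ≤ 16 * (β * (2 * n + 3 + Nat.clog 2 β)) := by exact_mod_cast hJ'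
    have h2 : (Nat.clog 2 β : ℝ) ≤ 1 + W + α * N := by exact_mod_cast hlog
    have h3 : (n : ℝ) ≤ N := by exact_mod_cast hnN
    calc (2 : ℝ) ^ (J + 1) = 2 * 2 ^ J := by ring
      _ ≤ 2 * (16 * ((2 * W * A ^ n) * (2 * N + 3 + (1 + W + α * N)))) := by
          refine mul_le_mul_of_nonneg_left (h1.trans ?_) (by norm_num)
          gcongr
      _ = _ := by push_cast; ring

theorem randomizedSolvesSubset_of_spec {Φ : ImplicitSetSystem} {A : Cmd} {T : List Bool → ℝ}
    (h : ∀ I, ∃ t : ℕ, (t : ℝ) ≤ T I ∧ Spec (SafeAnswer Φ I) (Wins Φ I) [A]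
      (Function.update (fun _ => Data.nil) 0 (.ofStr I)) t (3 / 4)) :
    Φ.RandomizedSolvesSubset A T := by
  intro I
  obtain ⟨t, ht, hs⟩ := h I
  obtain ⟨h1, h2⟩ := hs t le_rfl
  refine ⟨t, ht, h1, fun hne => ?_⟩
  have e : {C : Cfg | Wins Φ I C.output} = {C | ∃ S ∈ Φ.sets I, IsSetAnswer C.output S} :=
    Set.ext fun C => ⟨fun h => h hne, fun h _ => h⟩
  rw [e] at h2
  by_contra hle
  have := ENNReal.toReal_mono (by simp) (not_lt.1 hle)
  rw [ENNReal.toReal_div, ENNReal.toReal_one, ENNReal.toReal_ofNat] at this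
  unfold start at this
  linarith

end PhiSubset

theorem theorem1 (Φ : PhiSubset.ImplicitSetSystem) (hΦ : Φ.PolyTimeComputable)
    (b c : ℝ) (hb : 1 ≤ b) (hc : 1 ≤ c)
    (hext : ∃ (P : PhiSubset.Cmd) (p : Polynomial ℕ), Φ.SolvesExtension P fun I X k =>
      b ^ ((Φ.univ I).card - X.card) * c ^ k * ((p.eval I.length : ℕ) : ℝ)) :
    ∃ (A : PhiSubset.Cmd) (q : Polynomial ℕ), Φ.RandomizedSolvesSubset A fun I =>
      (1 + b - 1 / c) ^ (Φ.univ I).card * ((q.eval I.length : ℕ) : ℝ) := by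
  open PhiSubset in
  obtain ⟨P, p, hP⟩ := hext
  obtain ⟨⟨PU, hPU, pU, hU⟩, -⟩ := hΦ
  obtain ⟨K, hK⟩ := exists_clockFactor hP.1
  -- `α` is a constant depending on `b` and `c` only; it enters the time bound but not the program.
  obtain ⟨α, hα⟩ := pow_unbounded_of_one_lt (1 + b - 1 / c) (one_lt_two (α := ℝ))
  refine ⟨subsetAlgorithm PU P, timePoly pU p PU.bound P.bound K α,
    randomizedSolvesSubset_of_spec fun I => ?_⟩
  obtain ⟨t, s', hb', ht, hQ⟩ := (hU I).exists_bigStep hPU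
  obtain ⟨J, hJ, hJ'⟩ := exists_phase (Φ := Φ) (p := p) hb hc hα.le P.bound I
  refine ⟨_, ?_, spec_subsetAlgorithm hK ⟨t, s', hb', by exact_mod_cast ht, hQ⟩
    (fun k t _ _ => answersWithin_of_solvesExtension hb hc hP I t (k - t)) hJ⟩
  have hc' : 1 / c ≤ 1 := (div_le_one (by linarith)).2 hc
  have hA : 1 ≤ (1 + b - 1 / c) ^ (Φ.univ I).card := one_le_pow₀ (by linarith)
  have hn : ((Φ.univ I).card : ℝ) ≤ I.length := by exact_mod_cast Φ.card_univ_le I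
  simp only [timePoly, Polynomial.eval_add, Polynomial.eval_mul, Polynomial.eval_C,
    Polynomial.eval_X, Polynomial.eval_pow, Polynomial.eval_one, Polynomial.eval_ofNat]
  push_cast at hJ' ⊢
  set M : ℝ := (1 + b - 1 / c) ^ (Φ.univ I).card
  set W : ℝ := (((costPoly p P.bound).eval I.length : ℕ) : ℝ)
  set V : ℝ := 64 * W * (2 * I.length + 4 + W + α * I.length)
  have h1 : ((2 * K + 80) * ((Φ.univ I).card + 1) ^ 2 * 2 ^ (J + 1) : ℝ) ≤
      (2 * K + 80) * (I.length + 1) ^ 2 * (M * V) := by gcongr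
  have h2 : ((pU.eval I.length : ℕ) : ℝ) + 2 * PU.bound + 6 * (Φ.univ I).card + 27 ≤
      M * (((pU.eval I.length : ℕ) : ℝ) + 2 * PU.bound + 6 * I.length + 27) := by
    refine le_trans ?_ (le_mul_of_one_le_left (by positivity) hA)
    gcongr
  linarith
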